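/- Let $K$ be an algebraically closed field. A triangulation quiver is a pair $(Q,f)$, where $Q=(Q_0,Q_1,s,t)$ is a finite connected quiver in which every vertex is the source of exactly two arrows and the target of exactly two arrows, and $f$ is a permutation of $Q_1$ with $f^3=\mathrm{id}$ and $s(f(\alpha))=t(\alpha)$ for all $\alpha\in Q_1$. For $\alpha\in Q_1$ let $\bar\alpha\neq\alpha$ be the other arrow with source $s(\alpha)$, let $g$ be the permutation $g(\alpha)=\overline{f(\alpha)}$ of $Q_1$, and let $n_\alpha$ be the size of the $g$-orbit of $\alpha$. Let $m_\bullet$ and $c_\bullet$ be functions on the set of $g$-orbits with values $m_\alpha\in\{1,2,3,\dots\}$ and $c_\alpha\in K\setminus\{0\}$, such that $m_\alpha n_\alpha\ge 3$ for all arrows $\alpha$. Let $A_\alpha=\alpha\,g(\alpha)\,g^2(\alpha)\cdots$ be the path of length $m_\alpha n_\alpha-1$ along the $g$-orbit of $\alpha$ (paths are composed from left to right). The weighted triangulation algebra $\Lambda=\Lambda(Q,f,m_\bullet,c_\bullet)$ is the quotient of the path algebra $KQ$ by the ideal generated by $\alpha f(\alpha)-c_{\bar\alpha}A_{\bar\alpha}$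 and $\alpha f(\alpha)g(f(\alpha))$ for all $\alpha\in Q_1$. It is called a tetrahedral algebra if all $m_\alpha$ are equal to $1$ and $(Q,f)$ is isomorphic to the tetrahedral triangulation quiver, which has vertices $1,\dots,6$ and twelve arrows, forming the four $f$-orbits $1\to5\to4\to1$, $2\to6\to4\to2$, $3\to2\to5\to3$, $3\to1\to6\to3$. **Theorem 7.4.** Assume that $Q$ has at least three vertices and that $\Lambda$ is not a tetrahedral algebra. Let $\Lambda^e=\Lambda^{\mathrm{op}}\otimes_K\Lambda$, so that $\Lambda^e$-modules are $\Lambda$-$\Lambda$-bimodules, and let $\Omega_{\Lambda^e}(M)$ denote the kernel of a projective cover of $M$. Then there is an isomorphism $\Omega^4_{\Lambda^e}(\Lambda)\cong\Lambda$ of $\Lambda$-$\Lambda$-bimodules. In particular, $\Lambda$ is a periodic algebra of period $4$, that is, $\Lambda$ is finite-dimensional over $K$ and $4$ is the least integer $n\ge1$ with $\Omega^n_{\Lambda^e}(\Lambda)\cong\Lambda$ as bimodules. -/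

import Mathlib

open scoped TensorProduct

universe u w

noncomputable section

/-! ### Syzygies and periodicity -/

/-- `p : P → M` is a (minimal) projective cover: `P` is projective, `p` is surjective, and the
kernel of `p` is superfluous in `P`. -/
def IsProjectiveCover {R : Type*} [Ring R] {P M : Type*} [AddCommGroup P] [Module R P]
    [AddCommGroup M] [Module R M] (p : P →ₗ[R] M) : Prop :=
  Module.Projective R P ∧ Function.Surjective p ∧
    ∀ N : Submodule R P, N ⊔ LinearMap.ker p = ⊤ → N = ⊤

/-- `IsSyzygy R n M N` says that `N` is isomorphic to the `n`-th syzygy `Ωⁿ(M)` of the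
`R`-module `M`, where `Ω⁰(M) = M`, `Ωⁿ⁺¹(M) = Ωⁿ(Ω(M))` and `Ω(M)` is the kernel of a projective
cover of `M` (projective covers being unique up to isomorphism). -/
def IsSyzygy (R : Type u) [Ring R] : ℕ → ∀ (M N : Type w) [AddCommGroup M] [Module R M]
    [AddCommGroup N] [Module R N], Prop
  | 0, M, N, _, _, _, _ => Nonempty (N ≃ₗ[R] M)
  | n + 1, M, N, _, _, _, _ =>
      ∃ (P : Type w) (_ : AddCommGroup P) (_ : Module R P) (p : P →ₗ[R] M),
        IsProjectiveCover p ∧ IsSyzygy R n (LinearMap.ker p) N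

section Bimodules

attribute [local instance] TensorProduct.Algebra.module

/-- `A`-`A`-bimodules (with `K` acting centrally) are modules over `A ⊗[K] Aᵐᵒᵖ`; the bimodule `A`
has the action `(a ⊗ op b) • x = a * x * b`. The proposition says that the `n`-th syzygy of `A` as
a bimodule is isomorphic to `A` as a bimodule. -/
def BimoduleSyzygyIsoSelf (K A : Type*) [Field K] [Ring A] [Algebra K A] (n : ℕ) : Prop :=
  IsSyzygy (A ⊗[K] Aᵐᵒᵖ) n A A

end Bimodules

/-- `A` is a (finite-dimensional) periodic algebra of period `d`: `d` is the least positive `n`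
such that the `n`-th bimodule syzygy of `A` is isomorphic to `A`. -/
def IsPeriodicAlgebraOfPeriod (K A : Type*) [Field K] [Ring A] [Algebra K A] (d : ℕ) : Prop :=
  Module.Finite K A ∧ IsLeast {n : ℕ | 0 < n ∧ BimoduleSyzygyIsoSelf K A n} d

/-! ### Triangulation quivers -/

/-- A triangulation quiver with vertex set `V` and arrow set `E`. -/
structure TriangulationQuiver (V E : Type*) where
  source : E → V
  target : E → V
  f : Equiv.Perm E
  connected : ∀ i j : V, Relation.EqvGen (fun a b => ∃ α, source α = a ∧ target α = b) i j
  two_source : ∀ i : V, {α | source α = i}.ncard = 2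
  two_target : ∀ i : V, {α | target α = i}.ncard = 2
  source_f : ∀ α, source (f α) = target α
  f_cube : ∀ α, f (f (f α)) = α

namespace TriangulationQuiver

section Combinatorics

variable {V E : Type*} (T : TriangulationQuiver V E)

theorem existsUnique_bar (α : E) : ∃! β, T.source β = T.source α ∧ β ≠ α := by
  obtain ⟨x, y, hxy, h⟩ := Set.ncard_eq_two.1 (T.two_source (T.source α))
  have key : ∀ β, T.source β = T.source α ↔ β = x ∨ β = y := fun β => by
    have := Set.ext_iff.1 h β
    simpa using this
  rcases (key α).1 rfl with rfl | rfl
  · exact ⟨y, ⟨(key y).2 (Or.inr rfl), hxy.symm⟩,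
      fun z hz => ((key z).1 hz.1).resolve_left hz.2⟩
  · exact ⟨x, ⟨(key x).2 (Or.inl rfl), hxy⟩,
      fun z hz => ((key z).1 hz.1).resolve_right hz.2⟩

/-- The other arrow with the same source as `α`. -/
def bar (α : E) : E := (T.existsUnique_bar α).choose

theorem source_bar (α : E) : T.source (T.bar α) = T.source α :=
  (T.existsUnique_bar α).choose_spec.1.1

theorem bar_ne (α : E) : T.bar α ≠ α := (T.existsUnique_bar α).choose_spec.1.2

theorem bar_involutive : Function.Involutive T.bar := fun α =>
  (T.existsUnique_bar (T.bar α)).unique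
    ⟨T.source_bar (T.bar α), T.bar_ne (T.bar α)⟩
    ⟨(T.source_bar α).symm, (T.bar_ne α).symm⟩

/-- The permutation `g`, given by `g α = bar (f α)`. -/
def g : Equiv.Perm E := T.f.trans T.bar_involutive.toPerm

theorem g_apply (α : E) : T.g α = T.bar (T.f α) := rfl

/-- The set of `g`-orbits of arrows. -/
def Orbit : Type _ := Quotient (Equiv.Perm.SameCycle.setoid T.g)

/-- The `g`-orbit of an arrow. -/
def orbit (α : E) : T.Orbit := Quotient.mk (Equiv.Perm.SameCycle.setoid T.g) α

/-- The length `n_α` of the `g`-orbit of `α`, i.e. the least `n > 0` with `gⁿ(α) = α`. -/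
def orbitLength (α : E) : ℕ := Function.minimalPeriod T.g α

/-- An isomorphism of triangulation quivers. -/
structure Iso {V' E' : Type*} (T' : TriangulationQuiver V' E') where
  vertices : V ≃ V'
  arrows : E ≃ E'
  source_arrows : ∀ α, T'.source (arrows α) = vertices (T.source α)
  target_arrows : ∀ α, T'.target (arrows α) = vertices (T.target α)
  f_arrows : ∀ α, T'.f (arrows α) = arrows (T.f α)

end Combinatorics

/-- The sources of the arrows of the tetrahedral triangulation quiver: its `f`-orbits are the four
oriented triangles `1 → 5 → 4 → 1`, `2 → 6 → 4 → 2`, `3 → 2 → 5 → 3`, `3 → 1 → 6 → 3`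
(the vertices `1, …, 6` are written here as `0, …, 5`). -/
def tetrahedralVertex (a : Fin 4 × Fin 3) : Fin 6 :=
  (![![0, 4, 3], ![1, 5, 3], ![2, 1, 4], ![2, 0, 5]] : Fin 4 → Fin 3 → Fin 6) a.1 a.2

/-- The tetrahedral triangulation quiver. The arrow `(k, r)` is the `r`-th arrow of the `k`-th
oriented triangle. -/
def tetrahedral : TriangulationQuiver (Fin 6) (Fin 4 × Fin 3) where
  source := tetrahedralVertex
  target a := tetrahedralVertex (a.1, a.2 + 1)
  f := (Equiv.refl (Fin 4)).prodCongr (Equiv.addRight (1 : Fin 3))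
  connected := by
    have key : ∀ i j : Fin 6, ∃ α β : Fin 4 × Fin 3,
        (tetrahedralVertex α = i ∧ tetrahedralVertex (α.1, α.2 + 1) = tetrahedralVertex β ∨
          tetrahedralVertex (α.1, α.2 + 1) = i ∧ tetrahedralVertex α = tetrahedralVertex β) ∧
        (tetrahedralVertex β = j ∨ tetrahedralVertex (β.1, β.2 + 1) = j) := by decide
    intro i j
    obtain ⟨α, β, h, h'⟩ := key i j
    have h1 : Relation.EqvGen (fun a b => ∃ α, tetrahedralVertex α = a ∧
        tetrahedralVertex (α.1, α.2 + 1) = b) i (tetrahedralVertex β) := by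
      rcases h with ⟨h1, h2⟩ | ⟨h1, h2⟩
      · exact Relation.EqvGen.rel _ _ ⟨α, h1, h2⟩
      · exact Relation.EqvGen.symm _ _ (Relation.EqvGen.rel _ _ ⟨α, h2, h1⟩)
    rcases h' with h' | h'
    · exact h' ▸ h1
    · exact Relation.EqvGen.trans _ _ _ h1 (Relation.EqvGen.rel _ _ ⟨β, rfl, h'⟩)
  two_source := by
    simp only [Set.ncard_eq_toFinset_card']
    decide
  two_target := by
    simp only [Set.ncard_eq_toFinset_card']
    decide
  source_f := by decide
  f_cube := by decide

/-! ### Path algebras and weighted triangulation algebras -/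

section Algebras

variable (K : Type*) [Field K] {V E : Type*} [Fintype V] (T : TriangulationQuiver V E)

/-- The defining relations of the path algebra, on generators `Sum.inl i` (the trivial path at the
vertex `i`) and `Sum.inr α` (the arrow `α`). Paths are composed from left to right. -/
inductive PathRel : FreeAlgebra K (V ⊕ E) → FreeAlgebra K (V ⊕ E) → Prop
  | idem (i : V) : PathRel
      (FreeAlgebra.ι K (Sum.inl i) * FreeAlgebra.ι K (Sum.inl i)) (FreeAlgebra.ι K (Sum.inl i))
  | orth (i j : V) (h : i ≠ j) : PathRel
      (FreeAlgebra.ι K (Sum.inl i) * FreeAlgebra.ι K (Sum.inl j)) 0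
  | sum_one : PathRel (∑ i : V, FreeAlgebra.ι K (Sum.inl i)) 1
  | source_mul (α : E) : PathRel
      (FreeAlgebra.ι K (Sum.inl (T.source α)) * FreeAlgebra.ι K (Sum.inr α))
      (FreeAlgebra.ι K (Sum.inr α))
  | mul_target (α : E) : PathRel
      (FreeAlgebra.ι K (Sum.inr α) * FreeAlgebra.ι K (Sum.inl (T.target α)))
      (FreeAlgebra.ι K (Sum.inr α))

/-- The path algebra `KQ`. -/
def PathAlgebra : Type _ := RingQuot (PathRel K T)

instance : Ring (PathAlgebra K T) := inferInstanceAs (Ring (RingQuot (PathRel K T)))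

instance : Algebra K (PathAlgebra K T) := inferInstanceAs (Algebra K (RingQuot (PathRel K T)))

/-- An arrow, as an element of the path algebra. -/
def arrow (α : E) : PathAlgebra K T :=
  RingQuot.mkAlgHom K (PathRel K T) (FreeAlgebra.ι K (Sum.inr α))

/-- The path `α g(α) g²(α) ⋯` with `k` arrows (for `k ≥ 1`). -/
def gPath (α : E) (k : ℕ) : PathAlgebra K T :=
  ((List.range k).map fun r => arrow K T ((T.g)^[r] α)).prod

variable {K} (m : T.Orbit → ℕ+) (c : T.Orbit → Kˣ)

/-- The path `A_α`, which runs along the `g`-orbit of `α` and has length `m_α n_α - 1`. -/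
def pathA (α : E) : PathAlgebra K T :=
  gPath K T α ((m (T.orbit α) : ℕ) * T.orbitLength α - 1)

/-- The defining relations of the weighted triangulation algebra. -/
inductive WeightedRel : PathAlgebra K T → PathAlgebra K T → Prop
  | comm (α : E) : WeightedRel (arrow K T α * arrow K T (T.f α))
      ((c (T.orbit (T.bar α)) : K) • pathA T m (T.bar α))
  | zero (β : E) : WeightedRel
      (arrow K T β * arrow K T (T.f β) * arrow K T (T.g (T.f β))) 0

/-- The weighted triangulation algebra `Λ(Q, f, m, c)`: the quotient of `KQ` by the two-sided
ideal generated by the relations above. -/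
def WeightedAlgebra : Type _ := RingQuot (WeightedRel T m c)

instance : Ring (WeightedAlgebra T m c) :=
  inferInstanceAs (Ring (RingQuot (WeightedRel T m c)))

instance : Algebra K (WeightedAlgebra T m c) :=
  inferInstanceAs (Algebra K (RingQuot (WeightedRel T m c)))

end Algebras

/-- The algebras `Λ(Q, f, m, c)` with this property are the tetrahedral algebras: `(Q, f)` is the
tetrahedral triangulation quiver and all weights are `1` (the parameters are arbitrary). -/
def IsTetrahedral {V E : Type*} (T : TriangulationQuiver V E) (m : T.Orbit → ℕ+) : Prop :=
  Nonempty (T.Iso tetrahedral) ∧ ∀ o, m o = 1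

end TriangulationQuiver

end

/-! The bimodule Λ has the presentation P₂ → P₁ → P₀ → Λ → 0 over R = Λ ⊗ Λᵒᵖ expected from quiver
and relations. P₀ has a generator `e_i ⊗ e_i` for each vertex. P₁ has a generator for each arrow,
and the differential d sends it to the commutator of that arrow with the generators of P₀. P₂ has a
generator for each commutativity relation, and r differentiates the relation by the Leibniz rule.
Periodicity is a self-duality of this presentation.

The algebra is symmetric: the sum of the socle coefficients (`symForm`) is a nondegenerate trace
form. A representation on the expected basis shows that this form is well defined. The flip σ,
sending a ⊗ b to b ⊗ a, is an anti-involution of R. It combines with the induced trace form of R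
into a perfect pairing on Rⁿ for which the adjoint of a matrix is its σ-transpose. When the relation
at f(γ) is indexed by γ, the matrix r is hermitian (`envFlip_relMat`): β splits the rest of the
g-cycle of γ into two pieces, and exchanging γ and β exchanges the pieces. Dualizing the
presentation therefore gives 0 → Λ → P₀ → P₂ → P₁, again with r as last map, and splicing the two
sequences gives Ω⁴(Λ) ≅ Λ (`SelfDualPresentation.isSyzygy_four`).

The crux is exactness at P₁ (`exact_relMat`), because P₂ has no generators for the zero relations.
Values on arrows that are compatible with the commutativity relations must extend to a derivation of
Λ, so they must respect the zero relations too. Two applications of commutativity rewrite one zero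
relation as a multiple, by paths on both sides, of another (`zeroDer_eq`). The multiplier lies in
the radical unless certain weights m_α n_α equal 3. If the rewriting fails to gain a radical factor
for an arrow and for its partner, four g-orbits have weight 3 and the quiver is tetrahedral
(`isTetrahedral_of_wt`). Otherwise Nakayama's lemma kills the defects (`zeroDer_eq_zero`).

Minimality follows from the radical filtration by path length, and at the last term from the fact
that the socle elements lie in the image of d (`mem_jacobson_of_linearCombination_flip`). Finally,
Ω²(Λ) ≅ Λ would force P₀ ≅ P₂, which a one-dimensional character at a non-loop arrow excludes.
Periods 1 and 3 would imply period 2. -/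

noncomputable section

namespace TriangulationQuiver

section Combinatorics

variable {V E : Type*} (T : TriangulationQuiver V E)

/-! ### Combinatorics of triangulation quivers -/

@[simp] theorem bar_bar (α : E) : T.bar (T.bar α) = α := T.bar_involutive α

theorem eq_or_eq_bar {α β : E} (h : T.source β = T.source α) : β = α ∨ β = T.bar α := by
  by_contra! hc
  exact hc.2 ((T.existsUnique_bar α).unique ⟨h, hc.1⟩ ⟨T.source_bar α, T.bar_ne α⟩)

theorem exists_source (i : V) : ∃ α, T.source α = i := by
  obtain ⟨x, y, -, h⟩ := Set.ncard_eq_two.1 (T.two_source i)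
  exact ⟨x, by have : x ∈ {α | T.source α = i} := h ▸ (by simp)
               simpa using this⟩

@[simp] theorem bar_g (α : E) : T.bar (T.g α) = T.f α := by simp [g_apply]

@[simp] theorem bar_f (α : E) : T.bar (T.f α) = T.g α := rfl

@[simp] theorem source_g (α : E) : T.source (T.g α) = T.target α := by
  rw [g_apply, source_bar, source_f]

theorem target_f_f (α : E) : T.target (T.f (T.f α)) = T.source α := by
  rw [← T.source_f, T.f_cube]

@[simp] theorem g_f_f_bar (α : E) : T.g (T.f (T.f (T.bar α))) = α := by
  rw [g_apply, T.f_cube, bar_bar]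

theorem g_f_f (α : E) : T.g (T.f (T.f α)) = T.bar α := by
  rw [g_apply, T.f_cube]

theorem g_ne_f (α : E) : T.g α ≠ T.f α := T.bar_ne _

theorem eq_g_or_eq_f {α β : E} (h : T.source β = T.target α) : β = T.g α ∨ β = T.f α := by
  rcases T.eq_or_eq_bar (α := T.g α) (h.trans (T.source_g α).symm) with h | h
  · exact Or.inl h
  · exact Or.inr (by rw [h, bar_g])

theorem orbit_g (α : E) : T.orbit (T.g α) = T.orbit α := by
  apply Quotient.sound
  exact ⟨-1, by simp⟩

theorem orbit_iterate (α : E) (k : ℕ) : T.orbit (T.g^[k] α) = T.orbit α := by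
  induction k with
  | zero => rfl
  | succ k ih => rw [Function.iterate_succ_apply', orbit_g, ih]

theorem orbitLength_g [Finite E] (α : E) : T.orbitLength (T.g α) = T.orbitLength α :=
  Function.minimalPeriod_apply (T.g.injective.mem_periodicPts α)

variable (m : T.Orbit → ℕ+)

/-- The number `m_α n_α`. -/
def wt (α : E) : ℕ := (m (T.orbit α) : ℕ) * T.orbitLength α

theorem wt_g [Finite E] (α : E) : T.wt m (T.g α) = T.wt m α := by
  rw [wt, wt, orbit_g, orbitLength_g]

theorem wt_iterate [Finite E] (α : E) (k : ℕ) : T.wt m (T.g^[k] α) = T.wt m α := by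
  induction k with
  | zero => rfl
  | succ k ih => rw [Function.iterate_succ_apply', wt_g, ih]

theorem iterate_wt (α : E) : T.g^[T.wt m α] α = α := by
  have : Function.IsPeriodicPt T.g (T.wt m α) α :=
    (Function.isPeriodicPt_minimalPeriod T.g α).const_mul _
  exact this

/-- The g-preimage of α is f²(ᾱ). This is the arrow that completes A_α to the full g-cycle, and it
is also the last side of the f-triangle of ᾱ. -/
theorem iterate_wt_sub_one {α : E} (h : 3 ≤ T.wt m α) :
    T.g^[T.wt m α - 1] α = T.f (T.f (T.bar α)) := by
  apply T.g.injective
  rw [← Function.iterate_succ_apply' T.g, g_f_f_bar]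
  have : (T.wt m α - 1).succ = T.wt m α := by omega
  rw [this, iterate_wt]

/-- A set of arrows which is nonempty and closed under `f` and `bar` contains all arrows. -/
theorem mem_of_closed (S : Set E) (hne : S.Nonempty) (hf : ∀ α ∈ S, T.f α ∈ S)
    (hbar : ∀ α ∈ S, T.bar α ∈ S) (α : E) : α ∈ S := by
  have key : ∀ β, (∃ γ ∈ S, T.source γ = T.source β) → β ∈ S := by
    rintro β ⟨γ, hγ, h⟩
    rcases T.eq_or_eq_bar h.symm with rfl | rfl
    · exact hγ
    · exact hbar _ hγ
  obtain ⟨β, hβ⟩ := hne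
  -- Membership in S depends only on the source, so it can be followed along edges: f moves forward
  -- along an arrow and f² = f⁻¹ moves back.
  have h2 : ∀ i j, Relation.EqvGen (fun a b => ∃ α, T.source α = a ∧ T.target α = b) i j →
      ((∃ γ ∈ S, T.source γ = i) ↔ (∃ γ ∈ S, T.source γ = j)) := by
    intro i j h
    induction h with
    | rel x y h =>
      obtain ⟨δ, rfl, rfl⟩ := h
      constructor
      · intro h
        exact ⟨_, hf _ (key δ h), T.source_f δ⟩
      · rintro ⟨γ, hγ, h⟩
        refine ⟨δ, ?_, rfl⟩
        have h3 : T.f δ ∈ S := key _ ⟨γ, hγ, by rw [h, T.source_f]⟩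
        have := hf _ (hf _ h3)
        rwa [T.f_cube] at this
    | refl => rfl
    | symm _ _ _ ih => exact ih.symm
    | trans _ _ _ _ _ ih1 ih2 => exact ih1.trans ih2
  exact key α ((h2 _ _ (T.connected (T.source β) (T.source α))).1 ⟨β, hβ, rfl⟩)

end Combinatorics

/-! ### Recognition of the tetrahedral quiver from four g-orbits of weight 3 -/

section Tetrahedral

/-- The involution `bar` of the tetrahedral triangulation quiver. -/
def tetrahedralBar (a : Fin 4 × Fin 3) : Fin 4 × Fin 3 :=
  (![![(3, 1), (2, 2), (1, 2)], ![(2, 1), (3, 2), (0, 2)], ![(3, 0), (1, 0), (0, 1)],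
    ![(2, 0), (0, 0), (1, 1)]] : Fin 4 → Fin 3 → Fin 4 × Fin 3) a.1 a.2

/-- The permutation `f` of the tetrahedral triangulation quiver. -/
def tetrahedralF (a : Fin 4 × Fin 3) : Fin 4 × Fin 3 := (a.1, a.2 + 1)

/-- This finite check drives injectivity: a map commuting with f and bar that identified two
distinct arrows would create a fixed arrow of bar or of f in its target. -/
theorem exists_collision : ∀ x y : Fin 4 × Fin 3, x ≠ y → ∃ (i j : Fin 3) (b : Bool),
    let w : Fin 4 × Fin 3 → Fin 4 × Fin 3 := fun z =>
      tetrahedralF^[i] ((if b then tetrahedralBar else id) (tetrahedralF^[j] z))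
    w y = tetrahedralBar (w x) ∨ w y = tetrahedralF (w x) ∨ w x = tetrahedralF (w y) := by
  decide

variable {V E : Type*} (T : TriangulationQuiver V E)

/-- The candidate for an isomorphism from the tetrahedral quiver, sending `(0, 0)` to `β`. -/
def tetrahedralMap (β : E) (a : Fin 4 × Fin 3) : E :=
  T.f^[a.2] ((![β, T.f (T.g (T.f β)), T.f (T.g β), T.f (T.f (T.bar β))] : Fin 4 → E) a.1)

theorem tetrahedralMap_f (β : E) (a : Fin 4 × Fin 3) :
    T.tetrahedralMap β (tetrahedralF a) = T.f (T.tetrahedralMap β a) := by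
  obtain ⟨k, r⟩ := a
  fin_cases r <;> simp [tetrahedralMap, tetrahedralF, T.f_cube]

variable {T} in
-- Each condition g³ = 1 is one gluing of triangles: g²(β) = f²(β̄), g²(fβ) = f²(gβ) and f²(g(fβ)) =
-- g(β̄). Together with f³ = 1 these determine bar on all twelve images.
theorem tetrahedralMap_bar {β : E} (h1 : T.g (T.g (T.g β)) = β)
    (h2 : T.g (T.g (T.g (T.f β))) = T.f β) (h3 : T.g (T.g (T.g (T.bar β))) = T.bar β)
    (a : Fin 4 × Fin 3) :
    T.tetrahedralMap β (tetrahedralBar a) = T.bar (T.tetrahedralMap β a) := by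
  have e1 : T.g (T.g β) = T.f (T.f (T.bar β)) := T.g.injective (by rw [h1, g_f_f_bar])
  have e2 : T.g (T.g (T.f β)) = T.f (T.f (T.g β)) :=
    T.g.injective (by rw [h2, g_f_f, bar_g])
  have e3 : T.f (T.f (T.g (T.f β))) = T.g (T.bar β) := T.g.injective <| by
    rw [g_f_f, bar_g]
    apply T.g.injective
    rw [h3, g_f_f]
  have e1' : T.bar (T.f (T.f (T.bar β))) = T.f (T.g β) := by rw [← e1, bar_g]
  have e2' : T.bar (T.f (T.f (T.g β))) = T.f (T.g (T.f β)) := by rw [← e2, bar_g]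
  obtain ⟨k, r⟩ := a
  fin_cases k <;> fin_cases r <;>
    simp [tetrahedralMap, tetrahedralBar, T.f_cube, e1, e2, e3, e1', e2']
  · rw [← e3, T.f_cube]
  · apply T.g.injective
    rw [h3, g_f_f]

theorem apply_iterate_eq (w : ℕ) (g' : Fin 4 × Fin 3 → Fin 4 × Fin 3) (g : E → E)
    (φ : Fin 4 × Fin 3 → E) (h : ∀ a, φ (g' a) = g (φ a)) (a : Fin 4 × Fin 3) :
    φ (g'^[w] a) = g^[w] (φ a) :=
  Function.Semiconj.iterate_right (f := φ) (ga := g') (gb := g) h w a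

theorem tetrahedralVertex_bar : ∀ x y : Fin 4 × Fin 3,
    tetrahedralVertex x = tetrahedralVertex y ↔ x = y ∨ x = tetrahedralBar y := by
  decide

theorem tetrahedralVertex_surjective : ∀ i : Fin 6, ∃ x, tetrahedralVertex x = i := by
  decide

theorem tetrahedral_orbits : ∀ x : Fin 4 × Fin 3, ∃ k : Fin 3, ∃ y,
    (y = (0, 0) ∨ y = (3, 1) ∨ y = (0, 1) ∨ y = (3, 2)) ∧
      x = (fun z => tetrahedralBar (tetrahedralF z))^[k] y := by
  decide

theorem tetrahedral_g_ne : ∀ x : Fin 4 × Fin 3, tetrahedralBar (tetrahedralF x) ≠ x := by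
  decide

theorem tetrahedral_g_cube : ∀ x : Fin 4 × Fin 3,
    (fun z => tetrahedralBar (tetrahedralF z))^[3] x = x := by
  decide

variable {T}

/-- If `f` has a fixed arrow and `g³ = 1`, there are at most two vertices. -/
theorem card_le_two_of_fixed [Fintype V] (hg : ∀ α, T.g (T.g (T.g α)) = α) {α : E}
    (hα : T.f α = α) : Fintype.card V ≤ 2 := by
  -- If f fixes α then g(α) = ᾱ, and g³(α) = α says that bar exchanges f(ᾱ) and f²(ᾱ). Hence the
  -- four arrows α, ᾱ, f(ᾱ), f²(ᾱ) are closed under f and bar, and they have only two sources.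
  have h1 : T.bar (T.f (T.bar α)) = T.f (T.f (T.bar α)) := by
    have := hg α
    rw [T.g_apply α, hα, T.g_apply (T.bar α)] at this
    apply T.f.injective
    rw [T.f_cube]
    apply T.bar_involutive.injective
    rw [bar_bar]
    exact this
  have h2 : T.bar (T.f (T.f (T.bar α))) = T.f (T.bar α) := by rw [← h1, bar_bar]
  have key : ∀ β, β ∈ ({α, T.bar α, T.f (T.bar α), T.f (T.f (T.bar α))} : Set E) := by
    apply T.mem_of_closed
    · exact ⟨α, by simp⟩
    · rintro β (rfl | rfl | rfl | rfl) <;> simp [hα, T.f_cube]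
    · rintro β (rfl | rfl | rfl | rfl) <;> simp [h1, h2, -bar_f]
  classical
  have : (Finset.univ : Finset V) ⊆ {T.source α, T.source (T.f (T.bar α))} := by
    intro i _
    obtain ⟨β, rfl⟩ := T.exists_source i
    rcases key β with rfl | rfl | rfl | rfl
    · simp
    · simp [source_bar]
    · simp
    · rw [← h1, source_bar]; simp
  exact (Finset.card_le_card this).trans Finset.card_le_two

variable {m : T.Orbit → ℕ+}

theorem g_cube_of_wt {α : E} (h : T.wt m α = 3) : T.g (T.g (T.g α)) = α := by
  have := T.iterate_wt m α
  rwa [h] at this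

/-- If the four `g`-orbits around an edge have weight `3`, the quiver is tetrahedral. -/
theorem isTetrahedral_of_wt [Fintype V] [Finite E] (hV : 3 ≤ Fintype.card V) {β : E}
    (h1 : T.wt m β = 3) (h2 : T.wt m (T.bar β) = 3) (h3 : T.wt m (T.f β) = 3)
    (h4 : T.wt m (T.f (T.bar β)) = 3) : T.IsTetrahedral m := by
  set φ := T.tetrahedralMap β with hφ
  have hf : ∀ a, φ (tetrahedralF a) = T.f (φ a) := T.tetrahedralMap_f β
  have hbar : ∀ a, φ (tetrahedralBar a) = T.bar (φ a) :=
    tetrahedralMap_bar (g_cube_of_wt h1) (g_cube_of_wt h3) (g_cube_of_wt h2)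
  have hg : ∀ a, φ ((fun z => tetrahedralBar (tetrahedralF z)) a) = T.g (φ a) := fun a => by
    simp only [hbar, hf, bar_f]
  have hsurj : ∀ α, ∃ a, φ a = α := by
    apply T.mem_of_closed (Set.range φ) ⟨_, (0, 0), rfl⟩
    · rintro _ ⟨a, rfl⟩
      exact ⟨_, hf a⟩
    · rintro _ ⟨a, rfl⟩
      exact ⟨_, hbar a⟩
  have hg3 : ∀ α, T.g (T.g (T.g α)) = α := fun α => by
    obtain ⟨a, rfl⟩ := hsurj α
    have := apply_iterate_eq 3 _ _ φ hg a
    rw [tetrahedral_g_cube] at this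
    exact this.symm
  have hfix : ∀ α, T.f α ≠ α := fun α h => by
    have := card_le_two_of_fixed hg3 h
    omega
  -- An identification would propagate along a word in f and bar to a fixed arrow of bar, which
  -- never exists, or of f, which `hfix` excludes.
  have hinj : Function.Injective φ := by
    intro x y hxy
    by_contra hne
    obtain ⟨i, j, b, h⟩ := exists_collision x y hne
    set w : Fin 4 × Fin 3 → Fin 4 × Fin 3 := fun z =>
      tetrahedralF^[i] ((if b then tetrahedralBar else id) (tetrahedralF^[j] z)) with hw
    have key : φ (w x) = φ (w y) := by
      simp only [hw]
      rw [apply_iterate_eq i _ _ φ hf, apply_iterate_eq i _ _ φ hf]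
      congr 1
      cases b
      · simp only [Bool.false_eq_true, if_false, id]
        rw [apply_iterate_eq j _ _ φ hf, apply_iterate_eq j _ _ φ hf, hxy]
      · simp only [if_true, hbar]
        rw [apply_iterate_eq j _ _ φ hf, apply_iterate_eq j _ _ φ hf, hxy]
    rcases h with h | h | h
    · rw [h, hbar] at key
      exact T.bar_ne _ key.symm
    · rw [h, hf] at key
      exact hfix _ key.symm
    · rw [h, hf] at key
      exact hfix _ key
  have hsource : ∀ a b, tetrahedralVertex a = tetrahedralVertex b ↔
      T.source (φ a) = T.source (φ b) := fun a b => by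
    rw [tetrahedralVertex_bar]
    constructor
    · rintro (rfl | rfl)
      · rfl
      · rw [hbar, source_bar]
    · intro h
      rcases T.eq_or_eq_bar h with h | h
      · exact Or.inl (hinj h)
      · exact Or.inr (hinj (h.trans (hbar b).symm))
  choose rep hrep using tetrahedralVertex_surjective
  -- Vertices are recovered as bar-orbits of arrows, so the bijection on arrows determines the one
  -- on vertices.
  have hvb : Function.Bijective fun i => T.source (φ (rep i)) := by
    constructor
    · intro i j h
      have := (hsource _ _).2 h
      rwa [hrep, hrep] at this
    · intro i
      obtain ⟨α, rfl⟩ := T.exists_source i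
      obtain ⟨a, rfl⟩ := hsurj α
      exact ⟨tetrahedralVertex a, (hsource _ _).1 (hrep _)⟩
  have hv : ∀ a, (Equiv.ofBijective _ hvb).symm (T.source (φ a)) = tetrahedralVertex a := by
    intro a
    rw [Equiv.symm_apply_eq]
    exact ((hsource _ _).1 (hrep _)).symm
  have ha : ∀ a, (Equiv.ofBijective φ ⟨hinj, hsurj⟩).symm (φ a) = a := fun a =>
    (Equiv.ofBijective φ ⟨hinj, hsurj⟩).symm_apply_apply a
  refine ⟨⟨⟨(Equiv.ofBijective _ hvb).symm, (Equiv.ofBijective φ ⟨hinj, hsurj⟩).symm,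
    ?_, ?_, ?_⟩⟩, ?_⟩
  · intro α
    obtain ⟨a, rfl⟩ := hsurj α
    rw [ha, hv]
    rfl
  · intro α
    obtain ⟨a, rfl⟩ := hsurj α
    rw [ha, ← T.source_f, ← hf, hv]
    rfl
  · intro α
    obtain ⟨a, rfl⟩ := hsurj α
    rw [ha, ← hf, ha]
    rfl
  · intro o
    -- The four g-orbits of the tetrahedral quiver are represented by the preimages of β, β̄, f(β)
    -- and f(β̄), the arrows whose weights are given.
    have hw : ∀ a, T.wt m (φ a) = 3 := by
      intro a
      obtain ⟨k, y, hy, rfl⟩ := tetrahedral_orbits a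
      rw [apply_iterate_eq k _ _ φ hg, wt_iterate]
      rcases hy with rfl | rfl | rfl | rfl
      · exact h1
      · have : φ (3, 1) = T.bar β := hbar (0, 0)
        rw [this, h2]
      · exact h3
      · have : φ (3, 2) = T.f (T.bar β) := by
          have e : φ (3, 1) = T.bar β := hbar (0, 0)
          exact (hf (3, 1)).trans (congrArg T.f e)
        rw [this, h4]
    obtain ⟨α, rfl⟩ := Quotient.exists_rep o
    obtain ⟨a, rfl⟩ := hsurj α
    have h := hw a
    -- Since m·n = 3 and g has no fixed arrow in the tetrahedral quiver, n = 3 and m = 1.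
    have hne : T.orbitLength (φ a) ≠ 1 := by
      intro h
      rw [orbitLength, Function.minimalPeriod_eq_one_iff_isFixedPt] at h
      exact tetrahedral_g_ne a (hinj ((hg a).trans h))
    change (m (T.orbit (φ a)) : ℕ) * _ = 3 at h
    have hd := (Nat.dvd_prime Nat.prime_three).1 (Dvd.intro_left _ h)
    have h3 := hd.resolve_left hne
    rw [h3] at h
    have : (m (T.orbit (φ a)) : ℕ) = 1 := by omega
    exact PNat.coe_eq_one_iff.1 this

end Tetrahedral

end TriangulationQuiver

namespace TriangulationQuiver

/-! ### Generators and universal properties -/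

section Lift

variable (K : Type*) [Field K] {V E : Type*} [Fintype V] (T : TriangulationQuiver V E)

/-- The trivial path at a vertex, as an element of the path algebra. -/
def vertex (i : V) : PathAlgebra K T :=
  RingQuot.mkAlgHom K (PathRel K T) (FreeAlgebra.ι K (Sum.inl i))

theorem gPath_zero (α : E) : gPath K T α 0 = 1 := by simp [gPath]

theorem gPath_one (α : E) : gPath K T α 1 = arrow K T α := by simp [gPath]

theorem gPath_succ (α : E) (k : ℕ) :
    gPath K T α (k + 1) = arrow K T α * gPath K T (T.g α) k := by
  simp only [gPath, List.range_succ_eq_map, List.map_cons, List.prod_cons, List.map_map,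
    Function.iterate_zero, id]
  rfl

theorem gPath_add (α : E) (k l : ℕ) :
    gPath K T α (k + l) = gPath K T α k * gPath K T (T.g^[k] α) l := by
  induction k generalizing α with
  | zero => simp [gPath_zero]
  | succ k ih =>
    rw [gPath_succ, mul_assoc, Function.iterate_succ_apply, ← ih, ← gPath_succ]
    congr 1
    omega

theorem gPath_succ' (α : E) (k : ℕ) :
    gPath K T α (k + 1) = gPath K T α k * arrow K T (T.g^[k] α) := by
  rw [gPath_add, gPath_one]

theorem vertex_mul_vertex_self (i : V) : vertex K T i * vertex K T i = vertex K T i := by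
  have := RingQuot.mkAlgHom_rel K (PathRel.idem (K := K) (T := T) i)
  rwa [map_mul] at this

theorem vertex_mul_vertex_of_ne {i j : V} (h : i ≠ j) :
    vertex K T i * vertex K T j = 0 := by
  have := RingQuot.mkAlgHom_rel K (PathRel.orth (K := K) (T := T) i j h)
  rwa [map_mul, map_zero] at this

theorem sum_vertex : ∑ i, vertex K T i = 1 := by
  have := RingQuot.mkAlgHom_rel K (PathRel.sum_one (K := K) (T := T))
  rwa [map_sum, map_one] at this

theorem vertex_mul_arrow (α : E) :
    vertex K T (T.source α) * arrow K T α = arrow K T α := by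
  have := RingQuot.mkAlgHom_rel K (PathRel.source_mul (K := K) (T := T) α)
  rwa [map_mul] at this

theorem arrow_mul_vertex (α : E) :
    arrow K T α * vertex K T (T.target α) = arrow K T α := by
  have := RingQuot.mkAlgHom_rel K (PathRel.mul_target (K := K) (T := T) α)
  rwa [map_mul] at this

variable {K T}

theorem pathAlgebra_induction {p : PathAlgebra K T → Prop}
    (hv : ∀ i, p (vertex K T i)) (ha : ∀ α, p (arrow K T α))
    (halg : ∀ r, p (algebraMap K _ r))
    (hadd : ∀ x y, p x → p y → p (x + y)) (hmul : ∀ x y, p x → p y → p (x * y)) (x) : p x := by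
  obtain ⟨y, rfl⟩ := RingQuot.mkAlgHom_surjective K (PathRel K T) x
  induction y using FreeAlgebra.induction with
  | grade0 r => exact (AlgHom.commutes (RingQuot.mkAlgHom K (PathRel K T)) r) ▸ halg r
  | grade1 x => rcases x with i | α
                · exact hv i
                · exact ha α
  | mul a b ha hb => exact (map_mul (RingQuot.mkAlgHom K (PathRel K T)) a b) ▸ hmul _ _ ha hb
  | add a b ha hb => exact (map_add (RingQuot.mkAlgHom K (PathRel K T)) a b) ▸ hadd _ _ ha hb

section

variable {B : Type*} [Ring B] [Algebra K B] (e' : V → B) (a' : E → B)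
  (hidem : ∀ i, e' i * e' i = e' i) (horth : ∀ i j, i ≠ j → e' i * e' j = 0)
  (hone : ∑ i, e' i = 1) (hs : ∀ α, e' (T.source α) * a' α = a' α)
  (ht : ∀ α, a' α * e' (T.target α) = a' α)

/-- The universal property of the path algebra. -/
def liftPath : PathAlgebra K T →ₐ[K] B :=
  RingQuot.liftAlgHom K ⟨FreeAlgebra.lift K (Sum.elim e' a'), by
    intro x y h
    induction h with
    | idem i => simp [hidem]
    | orth i j h => simp [horth i j h]
    | sum_one => simp [hone]
    | source_mul α => simp [hs]
    | mul_target α => simp [ht]⟩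

@[simp] theorem liftPath_vertex (i : V) :
    liftPath (K := K) e' a' hidem horth hone hs ht (vertex K T i) = e' i := by
  refine (RingQuot.liftAlgHom_mkAlgHom_apply K _ _ _).trans ?_
  simp

@[simp] theorem liftPath_arrow (α : E) :
    liftPath (K := K) e' a' hidem horth hone hs ht (arrow K T α) = a' α := by
  refine (RingQuot.liftAlgHom_mkAlgHom_apply K _ _ _).trans ?_
  simp

end

variable (m : T.Orbit → ℕ+) (c : T.Orbit → Kˣ)

variable (T) in
/-- The projection from the path algebra to the weighted triangulation algebra. -/
def toWeighted : PathAlgebra K T →ₐ[K] WeightedAlgebra T m c :=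
  RingQuot.mkAlgHom K (WeightedRel T m c)

theorem toWeighted_surjective : Function.Surjective (toWeighted T m c) :=
  RingQuot.mkAlgHom_surjective K _

variable {m c}

/-- The universal property of the weighted triangulation algebra. -/
def liftWeighted {B : Type*} [Ring B] [Algebra K B] (θ : PathAlgebra K T →ₐ[K] B)
    (hcomm : ∀ α, θ (arrow K T α) * θ (arrow K T (T.f α)) =
      (c (T.orbit (T.bar α)) : K) • θ (gPath K T (T.bar α) (T.wt m (T.bar α) - 1)))
    (hzero : ∀ α, θ (arrow K T α) * θ (arrow K T (T.f α)) * θ (arrow K T (T.g (T.f α))) = 0) :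
    WeightedAlgebra T m c →ₐ[K] B :=
  RingQuot.liftAlgHom K ⟨θ, by
    intro x y h
    induction h with
    | comm α =>
      rw [map_mul, hcomm, map_smul]
      rfl
    | zero α => simp [hzero]⟩

@[simp] theorem liftWeighted_toWeighted {B : Type*} [Ring B] [Algebra K B]
    (θ : PathAlgebra K T →ₐ[K] B) (hcomm) (hzero) (x : PathAlgebra K T) :
    liftWeighted (m := m) (c := c) θ hcomm hzero (toWeighted T m c x) = θ x :=
  RingQuot.liftAlgHom_mkAlgHom_apply K _ _ _

variable (T m c)

/-- The idempotent of the weighted triangulation algebra at a vertex. -/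
def idm (i : V) : WeightedAlgebra T m c := toWeighted T m c (vertex K T i)

/-- The path with `k` arrows along a `g`-orbit, in the weighted triangulation algebra. -/
def pth (α : E) (k : ℕ) : WeightedAlgebra T m c := toWeighted T m c (gPath K T α k)

theorem toWeighted_arrow (α : E) : toWeighted T m c (arrow K T α) = pth T m c α 1 := by
  rw [pth, gPath_one]

variable {T m c}

theorem weighted_induction {p : WeightedAlgebra T m c → Prop}
    (hv : ∀ i, p (idm T m c i)) (ha : ∀ α, p (pth T m c α 1))
    (halg : ∀ r, p (algebraMap K _ r))
    (hadd : ∀ x y, p x → p y → p (x + y)) (hmul : ∀ x y, p x → p y → p (x * y)) (x) : p x := by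
  obtain ⟨y, rfl⟩ := toWeighted_surjective m c x
  induction y using pathAlgebra_induction with
  | hv i => exact hv i
  | ha α => exact (toWeighted_arrow T m c α) ▸ ha α
  | halg r => exact (AlgHom.commutes (toWeighted T m c) r) ▸ halg r
  | hadd a b ha hb => exact (map_add (toWeighted T m c) a b) ▸ hadd _ _ ha hb
  | hmul a b ha hb => exact (map_mul (toWeighted T m c) a b) ▸ hmul _ _ ha hb

end Lift

/-! ### Multiplication in the weighted triangulation algebra -/

section Mul

variable {K : Type*} [Field K] {V E : Type*} [Fintype V] {T : TriangulationQuiver V E}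
  {m : T.Orbit → ℕ+} {c : T.Orbit → Kˣ}

local notation "e" => idm T m c
local notation "p" => pth T m c

theorem idm_mul_idm_self (i : V) : e i * e i = e i := by
  rw [idm, ← map_mul, vertex_mul_vertex_self]

theorem idm_mul_idm_of_ne {i j : V} (h : i ≠ j) : e i * e j = 0 := by
  rw [idm, idm, ← map_mul, vertex_mul_vertex_of_ne K T h, map_zero]

theorem sum_idm : ∑ i, e i = 1 := by
  simp_rw [idm]
  rw [← map_sum, sum_vertex, map_one]

theorem pth_zero (α : E) : p α 0 = 1 := by rw [pth, gPath_zero, map_one]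

theorem pth_succ (α : E) (k : ℕ) : p α (k + 1) = p α 1 * p (T.g α) k := by
  rw [pth, gPath_succ, map_mul, toWeighted_arrow]; rfl

theorem pth_add (α : E) (k l : ℕ) : p α (k + l) = p α k * p (T.g^[k] α) l := by
  rw [pth, gPath_add, map_mul, pth, pth]

theorem pth_succ' (α : E) (k : ℕ) : p α (k + 1) = p α k * p (T.g^[k] α) 1 := pth_add α k 1

theorem idm_mul_pth {α : E} {k : ℕ} (hk : k ≠ 0) : e (T.source α) * p α k = p α k := by
  obtain ⟨k, rfl⟩ := Nat.exists_eq_succ_of_ne_zero hk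
  rw [Nat.succ_eq_add_one, pth_succ, ← mul_assoc, ← toWeighted_arrow, idm, ← map_mul,
    vertex_mul_arrow]

theorem pth_mul_idm (α : E) (k : ℕ) :
    p α (k + 1) * e (T.target (T.g^[k] α)) = p α (k + 1) := by
  rw [pth_succ', mul_assoc, ← toWeighted_arrow, idm, ← map_mul, arrow_mul_vertex]

theorem idm_mul_pth_of_ne {α : E} {i : V} {k : ℕ} (hk : k ≠ 0) (h : i ≠ T.source α) :
    e i * p α k = 0 := by
  rw [← idm_mul_pth hk, ← mul_assoc, idm_mul_idm_of_ne h, zero_mul]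

theorem pth_mul_idm_of_ne {α : E} {i : V} {k : ℕ} (h : i ≠ T.target (T.g^[k] α)) :
    p α (k + 1) * e i = 0 := by
  rw [← pth_mul_idm, mul_assoc, idm_mul_idm_of_ne h.symm, mul_zero]

theorem pth_mul_pth_of_ne {α β : E} {k l : ℕ} (hl : l ≠ 0)
    (h : T.target (T.g^[k] α) ≠ T.source β) : p α (k + 1) * p β l = 0 := by
  rw [← pth_mul_idm, mul_assoc, idm_mul_pth_of_ne hl h, mul_zero]

theorem pth_mul_f (α : E) : p α 1 * p (T.f α) 1 =
    (c (T.orbit (T.bar α)) : K) • p (T.bar α) (T.wt m (T.bar α) - 1) := by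
  have := RingQuot.mkAlgHom_rel K (WeightedRel.comm (m := m) (c := c) α)
  rw [map_mul, map_smul] at this
  rw [← toWeighted_arrow, ← toWeighted_arrow]
  exact this

theorem pth_mul_f_mul_g (α : E) : p α 1 * p (T.f α) 1 * p (T.g (T.f α)) 1 = 0 := by
  have := RingQuot.mkAlgHom_rel K (WeightedRel.zero (m := m) (c := c) α)
  rw [map_mul, map_mul, map_zero] at this
  rw [← toWeighted_arrow, ← toWeighted_arrow, ← toWeighted_arrow]
  exact this

theorem pth_mul_f_of_two_le {α : E} {k : ℕ} (hk : 2 ≤ k) : p α 1 * p (T.f α) k = 0 := by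
  obtain ⟨k, rfl⟩ := Nat.exists_eq_add_of_le hk
  have : p (T.f α) 2 = p (T.f α) 1 * p (T.g (T.f α)) 1 := pth_succ _ 1
  rw [pth_add, this, ← mul_assoc, ← mul_assoc, pth_mul_f_mul_g, zero_mul]

/-- The last two arrows multiply to a multiple of A_{f(α)}. This path has length at least 2, so it
begins with f(α) g(f(α)), and α annihilates it from the left by the zero relation. -/
theorem pth_two_mul_f (h3 : ∀ α, 3 ≤ T.wt m α) (α : E) :
    p α 1 * (p (T.g α) 1 * p (T.f (T.g α)) 1) = 0 := by
  have := h3 (T.bar (T.g α))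
  rw [pth_mul_f, mul_smul_comm, bar_g, pth_mul_f_of_two_le, smul_zero]
  rw [bar_g] at this
  omega

theorem pth_mul_pth_f (h3 : ∀ α, 3 ≤ T.wt m α) (α : E) {k l : ℕ} (hl : l ≠ 0)
    (h : 0 < k ∨ 2 ≤ l) : p α (k + 1) * p (T.f (T.g^[k] α)) l = 0 := by
  by_cases h' : 2 ≤ l
  · rw [pth_succ', mul_assoc, pth_mul_f_of_two_le h', mul_zero]
  · obtain rfl : l = 1 := by omega
    obtain ⟨k, rfl⟩ : ∃ k', k = k' + 1 := ⟨k - 1, by omega⟩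
    rw [pth_succ', pth_succ', Function.iterate_succ_apply', mul_assoc, mul_assoc,
      pth_two_mul_f h3, mul_zero]

/-- All cases of the product of two paths along `g`-orbits. -/
theorem pth_mul_pth_cases (h3 : ∀ α, 3 ≤ T.wt m α) (α β : E) (k l : ℕ) (hl : l ≠ 0) :
    (β = T.g^[k + 1] α ∧ p α (k + 1) * p β l = p α (k + 1 + l)) ∨
    (β ≠ T.g^[k + 1] α ∧ (p α (k + 1) * p β l = 0 ∨ (β = T.f α ∧ k = 0 ∧ l = 1 ∧
      p α (k + 1) * p β l =
        (c (T.orbit (T.bar α)) : K) • p (T.bar α) (T.wt m (T.bar α) - 1)))) := by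
  by_cases hβ : T.source β = T.target (T.g^[k] α)
  · rcases T.eq_g_or_eq_f hβ with rfl | rfl
    · left
      rw [← Function.iterate_succ_apply' T.g]
      exact ⟨rfl, (pth_add _ _ _).symm⟩
    · right
      rw [Function.iterate_succ_apply']
      refine ⟨(T.g_ne_f _).symm, ?_⟩
      by_cases h : 0 < k ∨ 2 ≤ l
      · exact Or.inl (pth_mul_pth_f h3 α hl h)
      · obtain rfl : k = 0 := by omega
        obtain rfl : l = 1 := by omega
        exact Or.inr ⟨rfl, rfl, rfl, pth_mul_f α⟩
  · right
    refine ⟨?_, Or.inl (pth_mul_pth_of_ne hl (Ne.symm hβ))⟩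
    rintro rfl
    rw [Function.iterate_succ_apply', source_g] at hβ
    exact hβ rfl

theorem smul_pth_wt_bar {α : E} (h3 : ∀ α, 3 ≤ T.wt m α) :
    (c (T.orbit (T.bar α)) : K) • p (T.bar α) (T.wt m (T.bar α)) =
      p α 1 * p (T.f α) 1 * p (T.f (T.f α)) 1 := by
  have h := h3 (T.bar α)
  rw [pth_mul_f, smul_mul_assoc]
  obtain ⟨n, hn⟩ : ∃ n, T.wt m (T.bar α) = n + 1 := ⟨_, (Nat.sub_add_cancel (by omega)).symm⟩
  have := T.iterate_wt_sub_one m h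
  rw [hn, Nat.add_sub_cancel, bar_bar] at this
  rw [hn, Nat.add_sub_cancel, pth_succ', this]

theorem smul_pth_wt [Finite E] {α : E} (h3 : ∀ α, 3 ≤ T.wt m α) :
    (c (T.orbit α) : K) • p α (T.wt m α) = p α 1 * p (T.f α) 1 * p (T.f (T.f α)) 1 := by
  have h := h3 α
  rw [mul_assoc, pth_mul_f, bar_f, orbit_g, wt_g, mul_smul_comm, ← pth_succ,
    Nat.sub_add_cancel (by omega)]

/-- The triangle α f(α) f²(α) has two bracketings. One contracts its first two sides and gives the
full cycle at ᾱ, the other contracts its last two and gives the full cycle at α. -/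
theorem smul_pth_wt_eq [Finite E] (α : E) (h3 : ∀ α, 3 ≤ T.wt m α) :
    (c (T.orbit (T.bar α)) : K) • p (T.bar α) (T.wt m (T.bar α)) =
      (c (T.orbit α) : K) • p α (T.wt m α) := by
  rw [smul_pth_wt_bar h3, smul_pth_wt h3]

theorem pth_eq_zero [Finite E] (h3 : ∀ α, 3 ≤ T.wt m α) {α : E} {k : ℕ}
    (hk : T.wt m α < k) : p α k = 0 := by
  obtain ⟨k, rfl⟩ := Nat.exists_eq_add_of_lt hk
  -- The full cycle at α is a multiple of the triangle of ᾱ. Multiplying by α, which is g(f²(ᾱ)),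
  -- makes the last three factors a zero relation.
  have key : p α (T.wt m α + 1) = 0 := by
    have h := smul_pth_wt_bar (c := c) (α := T.bar α) h3
    rw [bar_bar] at h
    rw [pth_succ', iterate_wt, ← (c (T.orbit α)).isUnit.smul_eq_zero, ← smul_mul_assoc]
    rw [h]
    have := pth_mul_f_mul_g (m := m) (c := c) (T.f (T.bar α))
    rw [g_f_f_bar] at this
    rw [mul_assoc, mul_assoc, ← mul_assoc (p _ _) (p _ _) (p α 1), this, mul_zero]
  rw [add_right_comm, pth_add, key, zero_mul]

variable (T m c) in
/-- The span of the paths of length at least `n` along `g`-orbits (everything if `n = 0`). -/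
def filt (n : ℕ) : Submodule K (WeightedAlgebra T m c) :=
  Submodule.span K {x | (n = 0 ∧ ∃ i, x = e i) ∨ ∃ α k, 0 < k ∧ n ≤ k ∧ x = p α k}

theorem idm_mem_filt (i : V) : e i ∈ filt T m c 0 :=
  Submodule.subset_span (Or.inl ⟨rfl, i, rfl⟩)

theorem pth_mem_filt {α : E} {n k : ℕ} (hk : 0 < k) (h : n ≤ k) : p α k ∈ filt T m c n :=
  Submodule.subset_span (Or.inr ⟨α, k, hk, h, rfl⟩)

theorem mul_mem_filt (h3 : ∀ α, 3 ≤ T.wt m α) {n l : ℕ} {x y : WeightedAlgebra T m c}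
    (hx : x ∈ filt T m c n) (hy : y ∈ filt T m c l) : x * y ∈ filt T m c (n + l) := by
  induction hx using Submodule.span_induction with
  | zero => simp
  | add x x' _ _ hx hx' => rw [add_mul]; exact add_mem hx hx'
  | smul r x _ hx => rw [smul_mul_assoc]; exact Submodule.smul_mem _ _ hx
  | mem x hx =>
    induction hy using Submodule.span_induction with
    | zero => simp
    | add x x' _ _ hx hx' => rw [mul_add]; exact add_mem hx hx'
    | smul r x _ hx => rw [mul_smul_comm]; exact Submodule.smul_mem _ _ hx
    | mem y hy =>
      rcases hx with ⟨rfl, i, rfl⟩ | ⟨α, k, hk, hn, rfl⟩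
      · rcases hy with ⟨rfl, j, rfl⟩ | ⟨α, k, hk, hn, rfl⟩
        · by_cases h : i = j
          · subst h; rw [idm_mul_idm_self]; exact idm_mem_filt _
          · rw [idm_mul_idm_of_ne h]; exact zero_mem _
        · by_cases h : i = T.source α
          · subst h; rw [idm_mul_pth hk.ne']; exact pth_mem_filt hk (by omega)
          · rw [idm_mul_pth_of_ne hk.ne' h]; exact zero_mem _
      · obtain ⟨k, rfl⟩ : ∃ k', k = k' + 1 := ⟨k - 1, by omega⟩
        rcases hy with ⟨rfl, j, rfl⟩ | ⟨β, l', hl, hn', rfl⟩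
        · by_cases h : j = T.target (T.g^[k] α)
          · subst h; rw [pth_mul_idm]; exact pth_mem_filt hk (by omega)
          · rw [pth_mul_idm_of_ne h]; exact zero_mem _
        · rcases pth_mul_pth_cases (c := c) h3 α β k l' hl.ne' with
            ⟨-, h⟩ | ⟨-, h | ⟨-, rfl, rfl, h⟩⟩
          · rw [h]; exact pth_mem_filt (by omega) (by omega)
          · rw [h]; exact zero_mem _
          -- The one product in which the path is replaced is α f(α), of length 2. It becomes a
          -- multiple of a path of length m·n − 1 ≥ 2, so the filtration degree does not drop.
          · rw [h]
            have := h3 (T.bar α)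
            exact Submodule.smul_mem _ _ (pth_mem_filt (by omega) (by omega))

theorem one_mem_filt : (1 : WeightedAlgebra T m c) ∈ filt T m c 0 := by
  rw [← sum_idm]
  exact sum_mem fun i _ => idm_mem_filt i

theorem filt_zero (h3 : ∀ α, 3 ≤ T.wt m α) : filt T m c 0 = ⊤ := by
  rw [eq_top_iff]
  rintro x -
  induction x using weighted_induction with
  | hv i => exact idm_mem_filt i
  | ha α => exact pth_mem_filt one_pos (by omega)
  | halg r => rw [Algebra.algebraMap_eq_smul_one]; exact Submodule.smul_mem _ _ one_mem_filt
  | hadd x y hx hy => exact add_mem hx hy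
  | hmul x y hx hy =>
    have := mul_mem_filt h3 hx hy
    rwa [zero_add] at this

theorem exists_filt_eq_bot [Finite E] (h3 : ∀ α, 3 ≤ T.wt m α) : ∃ n, filt T m c n = ⊥ := by
  cases nonempty_fintype E
  refine ⟨(Finset.univ.sup (T.wt m)) + 1, ?_⟩
  rw [filt, Submodule.span_eq_bot]
  rintro x (⟨h, -⟩ | ⟨α, k, hk, h, rfl⟩)
  · omega
  · apply pth_eq_zero h3
    have := Finset.le_sup (f := T.wt m) (Finset.mem_univ α)
    omega

theorem finite_weighted [Finite E] (h3 : ∀ α, 3 ≤ T.wt m α) :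
    Module.Finite K (WeightedAlgebra T m c) := by
  cases nonempty_fintype E
  constructor
  rw [← filt_zero h3]
  set N := Finset.univ.sup (T.wt m)
  have : filt T m c 0 = Submodule.span K
      (Set.range (fun i => e i) ∪ Set.range (fun x : E × Fin (N + 1) => p x.1 x.2)) := by
    apply le_antisymm
    · rw [filt, Submodule.span_le]
      rintro x (⟨-, i, rfl⟩ | ⟨α, k, -, -, rfl⟩)
      · exact Submodule.subset_span (Or.inl ⟨i, rfl⟩)
      · by_cases h : k < N + 1
        · exact Submodule.subset_span (Or.inr ⟨(α, ⟨k, h⟩), rfl⟩)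
        · have := Finset.le_sup (f := T.wt m) (Finset.mem_univ α)
          rw [pth_eq_zero h3 (by omega)]
          exact zero_mem _
    · rw [filt_zero h3]
      exact le_top
  rw [this]
  exact Submodule.fg_span ((Set.finite_range _).union (Set.finite_range _))

end Mul

end TriangulationQuiver

namespace TriangulationQuiver

/-! ### The regular representation and the symmetrizing form -/

section Representation

open scoped Classical in
/-- The image of the basis vector `(α, k)` of the regular representation: the path of length `k`
along the `g`-orbit of `α`, for `k ≥ 1`. The socle at `i` is spanned by `Sum.inr (Sum.inr i)`. -/
def pathVec {K : Type*} [Field K] {V E : Type*} (T : TriangulationQuiver V E)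
    (m : T.Orbit → ℕ+) (c : T.Orbit → Kˣ) (α : E) (k : ℕ) : (V ⊕ (E × ℕ) ⊕ V) →₀ K :=
  if k < T.wt m α then Finsupp.single (Sum.inr (Sum.inl (α, k))) 1
  else if k = T.wt m α then
    Finsupp.single (Sum.inr (Sum.inr (T.source α))) (((c (T.orbit α))⁻¹ : Kˣ) : K)
  else 0

open scoped Classical in
/-- The action of an arrow on the regular representation. -/
def arrowOp {K : Type*} [Field K] {V E : Type*} (T : TriangulationQuiver V E)
    (m : T.Orbit → ℕ+) (c : T.Orbit → Kˣ) (β : E) :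
    Module.End K ((V ⊕ (E × ℕ) ⊕ V) →₀ K) :=
  Finsupp.linearCombination K fun x => match x with
    | Sum.inl j => if j = T.target β then pathVec T m c β 1 else 0
    | Sum.inr (Sum.inl (α, k)) =>
      if 1 ≤ k ∧ k < T.wt m α then
        if α = T.g β then pathVec T m c β (k + 1)
        else if α = T.f β ∧ k = 1 then
          (c (T.orbit (T.bar β)) : K) • pathVec T m c (T.bar β) (T.wt m (T.bar β) - 1)
        else 0
      else 0
    | Sum.inr (Sum.inr _) => 0

open scoped Classical in
/-- The action of a trivial path on the regular representation. -/
def vertexOp (K : Type*) [Field K] {V E : Type*} (T : TriangulationQuiver V E) (i : V) :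
    Module.End K ((V ⊕ (E × ℕ) ⊕ V) →₀ K) :=
  Finsupp.linearCombination K fun x => match x with
    | Sum.inl j => if j = i then Finsupp.single (Sum.inl j) 1 else 0
    | Sum.inr (Sum.inl (α, k)) =>
      if T.source α = i then Finsupp.single (Sum.inr (Sum.inl (α, k))) 1 else 0
    | Sum.inr (Sum.inr j) => if j = i then Finsupp.single (Sum.inr (Sum.inr j)) 1 else 0

variable {K : Type*} [Field K] {V E : Type*} {T : TriangulationQuiver V E}
  {m : T.Orbit → ℕ+} {c : T.Orbit → Kˣ}

local notation "P" => pathVec T m c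
local notation "A" => arrowOp T m c

open scoped Classical in
theorem arrowOp_vertex (β : E) (j : V) :
    A β (Finsupp.single (Sum.inl j) 1) = if j = T.target β then P β 1 else 0 := by
  simp [arrowOp]

theorem arrowOp_top (β : E) (j : V) (r : K) :
    A β (Finsupp.single (Sum.inr (Sum.inr j)) r) = 0 := by
  simp [arrowOp]

/-- The index set E × ℕ contains pairs with k = 0 or k ≥ m·n, which name no basis path. Arrows
annihilate these, so the relations hold on them trivially. -/
theorem arrowOp_path_invalid (β : E) {α : E} {k : ℕ} (h : ¬ (1 ≤ k ∧ k < T.wt m α)) (r : K) :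
    A β (Finsupp.single (Sum.inr (Sum.inl (α, k))) r) = 0 := by
  simp [arrowOp, h]

theorem pathVec_of_lt {α : E} {k : ℕ} (h : k < T.wt m α) :
    P α k = Finsupp.single (Sum.inr (Sum.inl (α, k))) 1 := by
  simp [pathVec, h]

theorem pathVec_wt (α : E) : P α (T.wt m α) =
    Finsupp.single (Sum.inr (Sum.inr (T.source α))) (((c (T.orbit α))⁻¹ : Kˣ) : K) := by
  simp [pathVec]

theorem pathVec_of_gt {α : E} {k : ℕ} (h : T.wt m α < k) : P α k = 0 := by
  simp [pathVec, h.not_gt, h.ne']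

theorem arrowOp_pathVec_g [Finite E] (β : E) {k : ℕ} (hk : 1 ≤ k) :
    A β (P (T.g β) k) = P β (k + 1) := by
  rcases lt_trichotomy k (T.wt m (T.g β)) with h | h | h
  · rw [pathVec_of_lt h, arrowOp, Finsupp.linearCombination_single, one_smul]
    simp [hk, h]
  · rw [h, pathVec_wt, arrowOp_top, wt_g, pathVec_of_gt (Nat.lt_succ_self _)]
  · rw [pathVec_of_gt h, map_zero, pathVec_of_gt]
    rw [wt_g] at h
    omega

theorem arrowOp_pathVec_f (h3 : ∀ α, 3 ≤ T.wt m α) (β : E) : A β (P (T.f β) 1) =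
    (c (T.orbit (T.bar β)) : K) • P (T.bar β) (T.wt m (T.bar β) - 1) := by
  have h : 1 < T.wt m (T.f β) := by have := h3 (T.f β); omega
  rw [pathVec_of_lt h, arrowOp, Finsupp.linearCombination_single, one_smul]
  simp [h, (T.g_ne_f β).symm]

theorem arrowOp_pathVec_f_of_two_le (β : E) {k : ℕ} (hk : 2 ≤ k) : A β (P (T.f β) k) = 0 := by
  rcases lt_trichotomy k (T.wt m (T.f β)) with h | h | h
  · rw [pathVec_of_lt h, arrowOp, Finsupp.linearCombination_single, one_smul]
    have : k ≠ 1 := by omega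
    simp [(T.g_ne_f β).symm, this]
  · rw [h, pathVec_wt, arrowOp_top]
  · rw [pathVec_of_gt h, map_zero]

theorem arrowOp_pathVec_of_ne (β : E) {α : E} (h : T.source α ≠ T.target β) (k : ℕ) :
    A β (P α k) = 0 := by
  have h1 : α ≠ T.g β := by rintro rfl; exact h (T.source_g β)
  have h2 : α ≠ T.f β := by rintro rfl; exact h (T.source_f β)
  rcases lt_trichotomy k (T.wt m α) with h | h | h
  · rw [pathVec_of_lt h, arrowOp, Finsupp.linearCombination_single, one_smul]
    simp [h1, h2]
  · rw [h, pathVec_wt, arrowOp_top]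
  · rw [pathVec_of_gt h, map_zero]

open scoped Classical in
theorem vertexOp_vertex (i j : V) :
    vertexOp K T i (Finsupp.single (Sum.inl j) 1) =
      if j = i then Finsupp.single (Sum.inl j) 1 else 0 := by
  rw [vertexOp, Finsupp.linearCombination_single, one_smul]

open scoped Classical in
theorem vertexOp_top (i j : V) (r : K) :
    vertexOp K T i (Finsupp.single (Sum.inr (Sum.inr j)) r) =
      if j = i then Finsupp.single (Sum.inr (Sum.inr j)) r else 0 := by
  rw [vertexOp, Finsupp.linearCombination_single]
  dsimp only
  split_ifs <;> simp

open scoped Classical in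
theorem vertexOp_path (i : V) (α : E) (k : ℕ) (r : K) :
    vertexOp K T i (Finsupp.single (Sum.inr (Sum.inl (α, k))) r) =
      if T.source α = i then Finsupp.single (Sum.inr (Sum.inl (α, k))) r else 0 := by
  rw [vertexOp, Finsupp.linearCombination_single]
  dsimp only
  split_ifs <;> simp

theorem vertexOp_pathVec (α : E) (k : ℕ) : vertexOp K T (T.source α) (P α k) = P α k := by
  classical
  rcases lt_trichotomy k (T.wt m α) with h | h | h
  · rw [pathVec_of_lt h, vertexOp_path, if_pos rfl]
  · rw [h, pathVec_wt, vertexOp_top, if_pos rfl]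
  · rw [pathVec_of_gt h, map_zero]

/-- Linear maps out of the regular representation agree if they do on basis vectors. -/
theorem regular_ext {F : Type*} [AddCommGroup F] [Module K F]
    {φ ψ : ((V ⊕ (E × ℕ) ⊕ V) →₀ K) →ₗ[K] F}
    (hv : ∀ i, φ (Finsupp.single (Sum.inl i) 1) = ψ (Finsupp.single (Sum.inl i) 1))
    (hp : ∀ α k, φ (Finsupp.single (Sum.inr (Sum.inl (α, k))) 1) =
      ψ (Finsupp.single (Sum.inr (Sum.inl (α, k))) 1))
    (ht : ∀ i, φ (Finsupp.single (Sum.inr (Sum.inr i)) 1) =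
      ψ (Finsupp.single (Sum.inr (Sum.inr i)) 1)) : φ = ψ := by
  apply Finsupp.lhom_ext
  intro a b
  have h : (Finsupp.single a b : (V ⊕ (E × ℕ) ⊕ V) →₀ K) = b • Finsupp.single a 1 := by simp
  rw [h, map_smul, map_smul]
  rcases a with i | ⟨α, k⟩ | i
  · rw [hv]
  · rw [hp]
  · rw [ht]

theorem arrowOp_mul_f_mul_g [Finite E] (h3 : ∀ α, 3 ≤ T.wt m α) (β : E) :
    A β * A (T.f β) * A (T.g (T.f β)) = 0 := by
  classical
  have key : ∀ k, 2 ≤ k → A β (P (T.f β) k) = 0 := fun k hk =>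
    arrowOp_pathVec_f_of_two_le β hk
  apply regular_ext
  · intro j
    simp only [Module.End.mul_apply, arrowOp_vertex, LinearMap.zero_apply]
    split_ifs
    · rw [arrowOp_pathVec_g _ le_rfl, key _ le_rfl]
    · simp
  · intro α k
    simp only [Module.End.mul_apply, LinearMap.zero_apply]
    by_cases hk : 1 ≤ k ∧ k < T.wt m α
    · rw [← pathVec_of_lt (c := c) hk.2]
      by_cases hs : T.source α = T.target (T.g (T.f β))
      · rcases T.eq_g_or_eq_f hs with rfl | rfl
        · rw [arrowOp_pathVec_g _ hk.1, arrowOp_pathVec_g _ (by omega), key _ (by omega)]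
        · by_cases hk2 : 2 ≤ k
          · rw [arrowOp_pathVec_f_of_two_le _ hk2, map_zero, map_zero]
          · obtain rfl : k = 1 := by omega
            have := h3 (T.f (T.f β))
            rw [arrowOp_pathVec_f h3, map_smul, bar_g, arrowOp_pathVec_f_of_two_le _ (by omega),
              smul_zero, map_zero]
      · rw [arrowOp_pathVec_of_ne _ hs, map_zero, map_zero]
    · rw [arrowOp_path_invalid _ hk, map_zero, map_zero]
  · intro i
    simp [Module.End.mul_apply, arrowOp_top]

variable (T m c) in
/-- The regular representation, as a representation of the path algebra. -/
def pathRep [Fintype V] : PathAlgebra K T →ₐ[K] Module.End K ((V ⊕ (E × ℕ) ⊕ V) →₀ K) :=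
  liftPath (vertexOp K T) (arrowOp T m c)
    (fun i => by
      classical
      apply regular_ext <;> intros <;>
        simp only [Module.End.mul_apply, vertexOp_vertex, vertexOp_path, vertexOp_top] <;>
        split_ifs <;> simp [vertexOp_vertex, vertexOp_path, vertexOp_top, *])
    (fun i j h => by
      classical
      apply regular_ext <;> intros <;>
        simp only [Module.End.mul_apply, vertexOp_vertex, vertexOp_path, vertexOp_top] <;>
        split_ifs <;> simp [vertexOp_vertex, vertexOp_path, vertexOp_top, *, h.symm])
    (by
      classical
      apply regular_ext <;> intros <;>
        simp [LinearMap.sum_apply, vertexOp_vertex, vertexOp_path, vertexOp_top])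
    (fun α => by
      classical
      apply regular_ext
      · intro i
        rw [Module.End.mul_apply, arrowOp_vertex]
        split_ifs
        · rw [vertexOp_pathVec]
        · rw [map_zero]
      · intro β k
        rw [Module.End.mul_apply, arrowOp, Finsupp.linearCombination_single, one_smul]
        dsimp only
        split_ifs
        · rw [vertexOp_pathVec]
        · rw [map_smul, ← T.source_bar α, vertexOp_pathVec]
        · rw [map_zero]
        · rw [map_zero]
      · intro i
        rw [Module.End.mul_apply, arrowOp_top, map_zero])
    (fun α => by
      classical
      apply regular_ext
      · intro i
        rw [Module.End.mul_apply, vertexOp_vertex, arrowOp_vertex]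
        split_ifs with h
        · rw [arrowOp_vertex, if_pos h]
        · rw [map_zero]
      · intro β k
        rw [Module.End.mul_apply, vertexOp_path]
        split_ifs with h
        · rfl
        · rw [map_zero]
          by_cases hk : 1 ≤ k ∧ k < T.wt m β
          · rw [← pathVec_of_lt (c := c) hk.2, arrowOp_pathVec_of_ne _ h]
          · rw [arrowOp_path_invalid _ hk]
      · intro i
        rw [Module.End.mul_apply, arrowOp_top, vertexOp_top]
        split_ifs
        · rw [arrowOp_top]
        · rw [map_zero])

variable [Fintype V]

theorem pathRep_gPath_pathVec [Finite E] (α : E) (l : ℕ) {k : ℕ} (hk : 1 ≤ k) :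
    pathRep T m c (gPath K T α l) (P (T.g^[l] α) k) = P α (l + k) := by
  induction l generalizing α with
  | zero => simp [gPath_zero]
  | succ l ih =>
    rw [gPath_succ, map_mul, Module.End.mul_apply, Function.iterate_succ_apply, ih, pathRep,
      liftPath_arrow, arrowOp_pathVec_g _ (by omega)]
    congr 1
    omega

theorem pathRep_gPath_succ (α : E) (l : ℕ) (x : (V ⊕ (E × ℕ) ⊕ V) →₀ K) :
    pathRep T m c (gPath K T α (l + 1)) x =
      pathRep T m c (gPath K T α l) (A (T.g^[l] α) x) := by
  rw [gPath_succ', map_mul, Module.End.mul_apply]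
  simp [pathRep]

/-- On a trivial path both sides produce A_{β̄}, and on paths starting with g(f(β)) both vanish. The
essential case is the single arrow f²(β): it closes the cycle of β on the left and the cycle of β̄
on the right. The factor c⁻¹ built into `pathVec` makes both equal to the same socle vector. -/
theorem arrowOp_mul_f [Finite E] (h3 : ∀ α, 3 ≤ T.wt m α) (β : E) : A β * A (T.f β) =
    (c (T.orbit (T.bar β)) : K) •
      pathRep T m c (gPath K T (T.bar β) (T.wt m (T.bar β) - 1)) := by
  classical
  obtain ⟨n, hn⟩ : ∃ n, T.wt m (T.bar β) = n + 3 := ⟨_, (Nat.sub_add_cancel (h3 _)).symm⟩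
  have hlast := T.iterate_wt_sub_one m (h3 (T.bar β))
  rw [hn, show n + 3 - 1 = n + 2 by omega, bar_bar] at hlast
  have hγ : T.target (T.g^[n + 1] (T.bar β)) = T.target (T.f β) := by
    rw [← source_g, ← Function.iterate_succ_apply' T.g, hlast, source_f]
  have hγ' : T.f (T.g^[n + 1] (T.bar β)) = T.g (T.f β) := by
    rw [← bar_g, ← Function.iterate_succ_apply' T.g, hlast, bar_f]
  rw [hn, show n + 3 - 1 = n + 2 by omega]
  apply regular_ext
  · intro j
    rw [Module.End.mul_apply, LinearMap.smul_apply, pathRep_gPath_succ, arrowOp_vertex,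
      arrowOp_vertex, hγ]
    split_ifs
    · rw [pathRep_gPath_pathVec _ _ le_rfl, arrowOp_pathVec_f h3, hn]
      rfl
    · simp
  · intro α k
    rw [Module.End.mul_apply, LinearMap.smul_apply]
    by_cases hk : 1 ≤ k ∧ k < T.wt m α
    · rw [← pathVec_of_lt (c := c) hk.2]
      by_cases hs : T.source α = T.target (T.f β)
      · rcases T.eq_g_or_eq_f hs with rfl | rfl
        · rw [arrowOp_pathVec_g _ hk.1, arrowOp_pathVec_f_of_two_le _ (by omega),
            pathRep_gPath_succ,
            ← hγ']
          by_cases hk2 : 2 ≤ k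
          · rw [arrowOp_pathVec_f_of_two_le _ hk2, map_zero, smul_zero]
          · obtain rfl : k = 1 := by omega
            have := h3 (T.bar (T.g^[n + 1] (T.bar β)))
            rw [arrowOp_pathVec_f h3, map_smul, pathRep_gPath_succ,
              Function.iterate_succ_apply', bar_g, arrowOp_pathVec_f_of_two_le, map_zero, smul_zero,
              smul_zero]
            rw [Function.iterate_succ_apply', bar_g] at this
            omega
        · have e1 : pathRep T m c (gPath K T (T.bar β) (n + 2)) (P (T.f (T.f β)) k) =
              P (T.bar β) (n + 2 + k) := by
            rw [← hlast]
            exact pathRep_gPath_pathVec _ _ hk.1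
          rw [e1]
          by_cases hk2 : 2 ≤ k
          · rw [arrowOp_pathVec_f_of_two_le _ hk2, map_zero, pathVec_of_gt (by omega), smul_zero]
          · obtain rfl : k = 1 := by omega
            have hb := h3 β
            rw [arrowOp_pathVec_f h3, map_smul, bar_f, wt_g, arrowOp_pathVec_g _ (by omega),
              Nat.sub_add_cancel (by omega), show n + 2 + 1 = T.wt m (T.bar β) from hn.symm,
              pathVec_wt, pathVec_wt, orbit_g, source_bar]
            simp
      · rw [arrowOp_pathVec_of_ne _ hs, pathRep_gPath_succ, arrowOp_pathVec_of_ne _ (by rwa [hγ])]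
        simp
    · rw [arrowOp_path_invalid _ hk, pathRep_gPath_succ, arrowOp_path_invalid _ hk]
      simp
  · intro i
    rw [Module.End.mul_apply, LinearMap.smul_apply, pathRep_gPath_succ, arrowOp_top, arrowOp_top]
    simp

variable [Finite E]

/-- The regular representation of the weighted triangulation algebra. -/
def regularRep (h3 : ∀ α, 3 ≤ T.wt m α) :
    WeightedAlgebra T m c →ₐ[K] Module.End K ((V ⊕ (E × ℕ) ⊕ V) →₀ K) :=
  liftWeighted (B := Module.End K ((V ⊕ (E × ℕ) ⊕ V) →₀ K)) (pathRep T m c)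
    (fun α => by
      rw [← arrowOp_mul_f (c := c) h3]
      simp [pathRep])
    (fun α => by
      rw [← arrowOp_mul_f_mul_g (c := c) h3 α]
      simp [pathRep])

theorem regularRep_pth (h3 : ∀ α, 3 ≤ T.wt m α) (α : E) (k : ℕ) :
    regularRep (c := c) h3 (pth T m c α k) = pathRep T m c (gPath K T α k) :=
  liftWeighted_toWeighted _ _ _ _

/-- The symmetrizing form: the sum of the coefficients at the socle elements. -/
def symForm (h3 : ∀ α, 3 ≤ T.wt m α) : WeightedAlgebra T m c →ₗ[K] K :=
  (Finsupp.linearCombination K fun x => match x with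
    | Sum.inr (Sum.inr _) => (1 : K)
    | _ => 0) ∘ₗ LinearMap.applyₗ (∑ i, Finsupp.single (Sum.inl i) 1) ∘ₗ
      (regularRep h3).toLinearMap

theorem symForm_pth (h3 : ∀ α, 3 ≤ T.wt m α) (α : E) {k : ℕ} (hk : k ≠ 0) :
    symForm h3 (pth T m c α k) =
      if k = T.wt m α then (((c (T.orbit α))⁻¹ : Kˣ) : K) else 0 := by
  classical
  obtain ⟨k, rfl⟩ := Nat.exists_eq_succ_of_ne_zero hk
  -- The sum of the trivial paths plays the part of the unit: acting on it returns the path itself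
  -- as a vector.
  have : regularRep h3 (pth T m c α (k + 1)) (∑ i, Finsupp.single (Sum.inl i) 1) =
      P α (k + 1) := by
    rw [regularRep_pth, map_sum]
    simp_rw [pathRep_gPath_succ, arrowOp_vertex]
    rw [Finset.sum_eq_single (T.target (T.g^[k] α))]
    · rw [if_pos rfl, pathRep_gPath_pathVec _ _ le_rfl]
    · intro i _ hi
      rw [if_neg hi, map_zero]
    · simp
  simp only [symForm, LinearMap.comp_apply, AlgHom.toLinearMap_apply, LinearMap.applyₗ_apply_apply,
    Nat.succ_eq_add_one, this]
  rcases lt_trichotomy (k + 1) (T.wt m α) with h | h | h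
  · rw [pathVec_of_lt h, if_neg h.ne]
    simp
  · rw [if_pos h, h, pathVec_wt]
    simp
  · rw [pathVec_of_gt h, if_neg h.ne', map_zero]

end Representation

end TriangulationQuiver

namespace TriangulationQuiver

theorem target_iterate_wt {V E : Type*} {T : TriangulationQuiver V E} {m : T.Orbit → ℕ+}
    (h3 : ∀ α, 3 ≤ T.wt m α) {β : E} {l : ℕ} (h : l + 1 = T.wt m β) :
    T.target (T.g^[l] β) = T.source β := by
  have := T.iterate_wt_sub_one m (h3 β)
  rw [← h, Nat.add_sub_cancel] at this
  rw [this, target_f_f, source_bar]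

/-! ### Symmetry and nondegeneracy of the form, and the socle -/

section SymForm

variable {K : Type*} [Field K] {V E : Type*} [Fintype V] {T : TriangulationQuiver V E}
  {m : T.Orbit → ℕ+} {c : T.Orbit → Kˣ} [Finite E]

local notation "e" => idm T m c
local notation "p" => pth T m c

theorem symForm_pth_mul_pth (h3 : ∀ α, 3 ≤ T.wt m α) (α β : E) {k l : ℕ} (hk : k ≠ 0)
    (hl : l ≠ 0) [Decidable (β = T.g^[k] α ∧ k + l = T.wt m α)] :
    symForm h3 (p α k * p β l) =
      if β = T.g^[k] α ∧ k + l = T.wt m α then (((c (T.orbit α))⁻¹ : Kˣ) : K) else 0 := by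
  obtain ⟨k, rfl⟩ : ∃ k', k = k' + 1 := ⟨k - 1, by omega⟩
  rcases pth_mul_pth_cases (c := c) h3 α β k l hl with ⟨h1, h⟩ | ⟨h1, h | ⟨-, rfl, rfl, h⟩⟩
  · rw [h, symForm_pth h3 _ (by omega)]
    simp only [h1, true_and]
  · rw [h, map_zero, if_neg (fun h => h1 h.1)]
  · have := h3 (T.bar α)
    rw [h, map_smul, symForm_pth h3 _ (by omega), if_neg (by omega), smul_zero,
      if_neg (fun h => h1 h.1)]

theorem symForm_idm_mul_pth (h3 : ∀ α, 3 ≤ T.wt m α) (i : V) (β : E) {l : ℕ} (hl : l ≠ 0)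
    [Decidable (i = T.source β ∧ l = T.wt m β)] :
    symForm h3 (e i * p β l) =
      if i = T.source β ∧ l = T.wt m β then (((c (T.orbit β))⁻¹ : Kˣ) : K) else 0 := by
  by_cases h : i = T.source β
  · subst h
    rw [idm_mul_pth hl, symForm_pth h3 _ hl]
    simp
  · rw [idm_mul_pth_of_ne hl h, map_zero, if_neg (fun h' => h h'.1)]

theorem symForm_pth_mul_idm (h3 : ∀ α, 3 ≤ T.wt m α) (i : V) (β : E) {l : ℕ} (hl : l ≠ 0)
    [Decidable (i = T.source β ∧ l = T.wt m β)] :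
    symForm h3 (p β l * e i) =
      if i = T.source β ∧ l = T.wt m β then (((c (T.orbit β))⁻¹ : Kˣ) : K) else 0 := by
  obtain ⟨l, rfl⟩ : ∃ l', l = l' + 1 := ⟨l - 1, by omega⟩
  by_cases h : i = T.target (T.g^[l] β)
  · subst h
    rw [pth_mul_idm, symForm_pth h3 _ hl]
    by_cases hw : l + 1 = T.wt m β
    · rw [if_pos hw, if_pos ⟨target_iterate_wt h3 hw, hw⟩]
    · rw [if_neg hw, if_neg (fun h => hw h.2)]
  · rw [pth_mul_idm_of_ne h, map_zero, if_neg]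
    rintro ⟨rfl, hw⟩
    exact h (target_iterate_wt h3 hw).symm

/-- A product of paths is seen by the form only if it runs exactly once through a full weighted
g-cycle. Exchanging the factors rotates that cycle, which changes neither its length nor its orbit,
hence not its parameter c. -/
theorem symForm_mul_comm (h3 : ∀ α, 3 ≤ T.wt m α) (x y : WeightedAlgebra T m c) :
    symForm h3 (x * y) = symForm h3 (y * x) := by
  classical
  have hx : x ∈ filt T m c 0 := filt_zero (c := c) h3 ▸ Submodule.mem_top
  have hy : y ∈ filt T m c 0 := filt_zero (c := c) h3 ▸ Submodule.mem_top
  induction hx using Submodule.span_induction with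
  | zero => simp
  | add x x' _ _ hx hx' => rw [add_mul, mul_add, map_add, map_add, hx, hx']
  | smul r x _ hx => rw [smul_mul_assoc, mul_smul_comm, map_smul, map_smul, hx]
  | mem x hx =>
    induction hy using Submodule.span_induction with
    | zero => simp
    | add x x' _ _ hx hx' => rw [add_mul, mul_add, map_add, map_add, hx, hx']
    | smul r x _ hx => rw [smul_mul_assoc, mul_smul_comm, map_smul, map_smul, hx]
    | mem y hy =>
      rcases hx with ⟨-, i, rfl⟩ | ⟨α, k, hk, -, rfl⟩
      · rcases hy with ⟨-, j, rfl⟩ | ⟨β, l, hl, -, rfl⟩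
        · by_cases h : i = j
          · rw [h]
          · rw [idm_mul_idm_of_ne h, idm_mul_idm_of_ne (Ne.symm h)]
        · rw [symForm_idm_mul_pth h3 _ _ hl.ne', symForm_pth_mul_idm h3 _ _ hl.ne']
      · rcases hy with ⟨-, j, rfl⟩ | ⟨β, l, hl, -, rfl⟩
        · rw [symForm_idm_mul_pth h3 _ _ hk.ne', symForm_pth_mul_idm h3 _ _ hk.ne']
        · rw [symForm_pth_mul_pth h3 _ _ hk.ne' hl.ne', symForm_pth_mul_pth h3 _ _ hl.ne' hk.ne']
          have key : ∀ (α β : E) (k l : ℕ), β = T.g^[k] α ∧ k + l = T.wt m α →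
              α = T.g^[l] β ∧ l + k = T.wt m β := by
            rintro α β k l ⟨rfl, h⟩
            rw [← Function.iterate_add_apply, add_comm l k, h, iterate_wt, wt_iterate]
            exact ⟨rfl, rfl⟩
          by_cases h : β = T.g^[k] α ∧ k + l = T.wt m α
          · rw [if_pos h, if_pos (key _ _ _ _ h), h.1, orbit_iterate]
          · rw [if_neg h, if_neg (fun h' => h (key _ _ _ _ h'))]

/-- Only a spanning statement: the coefficients are not unique, because the two full cycles at a
vertex are proportional. -/
theorem exists_coeff [Fintype E] (h3 : ∀ α, 3 ≤ T.wt m α) (x : WeightedAlgebra T m c) :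
    ∃ (r : V → K) (s : E → ℕ → K), x = ∑ i, r i • e i +
      ∑ α, ∑ k ∈ Finset.Icc 1 (T.wt m α), s α k • p α k := by
  classical
  have hx : x ∈ filt T m c 0 := filt_zero (c := c) h3 ▸ Submodule.mem_top
  induction hx using Submodule.span_induction with
  | zero => exact ⟨0, 0, by simp⟩
  | add x y _ _ hx hy =>
    obtain ⟨r, s, rfl⟩ := hx
    obtain ⟨r', s', rfl⟩ := hy
    refine ⟨r + r', s + s', ?_⟩
    simp only [Pi.add_apply, add_smul, Finset.sum_add_distrib]
    abel
  | smul t x _ hx =>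
    obtain ⟨r, s, rfl⟩ := hx
    refine ⟨t • r, t • s, ?_⟩
    simp only [Pi.smul_apply, smul_eq_mul, mul_smul, Finset.smul_sum, smul_add]
  | mem x hx =>
    rcases hx with ⟨-, i, rfl⟩ | ⟨α, k, hk, -, rfl⟩
    · refine ⟨Pi.single i 1, 0, ?_⟩
      simp [Pi.single_apply, ite_smul]
    · by_cases h : k ≤ T.wt m α
      · refine ⟨0, Pi.single α (Pi.single k 1), ?_⟩
        rw [Finset.sum_eq_single α]
        · rw [Finset.sum_eq_single k]
          · simp
          · intro l _ hl
            simp [hl]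
          · simp only [Finset.mem_Icc]
            omega
        · intro β _ hβ
          simp [hβ]
        · simp
      · exact ⟨0, 0, by rw [pth_eq_zero h3 (by omega)]; simp⟩

variable (T m c) in
/-- The socle element at a vertex. -/
def socle (i : V) : WeightedAlgebra T m c :=
  (c (T.orbit (T.exists_source i).choose) : K) •
    p (T.exists_source i).choose (T.wt m (T.exists_source i).choose)

/-- The socle element does not depend on which of the two arrows at the vertex was chosen to define
it. -/
theorem socle_source (h3 : ∀ α, 3 ≤ T.wt m α) (α : E) :
    socle T m c (T.source α) = (c (T.orbit α) : K) • p α (T.wt m α) := by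
  rw [socle]
  rcases T.eq_or_eq_bar (T.exists_source (T.source α)).choose_spec with h | h
  · rw [h]
  · rw [h, smul_pth_wt_eq α h3]

theorem pth_wt (h3 : ∀ α, 3 ≤ T.wt m α) (α : E) :
    p α (T.wt m α) = (((c (T.orbit α))⁻¹ : Kˣ) : K) • socle T m c (T.source α) := by
  rw [socle_source h3, smul_smul]
  simp

theorem symForm_socle (h3 : ∀ α, 3 ≤ T.wt m α) (i : V) : symForm h3 (socle T m c i) = 1 := by
  obtain ⟨α, rfl⟩ := T.exists_source i
  have := h3 α
  rw [socle_source h3, map_smul, symForm_pth h3 _ (by omega), if_pos rfl]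
  simp

theorem idm_mul_socle (h3 : ∀ α, 3 ≤ T.wt m α) (i : V) :
    e i * socle T m c i = socle T m c i := by
  obtain ⟨α, rfl⟩ := T.exists_source i
  have := h3 α
  rw [socle_source h3, mul_smul_comm, idm_mul_pth (by omega)]

theorem socle_mul_idm (h3 : ∀ α, 3 ≤ T.wt m α) (i : V) :
    socle T m c i * e i = socle T m c i := by
  obtain ⟨α, rfl⟩ := T.exists_source i
  have := h3 α
  obtain ⟨n, hn⟩ : ∃ n, T.wt m α = n + 1 := ⟨T.wt m α - 1, by omega⟩
  have h := pth_mul_idm (c := c) (m := m) α n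
  rw [target_iterate_wt h3 hn.symm] at h
  rw [socle_source h3, smul_mul_assoc, hn, h]

theorem socle_mem_filt (h3 : ∀ α, 3 ≤ T.wt m α) (i : V) : socle T m c i ∈ filt T m c 1 := by
  obtain ⟨α, rfl⟩ := T.exists_source i
  have := h3 α
  rw [socle_source h3]
  exact Submodule.smul_mem _ _ (pth_mem_filt (by omega) (by omega))

theorem socle_mul (h3 : ∀ α, 3 ≤ T.wt m α) (i : V) {x : WeightedAlgebra T m c}
    (hx : x ∈ filt T m c 1) : socle T m c i * x = 0 := by
  obtain ⟨α, rfl⟩ := T.exists_source i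
  induction hx using Submodule.span_induction with
  | zero => simp
  | add x x' _ _ hx hx' => rw [mul_add, hx, hx', add_zero]
  | smul r x _ hx => rw [mul_smul_comm, hx, smul_zero]
  | mem x hx =>
    rcases hx with ⟨h, -⟩ | ⟨β, l, hl, -, rfl⟩
    · omega
    · by_cases hs : T.source β = T.source α
      · have : p β (T.wt m β) * p β l = 0 := by
          have h := pth_add (m := m) (c := c) β (T.wt m β) l
          rw [iterate_wt] at h
          rw [← h, pth_eq_zero h3 (by omega)]
        rw [← hs, socle_source h3, smul_mul_assoc, this, smul_zero]
      · rw [← socle_mul_idm h3, mul_assoc, idm_mul_pth_of_ne hl.ne' (Ne.symm hs), mul_zero]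

/-- The symmetrizing form is nondegenerate. -/
theorem eq_zero_of_symForm (h3 : ∀ α, 3 ≤ T.wt m α) {x : WeightedAlgebra T m c}
    (hx : ∀ y, symForm h3 (y * x) = 0) : x = 0 := by
  classical
  cases nonempty_fintype E
  obtain ⟨r, s, hrs⟩ := exists_coeff h3 x
  have hφ : ∀ y, ∑ i, r i • symForm h3 (y * e i) +
      ∑ α, ∑ k ∈ Finset.Icc 1 (T.wt m α), s α k • symForm h3 (y * p α k) = 0 := by
    intro y
    rw [← hx y, hrs]
    simp only [mul_add, Finset.mul_sum, mul_smul_comm, map_add, map_sum, map_smul]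
  -- The complementary part of the g-cycle pairs nontrivially with this one path only, so it
  -- isolates the coefficient.
  have hs : ∀ α, ∀ k ∈ Finset.Icc 1 (T.wt m α), k ≠ T.wt m α → s α k = 0 := by
    intro α k hk hk'
    rw [Finset.mem_Icc] at hk
    have h := hφ (p (T.g^[k] α) (T.wt m α - k))
    rw [Finset.sum_eq_zero, zero_add, Finset.sum_eq_single α, Finset.sum_eq_single k] at h
    · rw [symForm_pth_mul_pth h3 _ _ (by omega) (by omega), if_pos] at h
      · simpa using h
      · rw [← Function.iterate_add_apply, wt_iterate, Nat.sub_add_cancel hk.2, iterate_wt]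
        exact ⟨rfl, rfl⟩
    · intro l hl hlk
      rw [Finset.mem_Icc] at hl
      rw [symForm_pth_mul_pth h3 _ _ (by omega) (by omega), if_neg, smul_zero]
      rw [wt_iterate]
      omega
    · intro h
      exact absurd (Finset.mem_Icc.2 hk) h
    · intro β _ hβ
      apply Finset.sum_eq_zero
      intro l hl
      rw [Finset.mem_Icc] at hl
      rw [symForm_pth_mul_pth h3 _ _ (by omega) (by omega), if_neg, smul_zero]
      rw [← Function.iterate_add_apply, Nat.sub_add_cancel hk.2, iterate_wt]
      exact fun h => hβ h.1
    · simp
    · intro i _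
      rw [symForm_pth_mul_idm h3 _ _ (by omega), if_neg, smul_zero]
      rw [wt_iterate]
      omega
  -- A full cycle pairs to zero with every path of positive length, so it isolates the coefficient
  -- of the trivial path.
  have hr : ∀ i, r i = 0 := by
    intro i
    obtain ⟨α, rfl⟩ := T.exists_source i
    have h3α := h3 α
    have h := hφ (p α (T.wt m α))
    rw [Finset.sum_eq_single (T.source α), add_comm, Finset.sum_eq_zero, zero_add] at h
    · rw [symForm_pth_mul_idm h3 _ _ (by omega), if_pos ⟨rfl, rfl⟩] at h
      simpa using h
    · intro β _
      apply Finset.sum_eq_zero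
      intro l hl
      rw [Finset.mem_Icc] at hl
      rw [symForm_pth_mul_pth h3 _ _ (by omega) (by omega), if_neg, smul_zero]
      omega
    · intro i _ hi
      rw [symForm_pth_mul_idm h3 _ _ (by omega), if_neg (fun h => hi h.1), smul_zero]
    · simp
  have hx' : x = ∑ α, s α (T.wt m α) • p α (T.wt m α) := by
    rw [hrs]
    simp only [hr, zero_smul, Finset.sum_const_zero, zero_add]
    refine Finset.sum_congr rfl fun α _ => ?_
    have h3α := h3 α
    rw [Finset.sum_eq_single (T.wt m α)]
    · intro k hk hk'
      rw [hs α k hk hk', zero_smul]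
    · simp only [Finset.mem_Icc]
      omega
  -- What remains at each vertex is a multiple of the socle element, on which the form takes the
  -- value 1.
  have hi : ∀ i, e i * x = 0 := by
    intro i
    have h1 : e i * x = (∑ α, if i = T.source α then
        s α (T.wt m α) * (((c (T.orbit α))⁻¹ : Kˣ) : K) else 0) • socle T m c i := by
      rw [hx', Finset.mul_sum, Finset.sum_smul]
      refine Finset.sum_congr rfl fun α _ => ?_
      have h3α := h3 α
      split_ifs with h
      · rw [mul_smul_comm, h, idm_mul_pth (by omega), pth_wt h3, smul_smul]
      · rw [mul_smul_comm, idm_mul_pth_of_ne (by omega) h, smul_zero, zero_smul]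
    have h2 := hx (e i)
    rw [h1, map_smul, symForm_socle, smul_eq_mul, mul_one] at h2
    rw [h1, h2, zero_smul]
  rw [← one_mul x, ← sum_idm, Finset.sum_mul]
  exact Finset.sum_eq_zero fun i _ => hi i

theorem exists_sub_mem_filt (h3 : ∀ α, 3 ≤ T.wt m α) (x : WeightedAlgebra T m c) :
    ∃ r : V → K, x - ∑ i, r i • e i ∈ filt T m c 1 := by
  cases nonempty_fintype E
  obtain ⟨r, s, rfl⟩ := exists_coeff h3 x
  refine ⟨r, ?_⟩
  rw [add_sub_cancel_left]
  refine sum_mem fun α _ => sum_mem fun k hk => Submodule.smul_mem _ _ (pth_mem_filt ?_ ?_) <;>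
  · rw [Finset.mem_Icc] at hk
    omega

end SymForm

end TriangulationQuiver

/-! ### Uniqueness of projective covers and syzygies -/

section Syzygy

variable {R : Type u} [Ring R]

/-- A lift between the two covers is surjective because its image and the superfluous kernel
together fill the target. It then splits, and the splitting is surjective by the same argument on
the other side. -/
theorem IsProjectiveCover.exists_equiv {M P P' : Type*} [AddCommGroup M] [Module R M]
    [AddCommGroup P] [Module R P] [AddCommGroup P'] [Module R P'] {p : P →ₗ[R] M}
    {p' : P' →ₗ[R] M} (hp : IsProjectiveCover p) (hp' : IsProjectiveCover p') :
    ∃ f : P ≃ₗ[R] P', ∀ x, p' (f x) = p x := by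
  obtain ⟨h1, h2, h3⟩ := hp
  obtain ⟨h1', h2', h3'⟩ := hp'
  obtain ⟨f, hf⟩ := Module.projective_lifting_property p' p h2'
  have hf' : ∀ x, p' (f x) = p x := fun x => LinearMap.congr_fun hf x
  have hfs : Function.Surjective f := by
    rw [← LinearMap.range_eq_top]
    apply h3'
    rw [eq_top_iff]
    intro y _
    obtain ⟨x, hx⟩ := h2 (p' y)
    refine Submodule.mem_sup.2 ⟨f x, ⟨x, rfl⟩, y - f x, ?_, by abel⟩
    rw [LinearMap.mem_ker, map_sub, hf', hx, sub_self]
  obtain ⟨s, hs⟩ := Module.projective_lifting_property f LinearMap.id hfs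
  have hs' : ∀ x, f (s x) = x := fun x => LinearMap.congr_fun hs x
  have hss : Function.Surjective s := by
    rw [← LinearMap.range_eq_top]
    apply h3
    rw [eq_top_iff]
    intro y _
    refine Submodule.mem_sup.2 ⟨s (f y), ⟨f y, rfl⟩, y - s (f y), ?_, by abel⟩
    rw [LinearMap.mem_ker, map_sub, ← hf' (s _), hs', hf', sub_self]
  have hfi : Function.Injective f := by
    intro x y h
    obtain ⟨x, rfl⟩ := hss x
    obtain ⟨y, rfl⟩ := hss y
    rw [hs', hs'] at h
    rw [h]
  exact ⟨LinearEquiv.ofBijective f ⟨hfi, hfs⟩, hf'⟩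

theorem IsProjectiveCover.comp_equiv {M M' P : Type*} [AddCommGroup M] [Module R M]
    [AddCommGroup M'] [Module R M'] [AddCommGroup P] [Module R P] {p : P →ₗ[R] M}
    (hp : IsProjectiveCover p) (f : M ≃ₗ[R] M') : IsProjectiveCover (f.toLinearMap ∘ₗ p) := by
  refine ⟨hp.1, f.surjective.comp hp.2.1, ?_⟩
  rw [LinearEquiv.ker_comp]
  exact hp.2.2

theorem IsProjectiveCover.nonempty_ker_equiv {M P P' : Type*} [AddCommGroup M] [Module R M]
    [AddCommGroup P] [Module R P] [AddCommGroup P'] [Module R P'] {p : P →ₗ[R] M}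
    {p' : P' →ₗ[R] M} (hp : IsProjectiveCover p) (hp' : IsProjectiveCover p') :
    Nonempty (LinearMap.ker p ≃ₗ[R] LinearMap.ker p') := by
  obtain ⟨f, hf⟩ := hp.exists_equiv hp'
  refine ⟨f.ofSubmodules _ _ ?_⟩
  ext y
  rw [Submodule.mem_map]
  constructor
  · rintro ⟨x, hx, rfl⟩
    exact (hf x).trans hx
  · intro hy
    refine ⟨f.symm y, ?_, f.apply_symm_apply y⟩
    rw [LinearMap.mem_ker, ← hf, f.apply_symm_apply]
    exact hy

theorem IsSyzygy.congr {n : ℕ} {M M' N : Type w} [AddCommGroup M] [Module R M]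
    [AddCommGroup M'] [Module R M'] [AddCommGroup N] [Module R N] (f : M ≃ₗ[R] M')
    (h : IsSyzygy R n M N) : IsSyzygy R n M' N := by
  cases n with
  | zero =>
    obtain ⟨g⟩ := h
    exact ⟨g.trans f⟩
  | succ n =>
    obtain ⟨P, _, _, p, hp, h⟩ := h
    refine ⟨P, _, _, f.toLinearMap ∘ₗ p, hp.comp_equiv f, ?_⟩
    rw [LinearEquiv.ker_comp]
    exact h

theorem IsSyzygy.unique {n : ℕ} {M N N' : Type w} [AddCommGroup M] [Module R M]
    [AddCommGroup N] [Module R N] [AddCommGroup N'] [Module R N']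
    (h : IsSyzygy R n M N) (h' : IsSyzygy R n M N') : Nonempty (N ≃ₗ[R] N') := by
  induction n generalizing M with
  | zero =>
    obtain ⟨g⟩ := h
    obtain ⟨g'⟩ := h'
    exact ⟨g.trans g'.symm⟩
  | succ n ih =>
    obtain ⟨P, _, _, p, hp, h⟩ := h
    obtain ⟨P', _, _, p', hp', h'⟩ := h'
    obtain ⟨f⟩ := hp.nonempty_ker_equiv hp'
    exact ih (h.congr f) h'

theorem IsSyzygy.add {n k : ℕ} {M N N' : Type w} [AddCommGroup M] [Module R M]
    [AddCommGroup N] [Module R N] [AddCommGroup N'] [Module R N']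
    (h : IsSyzygy R n M N) (h' : IsSyzygy R k N N') : IsSyzygy R (k + n) M N' := by
  induction n generalizing M with
  | zero =>
    obtain ⟨g⟩ := h
    exact h'.congr g
  | succ n ih =>
    obtain ⟨P, _, _, p, hp, h⟩ := h
    exact ⟨P, _, _, p, hp, ih h⟩

/-- If `Ωᵏ(M) ≅ N` and `Ωᵏ⁺ⁿ(M) ≅ N'` then `Ωⁿ(N) ≅ N'`. -/
theorem IsSyzygy.sub {n k : ℕ} {M N N' : Type w} [AddCommGroup M] [Module R M]
    [AddCommGroup N] [Module R N] [AddCommGroup N'] [Module R N']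
    (h : IsSyzygy R n M N) (h' : IsSyzygy R (k + n) M N') : IsSyzygy R k N N' := by
  induction n generalizing M with
  | zero =>
    obtain ⟨g⟩ := h
    exact h'.congr g.symm
  | succ n ih =>
    obtain ⟨P, _, _, p, hp, h⟩ := h
    obtain ⟨P', _, _, p', hp', h'⟩ := h'
    obtain ⟨f⟩ := hp'.nonempty_ker_equiv hp
    exact ih h (IsSyzygy.congr f h')

theorem IsSyzygy.succ {n : ℕ} {P M N : Type w} [AddCommGroup M] [Module R M]
    [AddCommGroup P] [Module R P] [AddCommGroup N] [Module R N] {p : P →ₗ[R] M}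
    (hp : IsProjectiveCover p) (h : IsSyzygy R n (LinearMap.ker p) N) :
    IsSyzygy R (n + 1) M N :=
  ⟨P, _, _, p, hp, h⟩

theorem IsSyzygy.succ_range {n : ℕ} {P Q N : Type w} [AddCommGroup Q] [Module R Q]
    [AddCommGroup P] [Module R P] [AddCommGroup N] [Module R N] {p : P →ₗ[R] Q}
    (hp : IsProjectiveCover p.rangeRestrict) (h : IsSyzygy R n (LinearMap.ker p) N) :
    IsSyzygy R (n + 1) (LinearMap.range p) N :=
  IsSyzygy.succ hp (h.congr (LinearEquiv.ofEq _ _ p.ker_rangeRestrict.symm))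

theorem IsSyzygy.of_range_eq {n : ℕ} {P Q M N : Type w} [AddCommGroup Q] [Module R Q]
    [AddCommGroup P] [Module R P] [AddCommGroup M] [Module R M] [AddCommGroup N] [Module R N]
    {p : P →ₗ[R] Q} {q : Q →ₗ[R] M} (h : LinearMap.range p = LinearMap.ker q)
    (hp : IsSyzygy R n (LinearMap.range p) N) : IsSyzygy R n (LinearMap.ker q) N :=
  hp.congr (LinearEquiv.ofEq _ _ h)

theorem isProjectiveCover_of_ker_le {P M : Type*} [AddCommGroup P] [Module R P]
    [AddCommGroup M] [Module R M] [Module.Projective R P] [Module.Finite R P] {p : P →ₗ[R] M}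
    (hs : Function.Surjective p) (hk : LinearMap.ker p ≤ Ring.jacobson R • ⊤) :
    IsProjectiveCover p := by
  refine ⟨inferInstance, hs, fun N hN => ?_⟩
  by_contra hne
  -- A proper submodule of a finitely generated module lies in a maximal one, and every maximal
  -- submodule contains rad(R)·P.
  obtain ⟨C, hC, hNC⟩ := (eq_top_or_exists_le_coatom N).resolve_left hne
  apply hC.1
  rw [eq_top_iff, ← hN]
  refine sup_le hNC (hk.trans ((Ring.jacobson_smul_top_le R P).trans ?_))
  exact sInf_le hC

end Syzygy

/-! ### Projective modules given by families of idempotents -/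

section ProjMod

variable {R : Type*} [Ring R] {ι κ : Type*}

/-- The direct sum of the left ideals `R ε_a`. -/
def projMod (ε : ι → R) : Submodule R (ι → R) where
  carrier := {x | ∀ a, x a * ε a = x a}
  add_mem' hx hy a := by rw [Pi.add_apply, add_mul, hx a, hy a]
  zero_mem' a := by simp
  smul_mem' r x hx a := by rw [Pi.smul_apply, smul_eq_mul, mul_assoc, hx a]

/-- The projection onto the direct sum of the left ideals `R ε_a`. -/
def toProjMod (ε : ι → R) (hε : ∀ a, ε a * ε a = ε a) : (ι → R) →ₗ[R] projMod ε where
  toFun x := ⟨fun a => x a * ε a, fun a => by rw [mul_assoc, hε]⟩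
  map_add' x y := by ext a; simp [add_mul]
  map_smul' r x := by ext a; simp [mul_assoc]

theorem toProjMod_coe (ε : ι → R) (hε : ∀ a, ε a * ε a = ε a) (x : projMod ε) :
    toProjMod ε hε x = x := by
  ext a
  exact x.2 a

theorem projective_projMod [Finite ι] {ε : ι → R} (hε : ∀ a, ε a * ε a = ε a) :
    Module.Projective R (projMod ε) :=
  Module.Projective.of_split (projMod ε).subtype (toProjMod ε hε)
    (LinearMap.ext (toProjMod_coe ε hε))

theorem finite_projMod [Finite ι] {ε : ι → R} (hε : ∀ a, ε a * ε a = ε a) :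
    Module.Finite R (projMod ε) :=
  Module.Finite.of_surjective (toProjMod ε hε) fun x => ⟨x, toProjMod_coe ε hε x⟩

theorem mem_jacobson_smul [Fintype ι] {ε : ι → R} (hε : ∀ a, ε a * ε a = ε a) (x : projMod ε)
    (hx : ∀ a, (x : ι → R) a ∈ Ring.jacobson R) :
    x ∈ Ring.jacobson R • (⊤ : Submodule R (projMod ε)) := by
  classical
  have : x = ∑ a, (x : ι → R) a • toProjMod ε hε (Pi.single a 1) := by
    ext b
    simp [toProjMod, Pi.single_apply, Finset.sum_apply, x.2 b]
  rw [this]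
  exact sum_mem fun a _ => Submodule.smul_mem_smul (hx a) Submodule.mem_top

variable [Fintype ι]

/-- This allows matrices to act on free modules throughout: projecting the argument to the summand
given by the idempotents does not change the value. -/
theorem linearCombination_mul {M : Type*} [AddCommGroup M] [Module R M] {ε : ι → R} {v : ι → M}
    (hv : ∀ a, ε a • v a = v a) (x : ι → R) :
    Fintype.linearCombination R v (fun a => x a * ε a) = Fintype.linearCombination R v x := by
  simp only [Fintype.linearCombination_apply, mul_smul, hv]

theorem linearCombination_mem {ε : κ → R} {v : ι → κ → R} (hv : ∀ a b, v a b * ε b = v a b)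
    (x : ι → R) : Fintype.linearCombination R v x ∈ projMod ε := by
  rw [Fintype.linearCombination_apply]
  exact sum_mem fun a _ => Submodule.smul_mem _ _ (hv a)

theorem linearCombination_pi_apply (v : ι → κ → R) (x : ι → R) (b : κ) :
    Fintype.linearCombination R v x b = ∑ a, x a * v a b := by
  rw [Fintype.linearCombination_apply, Finset.sum_apply]
  rfl

theorem linearCombination_apply_mem_jacobson {v : ι → κ → R}
    (hv : ∀ a b, v a b ∈ Ring.jacobson R) (x : ι → R) (b : κ) :
    Fintype.linearCombination R v x b ∈ Ring.jacobson R := by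
  rw [Fintype.linearCombination_apply, Finset.sum_apply]
  exact sum_mem fun a _ => Ideal.mul_mem_left _ _ (hv a b)

/-- The map between projective modules given by a matrix. -/
def projMap (ε : ι → R) (ε' : κ → R) (v : ι → κ → R) (hv : ∀ a b, v a b * ε' b = v a b) :
    projMod ε →ₗ[R] projMod ε' :=
  LinearMap.codRestrict _ ((Fintype.linearCombination R v).domRestrict _)
    fun x => linearCombination_mem hv x

end ProjMod

/-! ### Duality over an algebra with an anti-involution and a symmetrizing form -/

section Duality

variable {K R : Type*} [Field K] [Ring R] [Algebra K R] (σ : R →ₗ[K] R) (τ : R →ₗ[K] K)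

/-- The bilinear form on `Rⁿ` induced by a symmetrizing form and an anti-involution. -/
def dualPairing (ι : Type*) [Fintype ι] : (ι → R) →ₗ[K] Module.Dual K (ι → R) :=
  LinearMap.mk₂ K (fun y x => ∑ a, τ (x a * σ (y a)))
    (fun y y' x => by simp [mul_add, Finset.sum_add_distrib])
    (fun r y x => by simp [Finset.mul_sum])
    (fun y x x' => by simp [add_mul, Finset.sum_add_distrib])
    (fun r y x => by simp [Finset.mul_sum])

theorem dualPairing_apply {ι : Type*} [Fintype ι] (x y : ι → R) :
    dualPairing σ τ ι y x = ∑ a, τ (x a * σ (y a)) := rfl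

variable {σ τ}

theorem dualPairing_injective (hσσ : ∀ x, σ (σ x) = x) (hτ : ∀ x, (∀ y, τ (y * x) = 0) → x = 0)
    (ι : Type*) [Fintype ι] : Function.Injective (dualPairing σ τ ι) := by
  classical
  rw [← LinearMap.ker_eq_bot, LinearMap.ker_eq_bot']
  intro y hy
  ext a
  rw [Pi.zero_apply, ← hσσ (y a), hτ (σ (y a)), map_zero]
  intro z
  have := LinearMap.congr_fun hy (Pi.single a z)
  rw [dualPairing_apply, Finset.sum_eq_single a] at this
  · simpa using this
  · intro b _ hb
    simp [hb]
  · simp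

theorem dualPairing_surjective [Module.Finite K R] (hσσ : ∀ x, σ (σ x) = x)
    (hτ : ∀ x, (∀ y, τ (y * x) = 0) → x = 0)
    (ι : Type*) [Fintype ι] : Function.Surjective (dualPairing σ τ ι) :=
  (LinearMap.injective_iff_surjective_of_finrank_eq_finrank Subspace.dual_finrank_eq.symm).1
    (dualPairing_injective hσσ hτ ι)

/-- The adjoint of a matrix is its σ-transpose, so a hermitian matrix is self-adjoint. -/
theorem dualPairing_linearCombination (hσσ : ∀ x, σ (σ x) = x)
    (hσ : ∀ x y, σ (x * y) = σ y * σ x) {ι κ : Type*} [Fintype ι] [Fintype κ]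
    (v : ι → κ → R) (x : ι → R) (y : κ → R) :
    dualPairing σ τ κ y (Fintype.linearCombination R v x) =
      dualPairing σ τ ι (Fintype.linearCombination R (fun b a => σ (v a b)) y) x := by
  simp only [dualPairing_apply, linearCombination_pi_apply, map_sum, Finset.sum_mul,
    Finset.mul_sum, hσ, hσσ, mul_assoc]
  exact Finset.sum_comm

theorem dualPairing_smul (hσ : ∀ x y, σ (x * y) = σ y * σ x)
    (hcomm : ∀ x y, τ (x * y) = τ (y * x))
    {ι : Type*} [Fintype ι] (r : R) (x y : ι → R) :
    dualPairing σ τ ι (r • y) x = dualPairing σ τ ι y (σ r • x) := by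
  simp only [dualPairing_apply, Pi.smul_apply, smul_eq_mul, hσ]
  refine Finset.sum_congr rfl fun a _ => ?_
  rw [← mul_assoc, hcomm, mul_assoc]

theorem dualPairing_mul (hσ : ∀ x y, σ (x * y) = σ y * σ x)
    {ι : Type*} [Fintype ι] (ε : ι → R) (x y : ι → R) :
    dualPairing σ τ ι y (fun a => x a * σ (ε a)) =
      dualPairing σ τ ι (fun a => y a * ε a) x := by
  simp only [dualPairing_apply, hσ, mul_assoc]

/-- A functional vanishing on the kernel of `D` factors through `D`. -/
theorem exists_dual_factor {W W' : Type*} [AddCommGroup W] [Module K W] [AddCommGroup W']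
    [Module K W'] (D : W →ₗ[K] W') (f : Module.Dual K W) (hf : ∀ x, D x = 0 → f x = 0) :
    ∃ ψ : Module.Dual K W', ∀ x, f x = ψ (D x) := by
  have : f ∈ LinearMap.range D.dualMap := by
    rw [LinearMap.range_dualMap_eq_dualAnnihilator_ker, Submodule.mem_dualAnnihilator]
    exact hf
  obtain ⟨ψ, rfl⟩ := this
  exact ⟨ψ, fun x => rfl⟩

/-- Data giving a four-term periodic minimal projective resolution: an exact sequence
`P₂ → P₁ → P₀ → M → 0` which is self-dual on the left. -/
structure SelfDualPresentation (σ : R →ₗ[K] R) (τ : R →ₗ[K] K) {ι κ : Type*} [Fintype ι]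
    [Fintype κ] {M : Type*} [AddCommGroup M] [Module K M] [Module R M] (β : M →ₗ[K] M →ₗ[K] K)
    (ε₀ : ι → R) (ε₁ : κ → R) (v : ι → M) (d : κ → ι → R) (r : κ → κ → R) : Prop where
  invol : ∀ x, σ (σ x) = x
  anti : ∀ x y, σ (x * y) = σ y * σ x
  trace : ∀ x y, τ (x * y) = τ (y * x)
  nondeg : ∀ x, (∀ y, τ (y * x) = 0) → x = 0
  idem₀ : ∀ a, ε₀ a * ε₀ a = ε₀ a
  idem₁ : ∀ a, ε₁ a * ε₁ a = ε₁ a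
  self₀ : ∀ a, σ (ε₀ a) = ε₀ a
  source_v : ∀ a, ε₀ a • v a = v a
  source_d : ∀ b a, ε₁ b * d b a = d b a
  target_d : ∀ b a, d b a * ε₀ a = d b a
  target_r : ∀ a b, r a b * ε₁ b = r a b
  symm_r : ∀ a b, σ (r a b) = r b a
  rad_d : ∀ b a, d b a ∈ Ring.jacobson R
  rad_d' : ∀ b a, σ (d b a) ∈ Ring.jacobson R
  rad_r : ∀ a b, r a b ∈ Ring.jacobson R
  surj : ∀ z : M, ∃ x, Fintype.linearCombination R v x = z
  complex₀ : ∀ b, Fintype.linearCombination R v (d b) = 0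
  exact₀ : ∀ x ∈ projMod ε₀, Fintype.linearCombination R v x = 0 →
    ∃ y, Fintype.linearCombination R d y = x
  complex₁ : ∀ a, Fintype.linearCombination R d (r a) = 0
  exact₁ : ∀ x ∈ projMod ε₁, Fintype.linearCombination R d x = 0 →
    ∃ y, Fintype.linearCombination R r y = x
  form_smul : ∀ (s : R) x y, β (s • x) y = β x (σ s • y)
  form_nondeg : ∀ y, (∀ x, β x y = 0) → y = 0
  rad_ker : ∀ x ∈ projMod ε₀, Fintype.linearCombination R (fun a b => σ (d b a)) x = 0 →
    ∀ a, x a ∈ Ring.jacobson R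

end Duality

namespace SelfDualPresentation

variable {K R : Type*} [Field K] [Ring R] [Algebra K R] {σ : R →ₗ[K] R} {τ : R →ₗ[K] K}
  {ι κ : Type*} [Fintype ι] [Fintype κ] {M : Type*} [AddCommGroup M] [Module K M] [Module R M]
  {β : M →ₗ[K] M →ₗ[K] K}
  {ε₀ : ι → R} {ε₁ : κ → R} {v : ι → M} {d : κ → ι → R} {r : κ → κ → R}

local notation "lc" => Fintype.linearCombination R

theorem idem₂ (D : SelfDualPresentation σ τ β ε₀ ε₁ v d r)
    (a : κ) : σ (ε₁ a) * σ (ε₁ a) = σ (ε₁ a) := by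
  rw [← D.anti, D.idem₁]

theorem source_r (D : SelfDualPresentation σ τ β ε₀ ε₁ v d r)
    (a b : κ) : σ (ε₁ a) * r a b = r a b := by
  rw [← D.symm_r, ← D.anti, D.target_r]

theorem source_d' (D : SelfDualPresentation σ τ β ε₀ ε₁ v d r)
    (a : ι) (b : κ) : ε₀ a * σ (d b a) = σ (d b a) := by
  rw [← D.self₀, ← D.anti, D.target_d]

theorem target_d' (D : SelfDualPresentation σ τ β ε₀ ε₁ v d r)
    (a : ι) (b : κ) : σ (d b a) * σ (ε₁ b) = σ (d b a) := by
  rw [← D.anti, D.source_d]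

theorem mul_mem₁ (D : SelfDualPresentation σ τ β ε₀ ε₁ v d r)
    (x : κ → R) : (fun a => x a * ε₁ a) ∈ projMod ε₁ := fun a => by
  rw [mul_assoc, D.idem₁]

theorem mul_mem₀ (D : SelfDualPresentation σ τ β ε₀ ε₁ v d r)
    (x : ι → R) : (fun a => x a * ε₀ a) ∈ projMod ε₀ := fun a => by
  rw [mul_assoc, D.idem₀]

theorem d_mul (D : SelfDualPresentation σ τ β ε₀ ε₁ v d r)
    (x : κ → R) : lc d (fun a => x a * ε₁ a) = lc d x :=
  linearCombination_mul (fun a => funext fun b => D.source_d a b) x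

theorem v_mul (D : SelfDualPresentation σ τ β ε₀ ε₁ v d r)
    (x : ι → R) : lc v (fun a => x a * ε₀ a) = lc v x :=
  linearCombination_mul D.source_v x

theorem v_d (D : SelfDualPresentation σ τ β ε₀ ε₁ v d r) (x : κ → R) : lc v (lc d x) = 0 := by
  rw [Fintype.linearCombination_apply R d, map_sum]
  exact Finset.sum_eq_zero fun a _ => by rw [map_smul, D.complex₀, smul_zero]

theorem d_r (D : SelfDualPresentation σ τ β ε₀ ε₁ v d r) (x : κ → R) : lc d (lc r x) = 0 := by
  rw [Fintype.linearCombination_apply R r, map_sum]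
  exact Finset.sum_eq_zero fun a _ => by rw [map_smul, D.complex₁, smul_zero]

theorem dualPairing_d (D : SelfDualPresentation σ τ β ε₀ ε₁ v d r)
    (x : κ → R) (y : ι → R) : dualPairing σ τ ι y (lc d x) =
    dualPairing σ τ κ (lc (fun a b => σ (d b a)) y) x :=
  dualPairing_linearCombination D.invol D.anti d x y

theorem dualPairing_r (D : SelfDualPresentation σ τ β ε₀ ε₁ v d r)
    (x : κ → R) (y : κ → R) : dualPairing σ τ κ y (lc r x) =
    dualPairing σ τ κ (lc r y) x := by
  have h : (fun b a => σ (r a b)) = r := funext fun b => funext fun a => D.symm_r a b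
  rw [dualPairing_linearCombination D.invol D.anti, h]

/-- The adjoint of d ∘ r = 0, with r self-adjoint. -/
theorem r_d' (D : SelfDualPresentation σ τ β ε₀ ε₁ v d r)
    (x : ι → R) : lc r (lc (fun a b => σ (d b a)) x) = 0 := by
  apply dualPairing_injective D.invol D.nondeg
  ext y : 1
  rw [← D.dualPairing_r, ← D.dualPairing_d, D.d_r, map_zero, map_zero]
  rfl

/-- Exactness at the third term. -/
theorem exact₂ (D : SelfDualPresentation σ τ β ε₀ ε₁ v d r)
    [Module.Finite K R] {x : κ → R} (hx : x ∈ projMod (fun a => σ (ε₁ a)))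
    (h : lc r x = 0) : ∃ y ∈ projMod ε₀, lc (fun a b => σ (d b a)) y = x := by
  -- The kernel of d is the image of r, and r is self-adjoint, so r x = 0 makes x orthogonal to it.
  -- Pairing with x then factors through d, and a vector representing the factor is a preimage of x
  -- under the adjoint of d.
  have h1 : ∀ u, lc d u = 0 → dualPairing σ τ κ x u = 0 := by
    intro u hu
    have e : (fun a => x a * σ (ε₁ a)) = x := funext hx
    rw [← e, ← dualPairing_mul D.anti]
    simp only [D.invol]
    rw [← D.d_mul] at hu
    obtain ⟨w, hw⟩ := D.exact₁ _ (D.mul_mem₁ u) hu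
    rw [← hw, D.dualPairing_r, h, map_zero, LinearMap.zero_apply]
  obtain ⟨ψ, hψ⟩ := exists_dual_factor ((lc d).restrictScalars K) _ h1
  obtain ⟨y, rfl⟩ := dualPairing_surjective D.invol D.nondeg ι ψ
  refine ⟨_, D.mul_mem₀ y, ?_⟩
  rw [linearCombination_mul fun a => funext fun b => D.source_d' a b]
  apply dualPairing_injective D.invol D.nondeg
  ext u : 1
  rw [hψ, ← D.dualPairing_d]
  rfl

theorem form_surjective (D : SelfDualPresentation σ τ β ε₀ ε₁ v d r) [Module.Finite K M]
    (ψ : Module.Dual K M) : ∃ z, ∀ x, β x z = ψ x := by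
  have hinj : Function.Injective β.flip := by
    rw [← LinearMap.ker_eq_bot, LinearMap.ker_eq_bot']
    intro y hy
    exact D.form_nondeg y fun x => LinearMap.congr_fun hy x
  obtain ⟨z, rfl⟩ := (LinearMap.injective_iff_surjective_of_finrank_eq_finrank
    Subspace.dual_finrank_eq.symm).1 hinj ψ
  exact ⟨z, fun x => rfl⟩

/-- The transpose of the augmentation. -/
theorem exists_coaugmentation (D : SelfDualPresentation σ τ β ε₀ ε₁ v d r) [Module.Finite K R]
    [Module.Finite K M] [IsScalarTower K R M] : ∃ ν : M →ₗ[R] projMod ε₀, Function.Injective ν ∧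
      ∀ y : projMod ε₀, lc (fun a b => σ (d b a)) y = 0 ↔ y ∈ LinearMap.range ν := by
  let e : (ι → R) ≃ₗ[K] Module.Dual K (ι → R) := LinearEquiv.ofBijective (dualPairing σ τ ι)
    ⟨dualPairing_injective D.invol D.nondeg ι, dualPairing_surjective D.invol D.nondeg ι⟩
  -- The adjoint of the augmentation, with M identified with its dual through β. It is R-linear
  -- because σ enters both pairings and the two twists cancel.
  let ν₀ : M →ₗ[K] (ι → R) := e.symm.toLinearMap ∘ₗ ((lc v).restrictScalars K).dualMap ∘ₗ β.flip
  have hν : ∀ z x, dualPairing σ τ ι (ν₀ z) x = β (lc v x) z := fun z x =>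
    LinearMap.congr_fun (e.apply_symm_apply _) x
  have huniq : ∀ z y, (∀ x, dualPairing σ τ ι y x = β (lc v x) z) → y = ν₀ z := fun z y h =>
    dualPairing_injective D.invol D.nondeg ι (LinearMap.ext fun x => (h x).trans (hν z x).symm)
  have hmem : ∀ z, ν₀ z ∈ projMod ε₀ := by
    intro z
    have := huniq z (fun a => ν₀ z a * ε₀ a) fun x => by
      rw [← dualPairing_mul D.anti, hν]
      simp only [D.self₀, D.v_mul]
    exact fun a => congrFun this a
  let ν : M →ₗ[R] projMod ε₀ :=
    { toFun := fun z => ⟨ν₀ z, hmem z⟩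
      map_add' := fun x y => Subtype.ext (map_add ν₀ x y)
      map_smul' := fun s z => Subtype.ext <| by
        refine (huniq (s • z) (s • ν₀ z) fun x => ?_).symm
        rw [dualPairing_smul D.anti D.trace, hν, map_smul, D.form_smul, D.invol] }
  refine ⟨ν, ?_, fun y => ⟨fun hy => ?_, ?_⟩⟩
  · intro z z' h
    have h' : ν₀ z = ν₀ z' := congrArg Subtype.val h
    rw [← sub_eq_zero]
    apply D.form_nondeg
    intro x
    obtain ⟨u, rfl⟩ := D.surj x
    rw [map_sub, ← hν, ← hν, h', sub_self]
  -- By exactness at P₀ the kernel of the augmentation is the image of d, to which y is orthogonal.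
  -- So pairing with y factors through M, where β represents the resulting functional.
  · have h1 : ∀ u, lc v u = 0 → dualPairing σ τ ι y u = 0 := by
      intro u hu
      rw [← D.v_mul] at hu
      obtain ⟨w, hw⟩ := D.exact₀ _ (D.mul_mem₀ u) hu
      have e : (fun a => (y : ι → R) a * ε₀ a) = y := funext y.2
      rw [← e, ← dualPairing_mul D.anti]
      simp only [D.self₀]
      rw [← hw, D.dualPairing_d, hy, map_zero, LinearMap.zero_apply]
    obtain ⟨ψ, hψ⟩ := exists_dual_factor ((lc v).restrictScalars K) _ h1
    obtain ⟨z, hz⟩ := D.form_surjective ψ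
    exact ⟨z, Subtype.ext (huniq z y fun x => (hψ x).trans (hz _).symm).symm⟩
  · rintro ⟨z, rfl⟩
    apply dualPairing_injective D.invol D.nondeg
    ext w : 1
    rw [← D.dualPairing_d]
    change dualPairing σ τ ι (ν₀ z) _ = _
    rw [hν, D.v_d, map_zero, map_zero]
    rfl

variable (v ε₀) in
/-- The augmentation. -/
def aug : projMod ε₀ →ₗ[R] M := (lc v).domRestrict _

/-- The first differential. -/
def dMap (D : SelfDualPresentation σ τ β ε₀ ε₁ v d r) : projMod ε₁ →ₗ[R] projMod ε₀ :=
  projMap ε₁ ε₀ d D.target_d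

/-- The second differential. -/
def rMap (D : SelfDualPresentation σ τ β ε₀ ε₁ v d r) :
    projMod (fun a => σ (ε₁ a)) →ₗ[R] projMod ε₁ :=
  projMap _ ε₁ r D.target_r

/-- The third differential. -/
def sMap (D : SelfDualPresentation σ τ β ε₀ ε₁ v d r) :
    projMod ε₀ →ₗ[R] projMod (fun a => σ (ε₁ a)) :=
  projMap ε₀ _ (fun a b => σ (d b a)) D.target_d'

theorem range_dMap (D : SelfDualPresentation σ τ β ε₀ ε₁ v d r) :
    LinearMap.range D.dMap = LinearMap.ker (aug ε₀ v) := by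
  ext x
  constructor
  · rintro ⟨y, rfl⟩
    exact D.v_d y
  · intro hx
    obtain ⟨y, hy⟩ := D.exact₀ x x.2 hx
    refine ⟨⟨_, D.mul_mem₁ y⟩, Subtype.ext ?_⟩
    rw [← hy]
    exact D.d_mul y

theorem range_rMap (D : SelfDualPresentation σ τ β ε₀ ε₁ v d r) :
    LinearMap.range D.rMap = LinearMap.ker D.dMap := by
  ext x
  rw [LinearMap.mem_ker, Subtype.ext_iff]
  constructor
  · rintro ⟨y, rfl⟩
    exact D.d_r y
  · intro hx
    obtain ⟨y, hy⟩ := D.exact₁ x x.2 hx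
    refine ⟨⟨fun a => y a * σ (ε₁ a), fun a => by rw [mul_assoc, D.idem₂]⟩, Subtype.ext ?_⟩
    rw [← hy]
    exact linearCombination_mul (fun a => funext fun b => D.source_r a b) y

theorem range_sMap (D : SelfDualPresentation σ τ β ε₀ ε₁ v d r) [Module.Finite K R] :
    LinearMap.range D.sMap = LinearMap.ker D.rMap := by
  ext x
  rw [LinearMap.mem_ker, Subtype.ext_iff]
  constructor
  · rintro ⟨y, rfl⟩
    exact D.r_d' y
  · intro hx
    obtain ⟨y, hy, h⟩ := D.exact₂ x.2 hx
    exact ⟨⟨y, hy⟩, Subtype.ext h⟩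

theorem nonempty_equiv_ker_sMap (D : SelfDualPresentation σ τ β ε₀ ε₁ v d r) [Module.Finite K R]
    [Module.Finite K M] [IsScalarTower K R M] : Nonempty (M ≃ₗ[R] LinearMap.ker D.sMap) := by
  obtain ⟨ν, hν, h⟩ := D.exists_coaugmentation
  refine ⟨(LinearEquiv.ofInjective ν hν).trans (LinearEquiv.ofEq _ _ ?_)⟩
  ext y
  rw [← h, LinearMap.mem_ker, Subtype.ext_iff]
  rfl

theorem cover_aug (D : SelfDualPresentation σ τ β ε₀ ε₁ v d r) :
    IsProjectiveCover (aug ε₀ v) := by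
  have := projective_projMod D.idem₀
  have := finite_projMod D.idem₀
  apply isProjectiveCover_of_ker_le
  · intro z
    obtain ⟨x, rfl⟩ := D.surj z
    exact ⟨⟨_, D.mul_mem₀ x⟩, D.v_mul x⟩
  · rw [← D.range_dMap]
    rintro _ ⟨y, rfl⟩
    exact mem_jacobson_smul D.idem₀ _ (linearCombination_apply_mem_jacobson D.rad_d y)

theorem cover_dMap (D : SelfDualPresentation σ τ β ε₀ ε₁ v d r) :
    IsProjectiveCover (P := projMod ε₁) (M := LinearMap.range D.dMap)
      D.dMap.rangeRestrict := by
  have := projective_projMod D.idem₁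
  have := finite_projMod D.idem₁
  apply isProjectiveCover_of_ker_le D.dMap.surjective_rangeRestrict
  rw [LinearMap.ker_rangeRestrict, ← D.range_rMap]
  rintro _ ⟨y, rfl⟩
  exact mem_jacobson_smul D.idem₁ _ (linearCombination_apply_mem_jacobson D.rad_r y)

theorem cover_rMap (D : SelfDualPresentation σ τ β ε₀ ε₁ v d r) [Module.Finite K R] :
    IsProjectiveCover (P := projMod fun a => σ (ε₁ a)) (M := LinearMap.range D.rMap)
      D.rMap.rangeRestrict := by
  have := projective_projMod D.idem₂
  have := finite_projMod D.idem₂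
  apply isProjectiveCover_of_ker_le D.rMap.surjective_rangeRestrict
  rw [LinearMap.ker_rangeRestrict, ← D.range_sMap]
  rintro _ ⟨y, rfl⟩
  exact mem_jacobson_smul D.idem₂ _
    (linearCombination_apply_mem_jacobson (fun a b => D.rad_d' b a) y)

theorem cover_sMap (D : SelfDualPresentation σ τ β ε₀ ε₁ v d r) :
    IsProjectiveCover (P := projMod ε₀) (M := LinearMap.range D.sMap)
      D.sMap.rangeRestrict := by
  have := projective_projMod D.idem₀
  have := finite_projMod D.idem₀
  apply isProjectiveCover_of_ker_le D.sMap.surjective_rangeRestrict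
  rw [LinearMap.ker_rangeRestrict]
  intro x hx
  exact mem_jacobson_smul D.idem₀ _ (D.rad_ker x x.2 (congrArg Subtype.val hx))

end SelfDualPresentation

/-! ### The spliced periodic resolution -/

section Main

universe v₁ v₂

variable {K : Type*} {R : Type (max v₁ v₂ w)} [Field K] [Ring R] [Algebra K R] {σ : R →ₗ[K] R}
  {τ : R →ₗ[K] K} {ι : Type v₁} {κ : Type v₂} [Fintype ι] [Fintype κ] {M : Type (max v₁ v₂ w)}
  [AddCommGroup M] [Module K M] [Module R M] {β : M →ₗ[K] M →ₗ[K] K}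
  {ε₀ : ι → R} {ε₁ : κ → R} {v : ι → M} {d : κ → ι → R} {r : κ → κ → R}

theorem SelfDualPresentation.isSyzygy_four (D : SelfDualPresentation σ τ β ε₀ ε₁ v d r)
    [Module.Finite K R] [Module.Finite K M] [IsScalarTower K R M] : IsSyzygy R 4 M M := by
  refine IsSyzygy.succ D.cover_aug (IsSyzygy.of_range_eq D.range_dMap ?_)
  refine IsSyzygy.succ_range D.cover_dMap (IsSyzygy.of_range_eq D.range_rMap ?_)
  refine IsSyzygy.succ_range D.cover_rMap (IsSyzygy.of_range_eq D.range_sMap ?_)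
  exact IsSyzygy.succ_range D.cover_sMap D.nonempty_equiv_ker_sMap

/-- If `Ω²(M) ≅ M` then the modules `P₂` and `P₀` of the resolution are isomorphic. -/
theorem SelfDualPresentation.nonempty_equiv_of_isSyzygy_two
    (D : SelfDualPresentation σ τ β ε₀ ε₁ v d r) [Module.Finite K R] (h : IsSyzygy R 2 M M) :
    Nonempty (projMod ε₀ ≃ₗ[R] projMod (fun a => σ (ε₁ a))) := by
  have h2 : IsSyzygy R 2 M (LinearMap.ker D.dMap) := by
    refine IsSyzygy.succ D.cover_aug (IsSyzygy.of_range_eq D.range_dMap ?_)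
    exact IsSyzygy.succ_range D.cover_dMap ⟨LinearEquiv.refl _ _⟩
  obtain ⟨f⟩ := h.unique h2
  -- The second syzygy is the image of r, covered by P₂. Under the assumed isomorphism it is also
  -- covered by P₀.
  let f' : M ≃ₗ[R] LinearMap.range D.rMap := f.trans (LinearEquiv.ofEq _ _ D.range_rMap.symm)
  obtain ⟨e, -⟩ := (D.cover_aug.comp_equiv f').exists_equiv D.cover_rMap
  exact ⟨e⟩

end Main

/-! ### The enveloping algebra -/

section Enveloping

open MulOpposite

variable {K A : Type*} [Field K] [Ring A] [Algebra K A]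

variable (K A) in
/-- The anti-involution `a ⊗ b ↦ b ⊗ a` of the enveloping algebra. -/
def envFlip : A ⊗[K] Aᵐᵒᵖ →ₗ[K] A ⊗[K] Aᵐᵒᵖ :=
  TensorProduct.map (opLinearEquiv K).symm.toLinearMap (opLinearEquiv K).toLinearMap ∘ₗ
    (TensorProduct.comm K A Aᵐᵒᵖ).toLinearMap

@[simp] theorem envFlip_tmul (a b : A) : envFlip K A (a ⊗ₜ op b) = b ⊗ₜ op a := rfl

/-- Induction on elements of the enveloping algebra. -/
theorem env_induction {p : A ⊗[K] Aᵐᵒᵖ → Prop} (h : ∀ a b : A, p (a ⊗ₜ op b))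
    (hadd : ∀ x y, p x → p y → p (x + y)) (x) : p x := by
  induction x with
  | zero => exact (TensorProduct.zero_tmul A (op (0 : A)) : (0 : A) ⊗ₜ[K] _ = 0) ▸ h 0 0
  | tmul a b => exact h a b.unop
  | add x y hx hy => exact hadd _ _ hx hy

theorem env_mul (a b a' b' : A) :
    (a ⊗ₜ[K] op b) * (a' ⊗ₜ op b') = (a * a') ⊗ₜ op (b' * b) := by
  rw [Algebra.TensorProduct.tmul_mul_tmul, ← op_mul]

theorem envFlip_envFlip (x : A ⊗[K] Aᵐᵒᵖ) : envFlip K A (envFlip K A x) = x := by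
  induction x using env_induction with
  | h a b => simp
  | hadd x y hx hy => rw [map_add, map_add, hx, hy]

theorem envFlip_mul (x y : A ⊗[K] Aᵐᵒᵖ) :
    envFlip K A (x * y) = envFlip K A y * envFlip K A x := by
  induction x using env_induction with
  | h a b =>
    induction y using env_induction with
    | h a' b' => rw [env_mul, envFlip_tmul, envFlip_tmul, envFlip_tmul, env_mul]
    | hadd x y hx hy => rw [mul_add, map_add, map_add, hx, hy, add_mul]
  | hadd x y hx hy => rw [add_mul, map_add, map_add, hx, hy, mul_add]

/-- The form on the enveloping algebra induced by a form on the algebra. -/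
def envForm (φ : A →ₗ[K] K) : A ⊗[K] Aᵐᵒᵖ →ₗ[K] K :=
  LinearMap.mul' K K ∘ₗ TensorProduct.map φ (φ ∘ₗ (opLinearEquiv K).symm.toLinearMap)

theorem envForm_tmul (φ : A →ₗ[K] K) (a b : A) : envForm φ (a ⊗ₜ op b) = φ a * φ b := rfl

theorem envForm_mul_comm {φ : A →ₗ[K] K} (hφ : ∀ x y, φ (x * y) = φ (y * x))
    (x y : A ⊗[K] Aᵐᵒᵖ) : envForm φ (x * y) = envForm φ (y * x) := by
  induction x using env_induction with
  | h a b =>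
    induction y using env_induction with
    | h a' b' => rw [env_mul, env_mul, envForm_tmul, envForm_tmul, hφ a a', hφ b' b]
    | hadd x y hx hy => rw [mul_add, map_add, hx, hy, add_mul, map_add]
  | hadd x y hx hy => rw [add_mul, map_add, hx, hy, mul_add, map_add]

/-- The form on the enveloping algebra is the tensor product of two injections into dual spaces.
Over a field this stays injective, and in finite dimension the tensor product of the duals is the
dual of the tensor product. -/
theorem envForm_nondeg [Module.Finite K A] {φ : A →ₗ[K] K} (hφ : ∀ x y, φ (x * y) = φ (y * x))
    (hn : ∀ x, (∀ y, φ (y * x) = 0) → x = 0) (x : A ⊗[K] Aᵐᵒᵖ)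
    (hx : ∀ y, envForm φ (y * x) = 0) : x = 0 := by
  let Φ : A →ₗ[K] Module.Dual K A := ((LinearMap.mul K A).compr₂ φ).flip
  have hΦ : Function.Injective Φ := by
    rw [← LinearMap.ker_eq_bot, LinearMap.ker_eq_bot']
    intro y hy
    exact hn y fun x => LinearMap.congr_fun hy x
  let Ψ : Aᵐᵒᵖ →ₗ[K] Module.Dual K Aᵐᵒᵖ :=
    (opLinearEquiv K).symm.toLinearMap.dualMap ∘ₗ Φ ∘ₗ (opLinearEquiv K).symm.toLinearMap
  have hΨ : Function.Injective Ψ :=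
    (LinearMap.dualMap_injective_of_surjective (opLinearEquiv K).symm.surjective).comp
      (hΦ.comp (opLinearEquiv K).symm.injective)
  have hinj : Function.Injective (TensorProduct.map Φ Ψ) :=
    TensorProduct.map_injective_of_flat_flat _ _ hΦ hΨ
  have key : ∀ x y, TensorProduct.dualDistrib K A Aᵐᵒᵖ (TensorProduct.map Φ Ψ x) y =
      envForm φ (y * x) := by
    intro x y
    induction x using env_induction with
    | h a b =>
      induction y using env_induction with
      | h a' b' =>
        rw [env_mul, envForm_tmul, hφ b b']
        rfl
      | hadd x y hx hy => rw [map_add, hx, hy, add_mul, map_add]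
    | hadd x y hx hy => rw [map_add, map_add, LinearMap.add_apply, hx, hy, mul_add, map_add]
  apply hinj
  rw [map_zero]
  apply (TensorProduct.dualDistribEquiv K A Aᵐᵒᵖ).injective
  rw [map_zero]
  exact LinearMap.ext fun y => (key x y).trans (hx y)

/-! #### Filtrations and the Jacobson radical -/

theorem mem_jacobson_of_isNilpotent {R : Type*} [Ring R] {x : R}
    (h : ∀ y, IsNilpotent (y * x)) : x ∈ Ring.jacobson R := by
  rw [← Ideal.jacobson_bot, Ideal.mem_jacobson_iff]
  intro y
  obtain ⟨u, hu⟩ := (h y).isUnit_one_add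
  refine ⟨(u⁻¹ : Rˣ), ?_⟩
  have : ((u⁻¹ : Rˣ) : R) * (1 + y * x) = 1 := by rw [← hu, Units.inv_mul]
  rw [Submodule.mem_bot, mul_assoc, ← this]
  noncomm_ring

/-- The filtration of the left factor alone induces a multiplicative filtration of the enveloping
algebra that reaches zero. Every left multiple of a ⊗ b has positive degree, hence is nilpotent. -/
theorem tmul_mem_jacobson_left {F : ℕ → Submodule K A} (h0 : F 0 = ⊤)
    (hmul : ∀ {n l x y}, x ∈ F n → y ∈ F l → x * y ∈ F (n + l)) {N : ℕ} (hN : F N = ⊥)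
    {a : A} (ha : a ∈ F 1) (b : A) : a ⊗ₜ[K] op b ∈ Ring.jacobson (A ⊗[K] Aᵐᵒᵖ) := by
  let X : ℕ → Submodule K (A ⊗[K] Aᵐᵒᵖ) := fun n =>
    Submodule.span K {x | ∃ a b, a ∈ F n ∧ x = a ⊗ₜ op b}
  have hX : ∀ {n l x y}, x ∈ X n → y ∈ X l → x * y ∈ X (n + l) := by
    intro n l x y hx hy
    induction hx using Submodule.span_induction with
    | zero => simp
    | add x x' _ _ hx hx' => rw [add_mul]; exact add_mem hx hx'
    | smul r x _ hx => rw [smul_mul_assoc]; exact Submodule.smul_mem _ _ hx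
    | mem x hx =>
      induction hy using Submodule.span_induction with
      | zero => simp
      | add x x' _ _ hx hx' => rw [mul_add]; exact add_mem hx hx'
      | smul r x _ hx => rw [mul_smul_comm]; exact Submodule.smul_mem _ _ hx
      | mem y hy =>
        obtain ⟨a, b, ha, rfl⟩ := hx
        obtain ⟨a', b', ha', rfl⟩ := hy
        exact Submodule.subset_span ⟨_, _, hmul ha ha', env_mul _ _ _ _⟩
  have hX0 : ∀ x, x ∈ X 0 := by
    intro x
    induction x using env_induction with
    | h a b => exact Submodule.subset_span ⟨a, b, h0 ▸ Submodule.mem_top, rfl⟩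
    | hadd x y hx hy => exact add_mem hx hy
  apply mem_jacobson_of_isNilpotent
  intro y
  have h1 : y * a ⊗ₜ op b ∈ X 1 := by
    have := hX (hX0 y) (Submodule.subset_span ⟨a, b, ha, rfl⟩ : a ⊗ₜ op b ∈ X 1)
    rwa [zero_add] at this
  have hpow : ∀ n, (y * a ⊗ₜ op b) ^ n ∈ X n := by
    intro n
    induction n with
    | zero => exact hX0 _
    | succ n ih => rw [pow_succ]; exact hX ih h1
  refine ⟨N, ?_⟩
  have hb : X N = ⊥ := by
    rw [Submodule.span_eq_bot]
    rintro x ⟨a, b, ha, rfl⟩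
    rw [hN, Submodule.mem_bot] at ha
    rw [ha, TensorProduct.zero_tmul]
  have := hpow N
  rwa [hb, Submodule.mem_bot] at this

theorem tmul_mem_jacobson_right {F : ℕ → Submodule K A} (h0 : F 0 = ⊤)
    (hmul : ∀ {n l x y}, x ∈ F n → y ∈ F l → x * y ∈ F (n + l)) {N : ℕ} (hN : F N = ⊥)
    (a : A) {b : A} (hb : b ∈ F 1) : a ⊗ₜ[K] op b ∈ Ring.jacobson (A ⊗[K] Aᵐᵒᵖ) := by
  let X : ℕ → Submodule K (A ⊗[K] Aᵐᵒᵖ) := fun n =>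
    Submodule.span K {x | ∃ a b, b ∈ F n ∧ x = a ⊗ₜ op b}
  have hX : ∀ {n l x y}, x ∈ X n → y ∈ X l → x * y ∈ X (l + n) := by
    intro n l x y hx hy
    induction hx using Submodule.span_induction with
    | zero => simp
    | add x x' _ _ hx hx' => rw [add_mul]; exact add_mem hx hx'
    | smul r x _ hx => rw [smul_mul_assoc]; exact Submodule.smul_mem _ _ hx
    | mem x hx =>
      induction hy using Submodule.span_induction with
      | zero => simp
      | add x x' _ _ hx hx' => rw [mul_add]; exact add_mem hx hx'
      | smul r x _ hx => rw [mul_smul_comm]; exact Submodule.smul_mem _ _ hx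
      | mem y hy =>
        obtain ⟨a, b, ha, rfl⟩ := hx
        obtain ⟨a', b', ha', rfl⟩ := hy
        exact Submodule.subset_span ⟨_, _, hmul ha' ha, env_mul _ _ _ _⟩
  have hX0 : ∀ x, x ∈ X 0 := by
    intro x
    induction x using env_induction with
    | h a b => exact Submodule.subset_span ⟨a, b, h0 ▸ Submodule.mem_top, rfl⟩
    | hadd x y hx hy => exact add_mem hx hy
  apply mem_jacobson_of_isNilpotent
  intro y
  have h1 : y * a ⊗ₜ op b ∈ X 1 := by
    have := hX (hX0 y) (Submodule.subset_span ⟨a, b, hb, rfl⟩ : a ⊗ₜ op b ∈ X 1)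
    rwa [add_zero] at this
  have hpow : ∀ n, (y * a ⊗ₜ op b) ^ n ∈ X n := by
    intro n
    induction n with
    | zero => exact hX0 _
    | succ n ih =>
      have := hX h1 ih
      rwa [← pow_succ'] at this
  refine ⟨N, ?_⟩
  have hb : X N = ⊥ := by
    rw [Submodule.span_eq_bot]
    rintro x ⟨a, b, hb, rfl⟩
    rw [hN, Submodule.mem_bot] at hb
    rw [hb, op_zero, TensorProduct.tmul_zero]
  have := hpow N
  rwa [hb, Submodule.mem_bot] at this

section Action

variable (K A) in
/-- An algebra as a module over its enveloping algebra. -/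
abbrev envModule : Module (A ⊗[K] Aᵐᵒᵖ) A := TensorProduct.Algebra.module

attribute [local instance] envModule

theorem env_smul (a b x : A) : (a ⊗ₜ[K] op b) • x = a * x * b := by
  rw [TensorProduct.Algebra.smul_def, op_smul_eq_mul, smul_eq_mul, mul_assoc]

theorem env_isScalarTower : IsScalarTower K (A ⊗[K] Aᵐᵒᵖ) A := by
  constructor
  intro k x y
  induction x using env_induction with
  | h a b => rw [TensorProduct.smul_tmul', env_smul, env_smul, smul_mul_assoc, smul_mul_assoc]
  | hadd x x' hx hx' => rw [smul_add, add_smul, hx, hx', add_smul, smul_add]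

/-- Moving right multiplication cyclically past the trace form turns it into left multiplication on
the other argument. This is the compatibility with σ needed to identify Λ with its dual as a
bimodule. -/
theorem form_env_smul {φ : A →ₗ[K] K} (hφ : ∀ x y, φ (x * y) = φ (y * x))
    (s : A ⊗[K] Aᵐᵒᵖ) (x y : A) : φ ((s • x) * y) = φ (x * (envFlip K A s • y)) := by
  induction s using env_induction with
  | h a b =>
    rw [envFlip_tmul, env_smul, env_smul, hφ x, mul_assoc, mul_assoc, hφ a, hφ (b * y * a)]
    simp only [mul_assoc]
  | hadd s s' hs hs' =>
    rw [add_smul, add_mul, map_add, hs, hs', map_add, add_smul, mul_add, map_add]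

end Action

end Enveloping

/-! ### One-sided multiplications, and derivations as block-triangular operators -/

section Enveloping

open MulOpposite

variable {K A : Type*} [Field K] [Ring A] [Algebra K A]

variable (K) in
/-- Left multiplication as an element of the enveloping algebra. -/
def envL (a : A) : A ⊗[K] Aᵐᵒᵖ := a ⊗ₜ op 1

variable (K) in
/-- Right multiplication as an element of the enveloping algebra. -/
def envR (a : A) : A ⊗[K] Aᵐᵒᵖ := 1 ⊗ₜ op a

theorem envL_mul (a b : A) : envL K (a * b) = envL K a * envL K b := by
  rw [envL, envL, envL, env_mul, one_mul]

theorem envR_mul (a b : A) : envR K (a * b) = envR K b * envR K a := by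
  rw [envR, envR, envR, env_mul, one_mul]

theorem envL_mul_envR (a b : A) : envL K a * envR K b = a ⊗ₜ op b := by
  rw [envL, envR, env_mul, mul_one, mul_one]

theorem envR_mul_envL (a b : A) : envR K b * envL K a = a ⊗ₜ op b := by
  rw [envL, envR, env_mul, one_mul, one_mul]

@[simp] theorem envL_one : envL K (1 : A) = 1 := rfl

@[simp] theorem envR_one : envR K (1 : A) = 1 := rfl

theorem envL_add (a b : A) : envL K (a + b) = envL K a + envL K b := TensorProduct.add_tmul _ _ _

theorem envR_add (a b : A) : envR K (a + b) = envR K a + envR K b := TensorProduct.tmul_add _ _ _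

theorem envL_smul (k : K) (a : A) : envL K (k • a) = k • envL K a :=
  (TensorProduct.smul_tmul' _ _ _).symm

theorem envR_smul (k : K) (a : A) : envR K (k • a) = k • envR K a :=
  TensorProduct.tmul_smul k (1 : A) (op a)

theorem envL_sum {ι : Type*} (s : Finset ι) (f : ι → A) :
    envL K (∑ i ∈ s, f i) = ∑ i ∈ s, envL K (f i) := TensorProduct.sum_tmul _ _ _

theorem envR_sum {ι : Type*} (s : Finset ι) (f : ι → A) :
    envR K (∑ i ∈ s, f i) = ∑ i ∈ s, envR K (f i) := by
  rw [envR, Finset.op_sum, TensorProduct.tmul_sum]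
  rfl

variable {M : Type*} [AddCommGroup M] [Module (A ⊗[K] Aᵐᵒᵖ) M]

theorem envL_zero_smul (x : M) : envL K (0 : A) • x = 0 :=
  map_zero (AddMonoidHom.mk' (fun a : A => envL K a • x) fun a b => by rw [envL_add, add_smul])

theorem envR_zero_smul (x : M) : envR K (0 : A) • x = 0 :=
  map_zero (AddMonoidHom.mk' (fun a : A => envR K a • x) fun a b => by rw [envR_add, add_smul])

theorem tmul_smul_eq (a b : A) (x : M) : (a ⊗ₜ[K] op b) • x = envL K a • envR K b • x := by
  rw [← mul_smul, envL_mul_envR]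

theorem envL_envR_comm (a b : A) (x : M) : envL K a • envR K b • x = envR K b • envL K a • x := by
  rw [← mul_smul, ← mul_smul, envL_mul_envR, envR_mul_envL]

variable [Module K M] [IsScalarTower K (A ⊗[K] Aᵐᵒᵖ) M]

/-- The map `y ↦ z y`. -/
def rightOrbit (z : M) : A →ₗ[K] M where
  toFun y := envR K y • z
  map_add' x y := by rw [envR_add, add_smul]
  map_smul' k x := by rw [envR_smul, smul_assoc, RingHom.id_apply]

variable (K) in
/-- The operator on `M × A` encoding an element with a value of a derivation. -/
def derOp (x : A) (z : M) : Module.End K (M × A) :=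
  LinearMap.prod
    (LinearMap.coprod (Algebra.lsmul K K M (envL K x)) (rightOrbit z))
    (LinearMap.mulLeft K x ∘ₗ LinearMap.snd K M A)

theorem derOp_apply (x : A) (z : M) (y : M × A) :
    derOp K x z y = (envL K x • y.1 + envR K y.2 • z, x * y.2) := rfl

/-- The off-diagonal entry multiplies by the Leibniz rule. Hence an algebra map sending x to an
operator with diagonal x is the same as a derivation, and derivations can be built from the
universal property of Λ. -/
theorem derOp_mul (x x' : A) (z z' : M) :
    derOp K x z * derOp K x' z' = derOp K (x * x') (envL K x • z' + envR K x' • z) := by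
  refine LinearMap.ext fun y => ?_
  simp only [Module.End.mul_apply, derOp_apply, smul_add, mul_assoc, envL_mul, envR_mul, mul_smul,
    envL_envR_comm, add_assoc]

theorem derOp_smul (k : K) (x : A) (z : M) : k • derOp K x z = derOp K (k • x) (k • z) := by
  refine LinearMap.ext fun y => ?_
  simp only [LinearMap.smul_apply, derOp_apply, Prod.smul_mk, smul_add, envL_smul, smul_assoc,
    smul_mul_assoc, smul_comm k]

theorem derOp_add (x x' : A) (z z' : M) :
    derOp K x z + derOp K x' z' = derOp K (x + x') (z + z') := by
  refine LinearMap.ext fun y => ?_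
  simp only [LinearMap.add_apply, derOp_apply, Prod.mk_add_mk, smul_add, envL_add, add_smul,
    add_mul]
  congr 1
  abel

theorem derOp_zero : derOp K (0 : A) (0 : M) = 0 := by
  refine LinearMap.ext fun y => ?_
  rw [derOp_apply, envL_zero_smul, smul_zero, zero_mul, add_zero]
  rfl

theorem derOp_one : derOp K (1 : A) (0 : M) = 1 := by
  refine LinearMap.ext fun y => ?_
  simp [derOp_apply]

theorem derOp_inj {x x' : A} {z z' : M} (h : derOp K x z = derOp K x' z') : z = z' := by
  have := congrArg Prod.fst (LinearMap.congr_fun h (0, 1))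
  simpa [derOp_apply] using this

end Enveloping

namespace TriangulationQuiver

open MulOpposite

/-! ### Derivations from values on arrows: the zero relations are redundant -/

section Derivation

variable {K : Type*} [Field K] {V E : Type*} [Fintype V] {T : TriangulationQuiver V E}
  {m : T.Orbit → ℕ+} {c : T.Orbit → Kˣ}

local notation "Λ" => WeightedAlgebra T m c
local notation "e" => idm T m c
local notation "p" => pth T m c
local notation "ℓ" => envL K (A := WeightedAlgebra T m c)
local notation "ρ" => envR K (A := WeightedAlgebra T m c)

variable {M : Type*} [AddCommGroup M]
  [Module (WeightedAlgebra T m c ⊗[K] (WeightedAlgebra T m c)ᵐᵒᵖ) M]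

variable (m c) in
/-- The value on a path along a `g`-orbit of the derivation with values `δ` on arrows. -/
def pathDer (δ : E → M) (α : E) (n : ℕ) : M :=
  ∑ k ∈ Finset.range n, (p α k ⊗ₜ[K] op (p (T.g^[k + 1] α) (n - 1 - k))) • δ (T.g^[k] α)

theorem pathDer_succ (δ : E → M) (α : E) (n : ℕ) : pathDer m c δ α (n + 1) =
    ρ (p (T.g^[n] α) 1) • pathDer m c δ α n + ℓ (p α n) • δ (T.g^[n] α) := by
  rw [pathDer, Finset.sum_range_succ, pathDer, Finset.smul_sum]
  congr 1
  · refine Finset.sum_congr rfl fun k hk => ?_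
    rw [Finset.mem_range] at hk
    have h1 : n + 1 - 1 - k = (n - 1 - k) + 1 := by omega
    have h2 : p (T.g^[k + 1] α) (n - 1 - k + 1) =
        p (T.g^[k + 1] α) (n - 1 - k) * p (T.g^[n] α) 1 := by
      rw [pth_succ', ← Function.iterate_add_apply]
      congr 3
      omega
    rw [h1, h2, ← mul_smul, envR, env_mul, one_mul]
  · rw [Nat.add_sub_cancel, Nat.sub_self, pth_zero]
    rfl

variable [Module K M]

variable (m c) in
/-- The value on a commutativity relation of the derivation with values `δ` on arrows. -/
def relDer (δ : E → M) (α : E) : M :=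
  ρ (p (T.f α) 1) • δ α + ℓ (p α 1) • δ (T.f α) -
    (c (T.orbit (T.bar α)) : K) • pathDer m c δ (T.bar α) (T.wt m (T.bar α) - 1)

variable [IsScalarTower K (WeightedAlgebra T m c ⊗[K] (WeightedAlgebra T m c)ᵐᵒᵖ) M]

theorem derOp_sum_idm : ∑ i, derOp K (e i) (0 : M) = 1 := by
  rw [← derOp_one, ← sum_idm]
  refine LinearMap.ext fun y => ?_
  simp only [LinearMap.sum_apply, derOp_apply, smul_zero, add_zero, envL_sum, Finset.sum_smul,
    Finset.sum_mul]
  ext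
  · simp [Prod.fst_sum]
  · simp [Prod.snd_sum]

/-- The representation of the path algebra on `M × Λ` given by a derivation. -/
def derRep (δ : E → M) (hs : ∀ α, ℓ (e (T.source α)) • δ α = δ α)
    (ht : ∀ α, ρ (e (T.target α)) • δ α = δ α) :
    PathAlgebra K T →ₐ[K] Module.End K (M × Λ) :=
  liftPath (K := K) (fun i => derOp K (e i) (0 : M)) (fun α => derOp K (p α 1) (δ α))
    (fun i => by rw [derOp_mul, idm_mul_idm_self, smul_zero, smul_zero, add_zero])
    (fun i j h => by
      rw [derOp_mul, idm_mul_idm_of_ne h, smul_zero, smul_zero, add_zero, derOp_zero])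
    derOp_sum_idm
    (fun α => by rw [derOp_mul, idm_mul_pth one_ne_zero, smul_zero, add_zero, hs])
    (fun α => by
      have := pth_mul_idm (m := m) (c := c) α 0
      rw [zero_add, Function.iterate_zero, id] at this
      rw [derOp_mul, this, smul_zero, zero_add, ht])

theorem derRep_arrow (δ : E → M) (hs) (ht) (α : E) :
    derRep (m := m) (c := c) δ hs ht (arrow K T α) = derOp K (p α 1) (δ α) := by
  simp [derRep]

theorem derRep_vertex (δ : E → M) (hs) (ht) (i : V) :
    derRep (m := m) (c := c) δ hs ht (vertex K T i) = derOp K (e i) 0 := by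
  simp [derRep]

theorem derRep_gPath (δ : E → M) (hs) (ht) (α : E) (n : ℕ) :
    derRep (m := m) (c := c) δ hs ht (gPath K T α n) = derOp K (p α n) (pathDer m c δ α n) := by
  induction n with
  | zero =>
    rw [gPath_zero, map_one, pth_zero]
    simp [pathDer, derOp_one]
  | succ n ih =>
    rw [gPath_succ', map_mul, ih, derRep_arrow, derOp_mul, ← pth_succ', pathDer_succ,
      add_comm (envL K _ • _)]

variable (m c) in
/-- The value on a zero relation of the derivation with values `δ` on arrows. -/
def zeroDer (δ : E → M) (α : E) : M :=
  ℓ (p α 1 * p (T.f α) 1) • δ (T.g (T.f α)) +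
    ρ (p (T.g (T.f α)) 1) • (ℓ (p α 1) • δ (T.f α) + ρ (p (T.f α) 1) • δ α)

theorem derOp_zeroDer (δ : E → M) (α : E) :
    derOp K (p α 1) (δ α) * derOp K (p (T.f α) 1) (δ (T.f α)) *
      derOp K (p (T.g (T.f α)) 1) (δ (T.g (T.f α))) = derOp K (0 : Λ) (zeroDer m c δ α) := by
  rw [derOp_mul, derOp_mul, pth_mul_f_mul_g]
  rfl

theorem derOp_mul_f (δ : E → M) (hrel : ∀ α, relDer m c δ α = 0) (α : E) :
    derOp K (p α 1) (δ α) * derOp K (p (T.f α) 1) (δ (T.f α)) =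
      (c (T.orbit (T.bar α)) : K) • derOp K (p (T.bar α) (T.wt m (T.bar α) - 1))
        (pathDer m c δ (T.bar α) (T.wt m (T.bar α) - 1)) := by
  have := hrel α
  rw [relDer, sub_eq_zero, add_comm] at this
  rw [derOp_mul, pth_mul_f, derOp_smul, this]

/-- The values on zero relations are related by the commutativity relations. -/
theorem zeroDer_eq (h3 : ∀ α, 3 ≤ T.wt m α) (δ : E → M)
    (hs : ∀ α, ℓ (e (T.source α)) • δ α = δ α) (ht : ∀ α, ρ (e (T.target α)) • δ α = δ α)
    (hrel : ∀ α, relDer m c δ α = 0) (α : E) {n n' : ℕ} (hn : T.wt m (T.bar α) = n + 3)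
    (hn' : T.wt m (T.f (T.g^[n] (T.bar α))) = n' + 3) :
    ∃ (β : E) (k : K), zeroDer m c δ α =
      k • (p (T.bar α) n ⊗ₜ[K] op (p β n')) • zeroDer m c δ (T.g^[n] (T.bar α)) := by
  set γ := T.g^[n] (T.bar α) with hγ
  set Θ := derRep (m := m) (c := c) δ hs ht
  set A : E → Module.End K (M × Λ) := fun β => Θ (arrow K T β) with hA
  have hA' : ∀ β, A β = derOp K (p β 1) (δ β) := derRep_arrow δ hs ht
  have hcomm : ∀ β, A β * A (T.f β) = (c (T.orbit (T.bar β)) : K) •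
      Θ (gPath K T (T.bar β) (T.wt m (T.bar β) - 1)) := fun β => by
    rw [hA', hA', derRep_gPath, derOp_mul_f δ hrel]
  have hlast := T.iterate_wt_sub_one m (h3 (T.bar α))
  rw [hn, show n + 3 - 1 = n + 2 by omega, bar_bar, Function.iterate_succ_apply',
    Function.iterate_succ_apply', ← hγ] at hlast
  have hfg : T.f (T.g γ) = T.g (T.f α) := by rw [← bar_g, hlast, bar_f]
  have e1 : Θ (gPath K T (T.bar α) (n + 2)) = Θ (gPath K T (T.bar α) n) * (A γ * A (T.g γ)) := by
    rw [gPath_succ', gPath_succ', map_mul, map_mul, mul_assoc, Function.iterate_succ_apply', ← hγ]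
  have e2 : Θ (gPath K T (T.f γ) (n' + 2)) = A (T.f γ) * (A (T.g (T.f γ)) *
      Θ (gPath K T (T.g (T.g (T.f γ))) n')) := by
    rw [gPath_succ, gPath_succ, map_mul, map_mul]
  -- Replace α f(α) by a multiple of A_ᾱ, whose last two arrows are γ and g(γ). Since g(f(α)) =
  -- f(g(γ)), the product g(γ) f(g(γ)) is in turn a multiple of A_{f(γ)}, which starts with f(γ)
  -- g(f(γ)). The zero relation at γ now stands in the middle. Only commutativity is used, so this
  -- holds for the operators.
  have key : A α * A (T.f α) * A (T.g (T.f α)) =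
      ((c (T.orbit (T.bar α)) : K) * (c (T.orbit (T.f γ)) : K)) •
        (Θ (gPath K T (T.bar α) n) * (A γ * A (T.f γ) * A (T.g (T.f γ))) *
          Θ (gPath K T (T.g (T.g (T.f γ))) n')) := by
    rw [hcomm, hn, show n + 3 - 1 = n + 2 by omega, e1, ← hfg, smul_mul_assoc, mul_assoc, mul_assoc,
      hcomm (T.g γ), bar_g, hn', show n' + 3 - 1 = n' + 2 by omega, e2, mul_smul, mul_smul_comm,
      mul_smul_comm]
    simp only [mul_assoc]
  refine ⟨T.g (T.g (T.f γ)), (c (T.orbit (T.bar α)) : K) * (c (T.orbit (T.f γ)) : K), ?_⟩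
  -- In Λ itself both zero relations hold, so their operators have zero diagonal. The outer paths
  -- therefore act by plain multiplication, without contributing derivative terms.
  rw [hA', hA', hA', hA', hA', hA', derOp_zeroDer, derOp_zeroDer, derRep_gPath, derRep_gPath,
    derOp_mul, derOp_mul, derOp_smul] at key
  rw [derOp_inj key, mul_zero, envL_zero_smul, envR_zero_smul, zero_add, add_zero, ← mul_smul (ρ _),
    envR_mul_envL]

theorem tmul_mem_jacobson_of_left [Finite E] (h3 : ∀ α, 3 ≤ T.wt m α) {x : Λ}
    (hx : x ∈ filt T m c 1) (y : Λ) : x ⊗ₜ[K] op y ∈ Ring.jacobson (Λ ⊗[K] Λᵐᵒᵖ) := by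
  obtain ⟨N, hN⟩ := exists_filt_eq_bot (c := c) h3
  exact tmul_mem_jacobson_left (F := filt T m c) (filt_zero h3) (mul_mem_filt h3) hN hx y

theorem tmul_mem_jacobson_of_right [Finite E] (h3 : ∀ α, 3 ≤ T.wt m α) (x : Λ) {y : Λ}
    (hy : y ∈ filt T m c 1) : x ⊗ₜ[K] op y ∈ Ring.jacobson (Λ ⊗[K] Λᵐᵒᵖ) := by
  obtain ⟨N, hN⟩ := exists_filt_eq_bot (c := c) h3
  exact tmul_mem_jacobson_right (F := filt T m c) (filt_zero h3) (mul_mem_filt h3) hN x hy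

/-- Outside the tetrahedral case, the zero relations follow from the commutativity relations. -/
theorem zeroDer_eq_zero [Finite E] (h3 : ∀ α, 3 ≤ T.wt m α) (hV : 3 ≤ Fintype.card V)
    (hT : ¬ T.IsTetrahedral m) (δ : E → M)
    (hs : ∀ α, ℓ (e (T.source α)) • δ α = δ α) (ht : ∀ α, ρ (e (T.target α)) • δ α = δ α)
    (hrel : ∀ α, relDer m c δ α = 0) (α : E) : zeroDer m c δ α = 0 := by
  set Z : Submodule (Λ ⊗[K] Λᵐᵒᵖ) M := Submodule.span _ (Set.range (zeroDer m c δ)) with hZ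
  have hmem : ∀ α, zeroDer m c δ α ∈ Z := fun α => Submodule.subset_span ⟨α, rfl⟩
  set J := Ring.jacobson (Λ ⊗[K] Λᵐᵒᵖ) • Z with hJ
  have hK : ∀ (k : K) (x : M), x ∈ J → k • x ∈ J := fun k x hx => by
    rw [← one_smul (Λ ⊗[K] Λᵐᵒᵖ) x, ← smul_assoc]
    exact J.smul_mem _ hx
  have step : ∀ α, zeroDer m c δ α ∈ J ∨ (T.wt m (T.bar α) = 3 ∧ T.wt m (T.f (T.bar α)) = 3 ∧
      ∃ k : K, zeroDer m c δ α = k • zeroDer m c δ (T.bar α)) := by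
    intro α
    obtain ⟨n, hn⟩ : ∃ n, T.wt m (T.bar α) = n + 3 := ⟨_, (Nat.sub_add_cancel (h3 _)).symm⟩
    obtain ⟨n', hn'⟩ : ∃ n', T.wt m (T.f (T.g^[n] (T.bar α))) = n' + 3 :=
      ⟨_, (Nat.sub_add_cancel (h3 _)).symm⟩
    obtain ⟨β, k, h⟩ := zeroDer_eq h3 δ hs ht hrel α hn hn'
    rcases Nat.eq_zero_or_pos n with rfl | hpos
    -- The outer paths have lengths n and n′, the excesses of two weights over 3. If either is
    -- positive the multiplier is in the radical; if both vanish, γ = ᾱ and only a scalar remains.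
    · rcases Nat.eq_zero_or_pos n' with rfl | hpos'
      · right
        refine ⟨hn, hn', k, ?_⟩
        rw [h, pth_zero, pth_zero, tmul_smul_eq, envL_one, envR_one, one_smul, one_smul]
        rfl
      · left
        rw [h]
        exact hK _ _ (Submodule.smul_mem_smul
          (tmul_mem_jacobson_of_right h3 _ (pth_mem_filt hpos' hpos')) (hmem _))
    · left
      rw [h]
      exact hK _ _ (Submodule.smul_mem_smul
        (tmul_mem_jacobson_of_left h3 (pth_mem_filt hpos hpos) _) (hmem _))
  have hall : ∀ α, zeroDer m c δ α ∈ J := by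
    intro α
    rcases step α with h | ⟨h1, h2, k, h⟩
    · exact h
    · rw [h]
      -- If the step from ᾱ also gains no radical factor, the orbits of α, ᾱ, f(α) and f(ᾱ) all have
      -- weight 3, which is the tetrahedral case.
      rcases step (T.bar α) with h' | ⟨h1', h2', -⟩
      · exact hK _ _ h'
      · rw [bar_bar] at h1' h2'
        exact absurd (isTetrahedral_of_wt hV h1' h1 h2' h2) hT
  -- Nakayama's lemma: the finitely generated module of defects is contained in its own radical
  -- multiple.
  have hbot : Z = ⊥ := by
    apply (Submodule.fg_span (Set.finite_range _)).eq_bot_of_le_jacobson_smul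
    refine Submodule.span_le.2 ?_
    rintro _ ⟨α, rfl⟩
    exact hall α
  have := hmem α
  rwa [hbot, Submodule.mem_bot] at this

/-- Outside the tetrahedral case, derivations are determined by values on arrows satisfying the
commutativity relations. -/
theorem exists_derivation [Finite E] (h3 : ∀ α, 3 ≤ T.wt m α) (hV : 3 ≤ Fintype.card V)
    (hT : ¬ T.IsTetrahedral m) (δ : E → M)
    (hs : ∀ α, ℓ (e (T.source α)) • δ α = δ α) (ht : ∀ α, ρ (e (T.target α)) • δ α = δ α)
    (hrel : ∀ α, relDer m c δ α = 0) : ∃ D : Λ →ₗ[K] M,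
      (∀ x y, D (x * y) = ℓ x • D y + ρ y • D x) ∧ (∀ i, D (e i) = 0) ∧
        ∀ α, D (p α 1) = δ α := by
  let Θ : Λ →ₐ[K] Module.End K (M × Λ) := liftWeighted (derRep (m := m) (c := c) δ hs ht)
    (fun α => by rw [derRep_arrow, derRep_arrow, derRep_gPath, derOp_mul_f δ hrel])
    (fun α => by
      rw [derRep_arrow, derRep_arrow, derRep_arrow, derOp_zeroDer,
        zeroDer_eq_zero h3 hV hT δ hs ht hrel, derOp_zero])
  -- Applying the operator to (0, 1) and taking the first component extracts its off-diagonal entry.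
  let D : Λ →ₗ[K] M := LinearMap.fst K M Λ ∘ₗ LinearMap.applyₗ ((0 : M), (1 : Λ)) ∘ₗ Θ.toLinearMap
  have hD : ∀ {x z}, Θ x = derOp K x z → D x = z := by
    intro x z h
    change (Θ x (0, 1)).1 = z
    rw [h, derOp_apply, smul_zero, zero_add]
    exact one_smul _ z
  have hidm : ∀ i, Θ (e i) = derOp K (e i) (0 : M) := fun i =>
    (liftWeighted_toWeighted _ _ _ _).trans (derRep_vertex δ hs ht i)
  have hpth : ∀ α, Θ (p α 1) = derOp K (p α 1) (δ α) := fun α => by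
    have h := (congrArg Θ (toWeighted_arrow T m c α).symm).trans
      (liftWeighted_toWeighted _ _ _ _)
    exact h.trans (derRep_arrow δ hs ht α)
  have hex : ∀ x, ∃ z, Θ x = derOp K x z := by
    intro x
    induction x using weighted_induction with
    | hv i => exact ⟨_, hidm i⟩
    | ha α => exact ⟨_, hpth α⟩
    | halg r =>
      refine ⟨0, ?_⟩
      rw [AlgHom.commutes, Algebra.algebraMap_eq_smul_one, Algebra.algebraMap_eq_smul_one,
        ← derOp_one, derOp_smul, smul_zero]
    | hadd x y hx hy =>
      obtain ⟨z, hz⟩ := hx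
      obtain ⟨z', hz'⟩ := hy
      exact ⟨_, by rw [map_add, hz, hz', derOp_add]⟩
    | hmul x y hx hy =>
      obtain ⟨z, hz⟩ := hx
      obtain ⟨z', hz'⟩ := hy
      exact ⟨_, by rw [map_mul, hz, hz', derOp_mul]⟩
  refine ⟨D, fun x y => ?_, fun i => hD (hidm i), fun α => hD (hpth α)⟩
  obtain ⟨z, hz⟩ := hex x
  obtain ⟨z', hz'⟩ := hex y
  rw [hD hz, hD hz']
  exact hD (by rw [map_mul, hz, hz', derOp_mul])

end Derivation

end TriangulationQuiver

namespace TriangulationQuiver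

open MulOpposite

/-! ### The matrices of the bimodule presentation -/

section Resolution

variable {K : Type*} [Field K] {V E : Type*} [Fintype V] {T : TriangulationQuiver V E}
  {m : T.Orbit → ℕ+} {c : T.Orbit → Kˣ}

local notation "Λ" => WeightedAlgebra T m c
local notation "Λᵉ" => WeightedAlgebra T m c ⊗[K] (WeightedAlgebra T m c)ᵐᵒᵖ
local notation "e" => idm T m c
local notation "p" => pth T m c
local notation "ℓ" => envL K (A := WeightedAlgebra T m c)
local notation "ρ" => envR K (A := WeightedAlgebra T m c)

theorem source_idm_mul_pth (α : E) (n : ℕ) :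
    e (T.source α) * p α n = p α n * e (T.source (T.g^[n] α)) := by
  cases n with
  | zero => rw [pth_zero, one_mul, mul_one]; rfl
  | succ n =>
    rw [idm_mul_pth n.succ_ne_zero, Function.iterate_succ_apply', source_g, pth_mul_idm]

theorem pth_one_mul_idm (α : E) : p α 1 * e (T.target α) = p α 1 := pth_mul_idm α 0

theorem pth_one_mul_idm_of_ne {α : E} {i : V} (h : i ≠ T.target α) : p α 1 * e i = 0 :=
  pth_mul_idm_of_ne (k := 0) h

variable (T m c) in
/-- The idempotent of the enveloping algebra given by a vertex. -/
def vertexIdm (i : V) : Λᵉ := e i ⊗ₜ op (e i)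

variable (T m c) in
/-- The idempotent of the enveloping algebra given by an arrow. -/
def arrowIdm (α : E) : Λᵉ := e (T.source α) ⊗ₜ op (e (T.target α))

theorem vertexIdm_mul_self (i : V) : vertexIdm T m c i * vertexIdm T m c i = vertexIdm T m c i := by
  rw [vertexIdm, env_mul, idm_mul_idm_self]

theorem vertexIdm_mul_of_ne {i j : V} (h : i ≠ j) : vertexIdm T m c i * vertexIdm T m c j = 0 := by
  rw [vertexIdm, vertexIdm, env_mul, idm_mul_idm_of_ne h, TensorProduct.zero_tmul]

theorem arrowIdm_mul_self (α : E) : arrowIdm T m c α * arrowIdm T m c α = arrowIdm T m c α := by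
  rw [arrowIdm, env_mul, idm_mul_idm_self, idm_mul_idm_self]

theorem envFlip_vertexIdm (i : V) : envFlip K Λ (vertexIdm T m c i) = vertexIdm T m c i := rfl

theorem envL_mul_arrowIdm (α : E) : ℓ (e (T.source α)) * arrowIdm T m c α = arrowIdm T m c α := by
  rw [arrowIdm, envL, env_mul, idm_mul_idm_self, mul_one]

theorem envR_mul_arrowIdm (α : E) : ρ (e (T.target α)) * arrowIdm T m c α = arrowIdm T m c α := by
  rw [arrowIdm, envR, env_mul, idm_mul_idm_self, one_mul]

variable (T m c) in
/-- The first differential of the bimodule resolution. -/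
def diffMat (α : E) : V → Λᵉ := (ℓ (p α 1) - ρ (p α 1)) • vertexIdm T m c

theorem diffMat_apply (α : E) (i : V) : diffMat T m c α i =
    (p α 1 * e i) ⊗ₜ op (e i) - e i ⊗ₜ op (e i * p α 1) := by
  rw [diffMat, Pi.smul_apply, smul_eq_mul, sub_mul, vertexIdm, envL, envR, env_mul, env_mul,
    one_mul, mul_one]

open Classical in
variable (T m c) in
/-- The standard generators of the term of degree one in the bimodule resolution. -/
def arrowBasis (α : E) : E → Λᵉ := Pi.single α (arrowIdm T m c α)

theorem arrowBasis_eq [DecidableEq E] (α : E) :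
    arrowBasis T m c α = Pi.single α (arrowIdm T m c α) := by
  rw [arrowBasis]
  congr!

theorem smul_arrowBasis [DecidableEq E] (s : Λᵉ) (α : E) :
    s • arrowBasis T m c α = Pi.single α (s * arrowIdm T m c α) := by
  rw [arrowBasis_eq]
  exact (Pi.single_smul' α s (arrowIdm T m c α)).symm

variable (T m c) in
/-- The second differential of the bimodule resolution. -/
def relMat (γ : E) : E → Λᵉ := relDer m c (arrowBasis T m c) (T.f γ)

theorem arrowIdm_mul_diffMat (α : E) (i : V) :
    arrowIdm T m c α * diffMat T m c α i = diffMat T m c α i := by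
  rw [diffMat_apply, arrowIdm, mul_sub, env_mul, env_mul, ← mul_assoc, idm_mul_pth one_ne_zero,
    mul_assoc, pth_one_mul_idm]
  congr 1
  · by_cases h : i = T.target α
    · rw [h, idm_mul_idm_self]
    · rw [pth_one_mul_idm_of_ne h, TensorProduct.zero_tmul, TensorProduct.zero_tmul]
  · by_cases h : i = T.source α
    · rw [h, idm_mul_idm_self]
    · rw [idm_mul_pth_of_ne one_ne_zero h, op_zero, TensorProduct.tmul_zero,
        TensorProduct.tmul_zero]

theorem diffMat_mul_vertexIdm (α : E) (i : V) :
    diffMat T m c α i * vertexIdm T m c i = diffMat T m c α i := by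
  rw [diffMat, Pi.smul_apply, smul_eq_mul, mul_assoc, vertexIdm_mul_self]

theorem diffMat_mem_jacobson [Finite E] (h3 : ∀ α, 3 ≤ T.wt m α) (α : E) (i : V) :
    diffMat T m c α i ∈ Ring.jacobson Λᵉ := by
  have hp : p α 1 ∈ filt T m c 1 := pth_mem_filt one_pos le_rfl
  have hi : e i ∈ filt T m c 0 := idm_mem_filt i
  rw [diffMat_apply]
  exact sub_mem (tmul_mem_jacobson_of_left h3 (mul_mem_filt (n := 1) (l := 0) h3 hp hi) _)
    (tmul_mem_jacobson_of_right h3 _ (mul_mem_filt (n := 0) (l := 1) h3 hi hp))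

theorem envFlip_diffMat_mem_jacobson [Finite E] (h3 : ∀ α, 3 ≤ T.wt m α) (α : E) (i : V) :
    envFlip K Λ (diffMat T m c α i) ∈ Ring.jacobson Λᵉ := by
  have hp : p α 1 ∈ filt T m c 1 := pth_mem_filt one_pos le_rfl
  have hi : e i ∈ filt T m c 0 := idm_mem_filt i
  rw [diffMat_apply, map_sub, envFlip_tmul, envFlip_tmul]
  exact sub_mem (tmul_mem_jacobson_of_right h3 _ (mul_mem_filt (n := 1) (l := 0) h3 hp hi))
    (tmul_mem_jacobson_of_left h3 (mul_mem_filt (n := 0) (l := 1) h3 hi hp) _)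

section Naturality

variable {M N : Type*} [AddCommGroup M]
  [Module (WeightedAlgebra T m c ⊗[K] (WeightedAlgebra T m c)ᵐᵒᵖ) M]

theorem linearCombination_arrowBasis [Fintype E] {u : E → M}
    (hu : ∀ α, arrowIdm T m c α • u α = u α) (α : E) :
    Fintype.linearCombination Λᵉ u (arrowBasis T m c α) = u α := by
  classical
  rw [arrowBasis, ← hu α]
  convert Fintype.linearCombination_apply_single Λᵉ u α (arrowIdm T m c α) using 1

/-- For an inner derivation the Leibniz sum along a path telescopes to the commutator with the whole
path. -/
theorem pathDer_inner (x : M) (α : E) (n : ℕ) :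
    pathDer m c (fun β => (ℓ (p β 1) - ρ (p β 1)) • x) α n = (ℓ (p α n) - ρ (p α n)) • x := by
  induction n with
  | zero =>
    rw [pathDer, Finset.range_zero, Finset.sum_empty, pth_zero, envL_one, envR_one, sub_smul,
      sub_self]
  | succ n ih =>
    rw [pathDer_succ, ih, pth_succ' α n, envL_mul, envR_mul]
    simp only [sub_smul, smul_sub, mul_smul, envL_envR_comm]
    abel

variable [Module K M] [IsScalarTower K (WeightedAlgebra T m c ⊗[K] (WeightedAlgebra T m c)ᵐᵒᵖ) M]
  [AddCommGroup N] [Module K N]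
  [Module (WeightedAlgebra T m c ⊗[K] (WeightedAlgebra T m c)ᵐᵒᵖ) N]
  [IsScalarTower K (WeightedAlgebra T m c ⊗[K] (WeightedAlgebra T m c)ᵐᵒᵖ) N]

theorem map_relDer (F : M →ₗ[WeightedAlgebra T m c ⊗[K] (WeightedAlgebra T m c)ᵐᵒᵖ] N)
    (δ : E → M) (α : E) : F (relDer m c δ α) = relDer m c (fun β => F (δ β)) α := by
  have hK : ∀ (k : K) x, F (k • x) = k • F x := fun k x => F.map_smul_of_tower k x
  rw [relDer, relDer, map_sub, map_add, map_smul, map_smul, hK, pathDer, pathDer, map_sum]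
  simp only [map_smul]

theorem linearCombination_relMat [Fintype E] {u : E → M}
    (hu : ∀ α, arrowIdm T m c α • u α = u α) (γ : E) :
    Fintype.linearCombination Λᵉ u (relMat T m c γ) = relDer m c u (T.f γ) := by
  rw [relMat, map_relDer]
  congr 1
  exact funext (linearCombination_arrowBasis hu)

/-- Commutators respect a relation that holds in Λ. Since d sends generators to commutators, this is
the identity d ∘ r = 0. -/
theorem relDer_inner (x : M) (α : E) :
    relDer m c (fun β => (ℓ (p β 1) - ρ (p β 1)) • x) α = 0 := by
  rw [relDer, pathDer_inner, ← smul_assoc (c _ : K), smul_sub (c _ : K), ← envL_smul, ← envR_smul,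
    ← pth_mul_f, envL_mul, envR_mul]
  simp only [sub_smul, smul_sub, mul_smul, envL_envR_comm]
  abel

end Naturality

theorem linearCombination_diffMat_relMat [Fintype E] (γ : E) :
    Fintype.linearCombination Λᵉ (diffMat T m c) (relMat T m c γ) = 0 := by
  rw [linearCombination_relMat fun α => funext fun i => arrowIdm_mul_diffMat α i]
  exact relDer_inner (vertexIdm T m c) _

end Resolution

end TriangulationQuiver

namespace TriangulationQuiver

open MulOpposite

/-! ### Exactness at P₀ and P₁ -/

section Exactness

variable {K : Type*} [Field K] {V E : Type*} [Fintype V] {T : TriangulationQuiver V E}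
  {m : T.Orbit → ℕ+} {c : T.Orbit → Kˣ}

local notation "Λ" => WeightedAlgebra T m c
local notation "Λᵉ" => WeightedAlgebra T m c ⊗[K] (WeightedAlgebra T m c)ᵐᵒᵖ
local notation "e" => idm T m c
local notation "p" => pth T m c
local notation "ℓ" => envL K (A := WeightedAlgebra T m c)
local notation "ρ" => envR K (A := WeightedAlgebra T m c)


section Boundary

variable {M : Type*} [AddCommGroup M]
  [Module (WeightedAlgebra T m c ⊗[K] (WeightedAlgebra T m c)ᵐᵒᵖ) M]
  {W : Submodule (WeightedAlgebra T m c ⊗[K] (WeightedAlgebra T m c)ᵐᵒᵖ) M} {z : M}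

/-- The elements commuting with z modulo W are closed under products, because [xy, z] = x[y, z] +
[x, z]y. So the generators suffice. -/
theorem inner_mem (hi : ∀ i, ℓ (e i) • z = ρ (e i) • z)
    (hW : ∀ α, (ℓ (p α 1) - ρ (p α 1)) • z ∈ W) (x : Λ) : ℓ x • z - ρ x • z ∈ W := by
  induction x using weighted_induction with
  | hv i =>
    rw [hi, sub_self]
    exact zero_mem _
  | ha α =>
    rw [← sub_smul]
    exact hW α
  | halg r =>
    rw [Algebra.algebraMap_eq_smul_one, envL_smul, envR_smul, envL_one, envR_one, sub_self]
    exact zero_mem _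
  | hadd x y hx hy =>
    rw [envL_add, envR_add, add_smul, add_smul, add_sub_add_comm]
    exact add_mem hx hy
  | hmul x y hx hy =>
    have := add_mem (Submodule.smul_mem _ (ℓ x) hy) (Submodule.smul_mem _ (ρ y) hx)
    rw [smul_sub, smul_sub, envL_envR_comm, sub_add_sub_cancel] at this
    rwa [envL_mul, envR_mul, mul_smul, mul_smul]

attribute [local instance] envModule in
-- Modulo W the element z is central, so the left factor of u can be moved to the right, and u • z
-- depends only on the image of u under multiplication.
theorem smul_sub_mem (hi : ∀ i, ℓ (e i) • z = ρ (e i) • z)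
    (hW : ∀ α, (ℓ (p α 1) - ρ (p α 1)) • z ∈ W) (u : Λᵉ) :
    u • z - ρ (u • (1 : Λ)) • z ∈ W := by
  induction u using env_induction with
  | h a b =>
    have := Submodule.smul_mem _ (ρ b) (inner_mem hi hW a)
    rw [smul_sub, ← mul_smul, ← mul_smul, envR_mul_envL, ← envR_mul] at this
    rwa [env_smul, mul_one]
  | hadd x y hx hy =>
    rw [add_smul, add_smul, envR_add, add_smul, add_sub_add_comm]
    exact add_mem hx hy

end Boundary

theorem envL_idm_smul_vertexIdm (i : V) :
    ℓ (e i) • vertexIdm T m c = ρ (e i) • vertexIdm T m c := by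
  funext j
  rw [Pi.smul_apply, Pi.smul_apply, smul_eq_mul, smul_eq_mul, vertexIdm, envL, envR, env_mul,
    env_mul, one_mul, mul_one]
  by_cases h : i = j
  · rw [h, idm_mul_idm_self]
  · rw [idm_mul_idm_of_ne h, idm_mul_idm_of_ne (Ne.symm h), op_zero, TensorProduct.tmul_zero,
      TensorProduct.zero_tmul]

section Action

attribute [local instance] envModule

theorem vertexIdm_smul_idm (i : V) : vertexIdm T m c i • e i = e i := by
  rw [vertexIdm, env_smul, idm_mul_idm_self, idm_mul_idm_self]

theorem vertexIdm_smul_one (i : V) : vertexIdm T m c i • (1 : Λ) = e i := by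
  rw [vertexIdm, env_smul, mul_one, idm_mul_idm_self]

theorem linearCombination_vertexIdm :
    Fintype.linearCombination Λᵉ (idm T m c) (vertexIdm T m c) = (1 : Λ) := by
  rw [Fintype.linearCombination_apply, ← sum_idm]
  exact Finset.sum_congr rfl fun i _ => vertexIdm_smul_idm i

theorem linearCombination_idm_surjective (z : Λ) :
    ∃ x : V → Λᵉ, Fintype.linearCombination Λᵉ (idm T m c) x = z := by
  refine ⟨ℓ z • vertexIdm T m c, ?_⟩
  rw [map_smul, linearCombination_vertexIdm, envL, env_smul, mul_one, mul_one]

theorem linearCombination_idm_diffMat (α : E) :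
    Fintype.linearCombination Λᵉ (idm T m c) (diffMat T m c α) = 0 := by
  rw [diffMat, map_smul, linearCombination_vertexIdm, sub_smul, envL, envR, env_smul, env_smul]
  simp only [mul_one, one_mul, sub_self]

theorem exact_diffMat [Fintype E] {x : V → Λᵉ} (hx : x ∈ projMod (vertexIdm T m c))
    (h : Fintype.linearCombination Λᵉ (idm T m c) x = 0) :
    ∃ y, Fintype.linearCombination Λᵉ (diffMat T m c) y = x := by
  classical
  -- The whole vector x is the multiple of `vertexIdm` by one element u of the enveloping algebra,
  -- and u • 1 is the augmentation of x. Centrality modulo the image of d then gives x ≡ 0.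
  have h1 : (∑ i, x i * vertexIdm T m c i) • vertexIdm T m c = x := by
    funext j
    rw [Pi.smul_apply, smul_eq_mul, Finset.sum_mul, Finset.sum_eq_single j]
    · rw [mul_assoc, vertexIdm_mul_self, hx j]
    · intro i _ hi
      rw [mul_assoc, vertexIdm_mul_of_ne hi, mul_zero]
    · simp
  have h2 : (∑ i, x i * vertexIdm T m c i) • (1 : Λ) = 0 := by
    rw [Finset.sum_smul, ← h, Fintype.linearCombination_apply]
    exact Finset.sum_congr rfl fun i _ => by rw [mul_smul, vertexIdm_smul_one]
  have h3 := smul_sub_mem (T := T) (m := m) (c := c) (z := vertexIdm T m c)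
    (W := LinearMap.range (Fintype.linearCombination Λᵉ (diffMat T m c)))
    envL_idm_smul_vertexIdm (fun α => ⟨Pi.single α 1, by
      rw [Fintype.linearCombination_apply_single, one_smul]
      rfl⟩) (∑ i, x i * vertexIdm T m c i)
  rw [h2] at h3
  have h4 := (congrArg _ (envR_zero_smul (K := K) (A := Λ) (vertexIdm T m c))).trans
    ((sub_zero _).trans h1)
  rwa [h4] at h3

end Action

section Second

variable {M : Type*} [AddCommGroup M] [Module K M]
  [Module (WeightedAlgebra T m c ⊗[K] (WeightedAlgebra T m c)ᵐᵒᵖ) M]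
  [IsScalarTower K (WeightedAlgebra T m c ⊗[K] (WeightedAlgebra T m c)ᵐᵒᵖ) M]

/-- The bimodule map extending a linear map, as a map of right modules. -/
def rightExtend (D : Λ →ₗ[K] M) : Λᵉ →ₗ[K] M :=
  TensorProduct.lift (LinearMap.mk₂ K (fun (a : Λ) (b : Λᵐᵒᵖ) => ρ b.unop • D a)
    (fun a a' b => by rw [map_add, smul_add])
    (fun k a b => by rw [map_smul, smul_comm])
    (fun a b b' => by rw [unop_add, envR_add, add_smul])
    (fun k a b => by rw [unop_smul, envR_smul, smul_assoc]))

theorem rightExtend_tmul (D : Λ →ₗ[K] M) (a b : Λ) :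
    rightExtend D (a ⊗ₜ op b) = ρ b • D a := rfl

/-- The extension of D to P₀ sends a(α ⊗ 1 − 1 ⊗ α)b to D(aα)b − D(a)αb, which is a D(α) b by the
Leibniz rule. Composition with d thus recovers the values of D on arrows. -/
theorem sum_rightExtend_diffMat {D : Λ →ₗ[K] M} (hD : ∀ x y, D (x * y) = ℓ x • D y + ρ y • D x)
    (hi : ∀ i, D (e i) = 0) (s : Λᵉ) (α : E) :
    ∑ i, rightExtend D (s * diffMat T m c α i) = s • D (p α 1) := by
  have hDi : ∀ x i, D (x * e i) = ρ (e i) • D x := fun x i => by rw [hD, hi, smul_zero, zero_add]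
  have hsum : ∀ (b : Λ) (z : M), ∑ i, ρ (e i * b) • ρ (e i) • z = ρ b • z := by
    intro b z
    simp only [← mul_smul, ← envR_mul, ← mul_assoc, idm_mul_idm_self]
    rw [← Finset.sum_smul, ← envR_sum, ← Finset.sum_mul, sum_idm, one_mul]
  induction s using env_induction with
  | h a b =>
    simp only [diffMat_apply, mul_sub, env_mul, map_sub, rightExtend_tmul, ← mul_assoc, hDi]
    simp only [mul_assoc]
    rw [Finset.sum_sub_distrib, hsum, hsum, hD, smul_add, envR_mul, mul_smul, add_sub_cancel_right,
      ← envL_envR_comm, tmul_smul_eq]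
  | hadd x y hx hy => simp only [add_mul, map_add, Finset.sum_add_distrib, hx, hy, add_smul]

end Second

/-- In the cokernel of r the classes of the arrow generators satisfy the differentiated
commutativity relations, so they are the values of a derivation. Extended to P₀ and composed with d,
it is the quotient map on P₁, hence the kernel of d lies in the image of r. -/
theorem exact_relMat [Fintype E] (h3 : ∀ α, 3 ≤ T.wt m α) (hV : 3 ≤ Fintype.card V)
    (hT : ¬ T.IsTetrahedral m) {x : E → Λᵉ} (hx : x ∈ projMod (arrowIdm T m c))
    (h : Fintype.linearCombination Λᵉ (diffMat T m c) x = 0) :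
    ∃ y, Fintype.linearCombination Λᵉ (relMat T m c) y = x := by
  classical
  let W := LinearMap.range (Fintype.linearCombination Λᵉ (relMat T m c))
  let δ : E → (E → Λᵉ) ⧸ W := fun α => W.mkQ (arrowBasis T m c α)
  have hL : ∀ α, ℓ (e (T.source α)) • arrowBasis T m c α = arrowBasis T m c α := fun α => by
    rw [smul_arrowBasis, envL_mul_arrowIdm]; rfl
  have hR : ∀ α, ρ (e (T.target α)) • arrowBasis T m c α = arrowBasis T m c α := fun α => by
    rw [smul_arrowBasis, envR_mul_arrowIdm]; rfl
  obtain ⟨D, hD, hi, hδ⟩ := exists_derivation (m := m) (c := c) h3 hV hT δ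
    (fun α => by rw [← map_smul, hL]) (fun α => by rw [← map_smul, hR])
    (fun α => by
      rw [← map_relDer, Submodule.mkQ_apply, Submodule.Quotient.mk_eq_zero]
      -- Row γ of the matrix is the relation at f(γ), so the relation at α is row f²(α).
      refine ⟨Pi.single (T.f (T.f α)) 1, ?_⟩
      rw [Fintype.linearCombination_apply_single, one_smul, relMat, T.f_cube])
  have key : ∑ i, rightExtend D (Fintype.linearCombination Λᵉ (diffMat T m c) x i) = W.mkQ x := by
    simp only [linearCombination_pi_apply, map_sum]
    rw [Finset.sum_comm]
    simp only [sum_rightExtend_diffMat hD hi, hδ]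
    conv_rhs => rw [← Finset.univ_sum_single x, map_sum]
    refine Finset.sum_congr rfl fun α _ => ?_
    rw [← map_smul, smul_arrowBasis, hx α]
  rw [h] at key
  simp only [Pi.zero_apply, map_zero, Finset.sum_const_zero] at key
  have := key.symm
  rwa [Submodule.mkQ_apply, Submodule.Quotient.mk_eq_zero] at this

end Exactness

end TriangulationQuiver

namespace TriangulationQuiver

open MulOpposite

/-! ### Hermitian symmetry of the relation matrix -/

section Symmetry

variable {K : Type*} [Field K] {V E : Type*} [Fintype V] {T : TriangulationQuiver V E}
  {m : T.Orbit → ℕ+} {c : T.Orbit → Kˣ}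

local notation "Λ" => WeightedAlgebra T m c
local notation "Λᵉ" => WeightedAlgebra T m c ⊗[K] (WeightedAlgebra T m c)ᵐᵒᵖ
local notation "e" => idm T m c
local notation "p" => pth T m c
local notation "ℓ" => envL K (A := WeightedAlgebra T m c)
local notation "ρ" => envR K (A := WeightedAlgebra T m c)

/-- The relation at f(γ) runs from the target of γ to its source. Indexing it by γ makes its
idempotent the flip of the idempotent of γ, which is what lets the matrix be compared with its own
σ-transpose. -/
theorem relMat_apply [DecidableEq E] (γ β : E) : relMat T m c γ β =
    (if β = T.f γ then e (T.target γ) ⊗ₜ op (p (T.f (T.f γ)) 1) else 0) +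
      (if β = T.f (T.f γ) then p (T.f γ) 1 ⊗ₜ op (e (T.source γ)) else 0) -
      (c (T.orbit (T.g γ)) : K) • ∑ k ∈ Finset.range (T.wt m (T.g γ) - 1),
        if β = T.g^[k + 1] γ then
          (p (T.g γ) k * e (T.source β)) ⊗ₜ
            op (e (T.target β) * p (T.g β) (T.wt m (T.g γ) - 2 - k)) else 0 := by
  have h := map_relDer (LinearMap.proj β : (E → Λᵉ) →ₗ[Λᵉ] Λᵉ) (arrowBasis T m c) (T.f γ)
  have hb : ∀ α, (LinearMap.proj β : (E → Λᵉ) →ₗ[Λᵉ] Λᵉ) (arrowBasis T m c α) =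
      if β = α then arrowIdm T m c β else 0 := fun α => by
    rw [arrowBasis_eq, LinearMap.proj_apply, Pi.single_apply]
    split_ifs with h
    · rw [h]
    · rfl
  simp only [hb] at h
  refine h.trans ?_
  rw [relDer, pathDer, bar_f]
  congr 1
  · congr 1
    · split_ifs with hβ
      · rw [hβ, smul_eq_mul, arrowIdm, envR, env_mul, one_mul, T.source_f, ← T.source_f (T.f γ),
          idm_mul_pth one_ne_zero]
      · rw [smul_zero]
    · split_ifs with hβ
      · rw [hβ, smul_eq_mul, arrowIdm, envL, env_mul, mul_one, T.source_f, pth_one_mul_idm,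
          target_f_f]
      · rw [smul_zero]
  · congr 1
    refine Finset.sum_congr rfl fun k _ => ?_
    rw [← Function.iterate_succ_apply T.g k γ]
    split_ifs with hβ
    · rw [smul_eq_mul, arrowIdm, env_mul, Function.iterate_succ_apply' T.g k,
        ← Function.iterate_succ_apply T.g k γ, ← hβ,
        show T.wt m (T.g γ) - 2 - k = T.wt m (T.g γ) - 1 - 1 - k by omega]
    · rw [smul_zero]

/-- The two sides of a triangle other than γ contribute one term each, and transposition exchanges
these terms: β = f(γ) exactly when γ = f²(β). -/
theorem arrow_term_symm (γ β : E) [DecidableEq E] :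
    envFlip K Λ (if β = T.f γ then e (T.target γ) ⊗ₜ op (p (T.f (T.f γ)) 1) else 0) =
      if γ = T.f (T.f β) then p (T.f β) 1 ⊗ₜ op (e (T.source β)) else 0 := by
  by_cases h : β = T.f γ
  · rw [if_pos h, if_pos (by rw [h, T.f_cube]), h, T.source_f, envFlip_tmul]
  · rw [if_neg h, if_neg (fun h' => h (by rw [h', T.f_cube])), map_zero]

/-- An occurrence of β in A_{g(γ)} writes the weighted cycle as γ u β v and contributes u ⊗ v. Read
from β the same cycle is β v γ u and contributes v ⊗ u. -/
theorem path_sum_symm [Finite E] [DecidableEq E] (γ β : E) :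
    envFlip K Λ ((c (T.orbit (T.g γ)) : K) • ∑ k ∈ Finset.range (T.wt m (T.g γ) - 1),
        if β = T.g^[k + 1] γ then
          (p (T.g γ) k * e (T.source β)) ⊗ₜ
            op (e (T.target β) * p (T.g β) (T.wt m (T.g γ) - 2 - k)) else 0) =
      (c (T.orbit (T.g β)) : K) • ∑ k ∈ Finset.range (T.wt m (T.g β) - 1),
        if γ = T.g^[k + 1] β then
          (p (T.g β) k * e (T.source γ)) ⊗ₜ
            op (e (T.target γ) * p (T.g γ) (T.wt m (T.g β) - 2 - k)) else 0 := by
  by_cases hc : ∃ n, β = T.g^[n] γ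
  · have hw : T.wt m (T.g γ) = T.wt m (T.g β) := by
      obtain ⟨n, rfl⟩ := hc
      rw [wt_g, wt_g, wt_iterate]
    have ho : T.orbit (T.g γ) = T.orbit (T.g β) := by
      obtain ⟨n, rfl⟩ := hc
      rw [orbit_g, orbit_g, orbit_iterate]
    have hwγ : T.wt m γ = T.wt m (T.g β) := by rw [← hw, wt_g]
    have hwβ : T.wt m β = T.wt m (T.g β) := by rw [wt_g]
    -- The pieces u and v have total length m·n − 2, so exchanging them replaces k by m·n − 2 − k.
    rw [hw, ho, map_smul, map_sum, ← Finset.sum_range_reflect]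
    congr 1
    refine Finset.sum_congr rfl fun k hk => ?_
    rw [Finset.mem_range] at hk
    have h1 : T.wt m (T.g β) - 1 - 1 - k = T.wt m (T.g β) - 2 - k := by omega
    have h2 : T.wt m (T.g β) - 2 - (T.wt m (T.g β) - 2 - k) = k := by omega
    have h3 : T.wt m (T.g β) - 2 - k + 1 + (k + 1) = T.wt m (T.g β) := by omega
    rw [h1, h2]
    have hiff : β = T.g^[T.wt m (T.g β) - 2 - k + 1] γ ↔ γ = T.g^[k + 1] β := by
      constructor
      · intro h
        conv_rhs => rw [h, ← Function.iterate_add_apply, add_comm (k + 1), h3, ← hwγ, iterate_wt]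
      · intro h
        conv_rhs => rw [h, ← Function.iterate_add_apply, h3, ← hwβ, iterate_wt]
    by_cases h : γ = T.g^[k + 1] β
    · have h' := hiff.2 h
      rw [if_pos h', if_pos h, envFlip_tmul, ← T.source_g β, source_idm_mul_pth, ← T.source_g γ,
        source_idm_mul_pth, ← Function.iterate_succ_apply, ← Function.iterate_succ_apply]
      rw [Nat.succ_eq_add_one, Nat.succ_eq_add_one, ← h, ← h']
    · rw [if_neg h, if_neg (mt hiff.1 h), map_zero]
  · rw [Finset.sum_eq_zero, Finset.sum_eq_zero, smul_zero, smul_zero, map_zero]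
    · intro k hk
      rw [Finset.mem_range] at hk
      refine if_neg fun h => hc ⟨T.wt m β - (k + 1), ?_⟩
      rw [h, ← Function.iterate_add_apply, Nat.sub_add_cancel, iterate_wt]
      rw [wt_g] at hk
      omega
    · intro k hk
      exact if_neg fun h => hc ⟨_, h⟩

theorem envFlip_relMat [Finite E] (γ β : E) :
    envFlip K Λ (relMat T m c γ β) = relMat T m c β γ := by
  classical
  have h := congrArg (envFlip K Λ) (arrow_term_symm (K := K) (m := m) (c := c) β γ)
  rw [envFlip_envFlip] at h
  rw [relMat_apply, relMat_apply, map_sub, map_add, path_sum_symm, arrow_term_symm, ← h,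
    add_comm]

theorem relMat_mul_arrowIdm (γ β : E) :
    relMat T m c γ β * arrowIdm T m c β = relMat T m c γ β := by
  classical
  let P : (E → Λᵉ) →ₗ[Λᵉ] Λᵉ := LinearMap.proj β
  have h : ∀ α, (LinearMap.toSpanSingleton Λᵉ Λᵉ (arrowIdm T m c β) ∘ₗ P) (arrowBasis T m c α) =
      P (arrowBasis T m c α) := fun α => by
    rw [arrowBasis_eq, LinearMap.comp_apply, LinearMap.proj_apply,
      LinearMap.toSpanSingleton_apply, smul_eq_mul, Pi.single_apply]
    split_ifs with h
    · rw [h, arrowIdm_mul_self]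
    · rw [zero_mul]
  have h1 := map_relDer P (arrowBasis T m c) (T.f γ)
  have h2 := map_relDer (LinearMap.toSpanSingleton Λᵉ Λᵉ (arrowIdm T m c β) ∘ₗ P)
    (arrowBasis T m c) (T.f γ)
  simp only [h] at h2
  exact h2.trans h1.symm

theorem relMat_mem_jacobson [Finite E] (h3 : ∀ α, 3 ≤ T.wt m α) (γ β : E) :
    relMat T m c γ β ∈ Ring.jacobson Λᵉ := by
  classical
  have hJ : ∀ (k : K) {x : Λᵉ}, x ∈ Ring.jacobson Λᵉ → k • x ∈ Ring.jacobson Λᵉ := fun k x hx => by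
    rw [← one_mul x, ← smul_mul_assoc]
    exact Ideal.mul_mem_left _ _ hx
  have hs := h3 (T.g γ)
  rw [relMat_apply]
  refine sub_mem (add_mem ?_ ?_) (hJ _ (sum_mem fun k hk => ?_))
  · split_ifs
    · exact tmul_mem_jacobson_of_right h3 _ (pth_mem_filt one_pos le_rfl)
    · exact zero_mem _
  · split_ifs
    · exact tmul_mem_jacobson_of_left h3 (pth_mem_filt one_pos le_rfl) _
    · exact zero_mem _
  · split_ifs
    -- For k = 0 the left tensor factor is idempotent, but the path on the right has length m·n − 2
    -- ≥ 1. This is where weights of at least 3 ensure minimality.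
    · rcases Nat.eq_zero_or_pos k with rfl | hk
      · exact tmul_mem_jacobson_of_right h3 _ (mul_mem_filt (n := 0) (l := 1) h3 (idm_mem_filt _)
          (pth_mem_filt (by omega) (by omega)))
      · exact tmul_mem_jacobson_of_left h3 (mul_mem_filt (n := 1) (l := 0) h3
          (pth_mem_filt hk hk) (idm_mem_filt _)) _
    · exact zero_mem _

end Symmetry

end TriangulationQuiver

namespace TriangulationQuiver

open MulOpposite

/-! ### Minimality at the last term, and assembly of the presentation -/

section Presentation

variable {K : Type*} [Field K] {V E : Type*} [Fintype V] {T : TriangulationQuiver V E}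
  {m : T.Orbit → ℕ+} {c : T.Orbit → Kˣ}

local notation "Λ" => WeightedAlgebra T m c
local notation "Λᵉ" => WeightedAlgebra T m c ⊗[K] (WeightedAlgebra T m c)ᵐᵒᵖ
local notation "e" => idm T m c
local notation "p" => pth T m c

attribute [local instance] envModule

/-- The socle element annihilates all paths of positive length, so pairing with it reads off the
coefficient of the trivial path. -/
theorem idm_mul_sub_mem_filt [Finite E] (h3 : ∀ α, 3 ≤ T.wt m α) (i : V) (x : Λ) :
    e i * x - symForm h3 (socle T m c i * x) • e i ∈ filt T m c 1 ∧
      x * e i - symForm h3 (socle T m c i * x) • e i ∈ filt T m c 1 := by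
  obtain ⟨r, hr⟩ := exists_sub_mem_filt h3 x
  obtain ⟨z, hz, rfl⟩ : ∃ z ∈ filt T m c 1, x = ∑ j, r j • e j + z := ⟨_, hr, by abel⟩
  have hl : e i * ∑ j, r j • e j = r i • e i := by
    rw [Finset.mul_sum, Finset.sum_eq_single i]
    · rw [mul_smul_comm, idm_mul_idm_self]
    · intro j _ hj
      rw [mul_smul_comm, idm_mul_idm_of_ne hj.symm, smul_zero]
    · simp
  have hr' : (∑ j, r j • e j) * e i = r i • e i := by
    rw [Finset.sum_mul, Finset.sum_eq_single i]
    · rw [smul_mul_assoc, idm_mul_idm_self]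
    · intro j _ hj
      rw [smul_mul_assoc, idm_mul_idm_of_ne hj, smul_zero]
    · simp
  have hs : symForm h3 (socle T m c i * (∑ j, r j • e j + z)) = r i := by
    rw [mul_add, socle_mul h3 i hz, add_zero, ← socle_mul_idm h3, mul_assoc, hl, mul_smul_comm,
      socle_mul_idm h3, map_smul, symForm_socle, smul_eq_mul, mul_one]
  rw [hs, mul_add, add_mul, hl, hr', add_sub_cancel_left, add_sub_cancel_left]
  exact ⟨mul_mem_filt (n := 0) (l := 1) h3 (idm_mem_filt i) hz,
    mul_mem_filt (n := 1) (l := 0) h3 hz (idm_mem_filt i)⟩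

/-- Modulo the radical, the left ideal generated by e_i ⊗ e_i is one-dimensional. The coordinate of
u there is its pairing with socle ⊗ socle. -/
theorem mul_vertexIdm_sub_mem_jacobson [Finite E] (h3 : ∀ α, 3 ≤ T.wt m α) (i : V) (u : Λᵉ) :
    u * vertexIdm T m c i - envForm (symForm h3)
      ((socle T m c i ⊗ₜ op (socle T m c i)) * envFlip K Λ u) • vertexIdm T m c i ∈
        Ring.jacobson Λᵉ := by
  induction u using env_induction with
  | h a b =>
    have ha := (idm_mul_sub_mem_filt h3 i a).2
    have hb := (idm_mul_sub_mem_filt h3 i b).1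
    rw [envFlip_tmul, env_mul, envForm_tmul, symForm_mul_comm h3 a, vertexIdm, env_mul]
    set r := symForm h3 (socle T m c i * a)
    set r' := symForm h3 (socle T m c i * b)
    have h : (a * e i) ⊗ₜ[K] op (e i * b) - (r' * r) • e i ⊗ₜ[K] op (e i) =
        (a * e i - r • e i) ⊗ₜ[K] op (e i * b) + (r • e i) ⊗ₜ[K] op (e i * b - r' • e i) := by
      rw [TensorProduct.sub_tmul, op_sub, TensorProduct.tmul_sub, op_smul, TensorProduct.tmul_smul,
        sub_add_sub_cancel, ← TensorProduct.smul_tmul', smul_smul]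
    rw [h]
    exact add_mem (tmul_mem_jacobson_of_left h3 ha _) (tmul_mem_jacobson_of_right h3 _ hb)
  | hadd x y hx hy =>
    rw [add_mul, map_add, mul_add, map_add, add_smul, add_sub_add_comm]
    exact add_mem hx hy

/-- Multiplication kills socle ⊗ socle, so that element lies in the image of d and is orthogonal to
the kernel of the adjoint of d. By the preceding computation this orthogonality says that the
coordinate x_i is radical. -/
theorem mem_jacobson_of_linearCombination_flip [Fintype E] (h3 : ∀ α, 3 ≤ T.wt m α) {x : V → Λᵉ}
    (hx : x ∈ projMod (vertexIdm T m c))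
    (h : Fintype.linearCombination Λᵉ (fun i α => envFlip K Λ (diffMat T m c α i)) x = 0) (i : V) :
    x i ∈ Ring.jacobson Λᵉ := by
  classical
  let s : V → Λᵉ := Pi.single i (socle T m c i ⊗ₜ op (socle T m c i))
  have hs : s i = socle T m c i ⊗ₜ op (socle T m c i) := Pi.single_eq_same _ _
  have hs' : ∀ j, j ≠ i → s j = 0 := fun j hj => Pi.single_eq_of_ne hj _
  obtain ⟨y, hy⟩ : ∃ y, Fintype.linearCombination Λᵉ (diffMat T m c) y = s := by
    apply exact_diffMat
    · intro j
      by_cases hj : j = i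
      · rw [hj, hs, vertexIdm, env_mul, socle_mul_idm h3, idm_mul_socle h3]
      · rw [hs' j hj, zero_mul]
    · rw [Fintype.linearCombination_apply_single, env_smul, socle_mul_idm h3,
        socle_mul h3 i (socle_mem_filt h3 i)]
  have h0 : envForm (symForm h3)
      ((socle T m c i ⊗ₜ op (socle T m c i)) * envFlip K Λ (x i)) = 0 := by
    have := dualPairing_linearCombination (τ := envForm (symForm h3)) envFlip_envFlip
      envFlip_mul (diffMat T m c) y x
    rw [hy, h, map_zero, LinearMap.zero_apply, dualPairing_apply, Finset.sum_eq_single i] at this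
    · rwa [hs] at this
    · intro j _ hj
      rw [hs' j hj, zero_mul, map_zero]
    · simp
  have := mul_vertexIdm_sub_mem_jacobson h3 i (x i)
  rwa [h0, zero_smul, sub_zero, hx i] at this

variable (c) in
/-- The self-dual presentation of a weighted triangulation algebra as a bimodule. -/
theorem selfDualPresentation [Fintype E] (h3 : ∀ α, 3 ≤ T.wt m α) (hV : 3 ≤ Fintype.card V)
    (hT : ¬ T.IsTetrahedral m) :
    SelfDualPresentation (envFlip K Λ) (envForm (symForm h3))
      ((LinearMap.mul K Λ).compr₂ (symForm h3)) (vertexIdm T m c) (arrowIdm T m c) (idm T m c)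
      (diffMat T m c) (relMat T m c) where
  invol := envFlip_envFlip
  anti := envFlip_mul
  trace := envForm_mul_comm (symForm_mul_comm h3)
  nondeg := by
    have := finite_weighted (c := c) h3
    exact envForm_nondeg (symForm_mul_comm h3) fun _ => eq_zero_of_symForm h3
  idem₀ := vertexIdm_mul_self
  idem₁ := arrowIdm_mul_self
  self₀ := envFlip_vertexIdm
  source_v := vertexIdm_smul_idm
  source_d := arrowIdm_mul_diffMat
  target_d := diffMat_mul_vertexIdm
  target_r := relMat_mul_arrowIdm
  symm_r := envFlip_relMat
  rad_d := diffMat_mem_jacobson h3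
  rad_d' := envFlip_diffMat_mem_jacobson h3
  rad_r := relMat_mem_jacobson h3
  surj := linearCombination_idm_surjective
  complex₀ := linearCombination_idm_diffMat
  exact₀ := fun _ => exact_diffMat
  complex₁ := linearCombination_diffMat_relMat
  exact₁ := fun _ => exact_relMat h3 hV hT
  form_smul := form_env_smul (symForm_mul_comm h3)
  form_nondeg := fun _ => eq_zero_of_symForm h3
  rad_ker := fun _ => mem_jacobson_of_linearCombination_flip h3

end Presentation

end TriangulationQuiver

/-- Every coordinate of an image is a sum of terms containing some ε_a as a factor, so χ annihilates
it. The idempotent ε'_b is then out of reach. -/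
theorem not_surjective_of_character {R k : Type*} [Ring R] [Field k] (χ : R →+* k) {ι κ : Type*}
    [Fintype ι] {ε : ι → R} {ε' : κ → R} (hε : ∀ a, ε a * ε a = ε a) (h : ∀ a, χ (ε a) = 0) {b : κ}
    (hb : ε' b * ε' b = ε' b) (h' : χ (ε' b) = 1) (f : projMod ε →ₗ[R] projMod ε') :
    ¬ Function.Surjective f := by
  classical
  intro hf
  have hmem : (Pi.single b (ε' b) : κ → R) ∈ projMod ε' := fun a => by
    by_cases ha : a = b
    · subst ha
      rw [Pi.single_eq_same, hb]
    · rw [Pi.single_eq_of_ne ha, zero_mul]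
  obtain ⟨x, hx⟩ := hf ⟨_, hmem⟩
  have hxb : (f x : κ → R) b = ε' b := by rw [hx]; simp
  have hs : ∀ a, ε a • toProjMod ε hε (Pi.single a 1) = toProjMod ε hε (Pi.single a 1) := by
    intro a
    rw [← map_smul]
    ext a'
    by_cases ha : a' = a
    · subst ha
      simp [toProjMod, hε]
    · simp [toProjMod, ha]
  have hsum : x = ∑ a, (x : ι → R) a • toProjMod ε hε (Pi.single a 1) := by
    ext a
    simp [toProjMod, Pi.single_apply, Finset.sum_apply, x.2 a]
  have key : χ ((f x : κ → R) b) = 0 := by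
    rw [hsum, map_sum, Submodule.coe_sum, Finset.sum_apply, map_sum]
    refine Finset.sum_eq_zero fun a _ => ?_
    rw [map_smul, ← hs a, map_smul, Submodule.coe_smul, Submodule.coe_smul, Pi.smul_apply,
      Pi.smul_apply, smul_eq_mul, smul_eq_mul, map_mul, map_mul, h, zero_mul, mul_zero]
  rw [hxb, h'] at key
  exact one_ne_zero key

namespace TriangulationQuiver

open MulOpposite

theorem exists_source_ne_target {V E : Type*} [Fintype V] (T : TriangulationQuiver V E)
    (hV : 3 ≤ Fintype.card V) : ∃ α, T.source α ≠ T.target α := by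
  by_contra! h
  have : Fintype.card V ≤ 1 := by
    refine Fintype.card_le_one_iff.2 fun i j => ?_
    induction T.connected i j with
    | rel x y h' =>
      obtain ⟨α, rfl, rfl⟩ := h'
      exact h α
    | refl x => rfl
    | symm x y _ ih => exact ih.symm
    | trans x y z _ _ ih ih' => exact ih.trans ih'
  omega

/-! ### Characters at pairs of vertices, excluding period 2 -/

section Character

variable {K : Type*} [Field K] {V E : Type*} [Fintype V] {T : TriangulationQuiver V E}
  {m : T.Orbit → ℕ+} {c : T.Orbit → Kˣ}

local notation "Λ" => WeightedAlgebra T m c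
local notation "Λᵉ" => WeightedAlgebra T m c ⊗[K] (WeightedAlgebra T m c)ᵐᵒᵖ

open Classical in
variable (K T) in
/-- The one-dimensional representation of the path algebra at a vertex. -/
def pathChar (i : V) : PathAlgebra K T →ₐ[K] K :=
  liftPath (K := K) (fun j => if j = i then (1 : K) else 0)
    (fun _ => 0) (fun j => by split_ifs <;> simp) (fun j j' h => by
      split_ifs with h1 h2
      · exact absurd (h1.trans h2.symm) h
      all_goals simp) (by simp) (fun _ => mul_zero _) (fun _ => zero_mul _)

theorem pathChar_arrow (i : V) (α : E) : pathChar K T i (arrow K T α) = 0 :=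
  liftPath_arrow _ _ _ _ _ _ _ α

open Classical in
theorem pathChar_vertex (i j : V) : pathChar K T i (vertex K T j) = if j = i then 1 else 0 :=
  liftPath_vertex _ _ _ _ _ _ _ j

variable (T m c) in
/-- The one-dimensional representation at a vertex. -/
def vertexChar (h3 : ∀ α, 3 ≤ T.wt m α) (i : V) : Λ →ₐ[K] K :=
  liftWeighted (pathChar K T i) (fun α => by
    obtain ⟨n, hn⟩ : ∃ n, T.wt m (T.bar α) - 1 = n + 1 :=
      ⟨T.wt m (T.bar α) - 2, by have := h3 (T.bar α); omega⟩
    rw [hn, gPath_succ, map_mul, pathChar_arrow, pathChar_arrow, pathChar_arrow, zero_mul,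
      zero_mul, smul_zero])
    (fun α => by rw [pathChar_arrow, zero_mul, zero_mul])

open Classical in
theorem vertexChar_idm (h3 : ∀ α, 3 ≤ T.wt m α) (i j : V) :
    vertexChar T m c h3 i (idm T m c j) = if j = i then 1 else 0 :=
  (liftWeighted_toWeighted _ _ _ _).trans (pathChar_vertex i j)

variable (T m c) in
/-- The one-dimensional bimodule at a pair of vertices. -/
def envChar (h3 : ∀ α, 3 ≤ T.wt m α) (i j : V) : Λᵉ →ₐ[K] K :=
  Algebra.TensorProduct.lift (vertexChar T m c h3 i)
    ((vertexChar T m c h3 j).fromOpposite fun _ _ => Commute.all _ _) fun _ _ => Commute.all _ _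

theorem envChar_tmul (h3 : ∀ α, 3 ≤ T.wt m α) (i j : V) (a b : Λ) :
    envChar T m c h3 i j (a ⊗ₜ op b) = vertexChar T m c h3 i a * vertexChar T m c h3 j b :=
  Algebra.TensorProduct.lift_tmul _ _ _ _ _

attribute [local instance] envModule

/-- The idempotents of P₀ are diagonal, whereas P₂ contains the one at (target γ, source γ) for each
arrow γ. If γ is not a loop, the character at that pair separates the two modules. -/
theorem not_isSyzygy_two [Fintype E] (h3 : ∀ α, 3 ≤ T.wt m α) (hV : 3 ≤ Fintype.card V)
    (hT : ¬ T.IsTetrahedral m) : ¬ IsSyzygy Λᵉ 2 Λ Λ := by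
  intro h
  have := finite_weighted (c := c) h3
  obtain ⟨f⟩ := (selfDualPresentation c h3 hV hT).nonempty_equiv_of_isSyzygy_two h
  obtain ⟨γ, hγ⟩ := T.exists_source_ne_target hV
  refine not_surjective_of_character
    (envChar T m c h3 (T.target γ) (T.source γ) : Λᵉ →+* K) vertexIdm_mul_self (fun i => ?_)
    (b := γ) ?_ ?_ f.toLinearMap f.surjective
  · change envChar T m c h3 _ _ (vertexIdm T m c i) = 0
    rw [vertexIdm, envChar_tmul, vertexChar_idm, vertexChar_idm]
    split_ifs with h1 h2
    · exact absurd (h2.symm.trans h1) hγ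
    all_goals simp
  · rw [← envFlip_mul, arrowIdm_mul_self]
  · change envChar T m c h3 _ _ (envFlip K Λ (arrowIdm T m c γ)) = 1
    rw [arrowIdm, envFlip_tmul, envChar_tmul, vertexChar_idm, vertexChar_idm, if_pos rfl,
      if_pos rfl, one_mul]

end Character

end TriangulationQuiver

end

/-! ### The main theorem -/

theorem theorem7p4 {K : Type*} [Field K] [IsAlgClosed K]
    {V E : Type*} [Fintype V] [Finite E] (T : TriangulationQuiver V E)
    (hV : 3 ≤ Fintype.card V)
    (m : T.Orbit → ℕ+) (c : T.Orbit → Kˣ)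
    (hmn : ∀ α : E, 3 ≤ (m (T.orbit α) : ℕ) * T.orbitLength α)
    (hT : ¬ T.IsTetrahedral m) :
    BimoduleSyzygyIsoSelf K (T.WeightedAlgebra m c) 4 ∧
      IsPeriodicAlgebraOfPeriod K (T.WeightedAlgebra m c) 4 := by
  cases nonempty_fintype E
  let _ := envModule K (T.WeightedAlgebra m c)
  have hfin := TriangulationQuiver.finite_weighted (c := c) hmn
  have h4 : BimoduleSyzygyIsoSelf K (T.WeightedAlgebra m c) 4 := by
    have := env_isScalarTower (K := K) (A := T.WeightedAlgebra m c)
    exact (TriangulationQuiver.selfDualPresentation c hmn hV hT).isSyzygy_four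
  have h2 : ¬ BimoduleSyzygyIsoSelf K (T.WeightedAlgebra m c) 2 :=
    TriangulationQuiver.not_isSyzygy_two hmn hV hT
  refine ⟨h4, hfin, ⟨by norm_num, h4⟩, ?_⟩
  rintro n ⟨hn, h⟩
  by_contra! hlt
  interval_cases n
  -- Period 1 gives Ω² ≅ id on Λ by composing twice. Below, period 3 together with Ω⁴(Λ) ≅ Λ gives
  -- period 1.
  · exact h2 (IsSyzygy.add h h)
  · exact h2 h
  · have h1 : BimoduleSyzygyIsoSelf K (T.WeightedAlgebra m c) 1 :=
      IsSyzygy.sub (n := 3) (k := 1) h h4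
    exact h2 (IsSyzygy.add h1 h1)
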